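/- Let $m\ge 1$, $T_0,\dots,T_m>0$, $a\in\mathbb R\setminus\{0\}$, $\mathbf T:=\sum_{j=0}^m T_j$, and let $q_j\in L_2(0,T_j)$ ($0\le j\le m$) be real-valued with $\int_0^{T_j}q_j(t)\,dt=0$. Let $\mathcal L$ be the boundary value problem $$-y_j''+q_jy_j=\lambda y_j \ \text{ on } (0,T_j),\ 0\le j\le m,\qquad y_j(0)=0,\ 1\le j\le m,$$ $$y_0(0)=a\,y_0(T_0)=y_j(T_j),\ 1\le j\le m,\qquad y_0'(0)=a^{-1}y_0'(T_0)+\sum_{j=1}^m y_j'(T_j).$$ Let $S_j(x,\lambda)$, $C_j(x,\lambda)$ be the solutions of $-y''+q_jy=\lambda y$ on $[0,T_j]$ with $S_j(0,\lambda)=C_j'(0,\lambda)=0$, $S_j'(0,\lambda)=C_j(0,\lambda)=1$. Put $h(\lambda)=S_0(T_0,\lambda)$, $d(\lambda)=aC_0(T_0,\lambda)+a^{-1}S_0'(T_0,\lambda)$ and, writing $s_j=S_j(T_j,\lambda)$, $s_j'=S_j'(T_j,\lambda)$, $c_k=C_k(T_k,\lambda)$, $c_k'=C_k'(T_k,\lambda)$,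 $$\Delta(\lambda)=(d(\lambda)-2)\prod_{j=1}^m s_j+a\,h(\lambda)\sum_{r=1}^m s_r'\prod_{j\ne r}s_j,$$ $$\Delta_k(\lambda)=(d(\lambda)-2)\,c_k\prod_{j\ne k}s_j+a\,h(\lambda)\Bigl(c_k'\prod_{j\ne k}s_j+c_k\sum_{r\ne k}s_r'\prod_{j\ne r,k}s_j\Bigr),\qquad M_k=-\Delta_k/\Delta ,$$ where $j$ and $r$ run over $\{1,\dots,m\}$. Let $PW(\mathbf T)$ be the class of functions $\int_{-\mathbf T}^{\mathbf T}f(t)e^{i\rho t}\,dt$ with $f\in L_2(-\mathbf T,\mathbf T)$. For $\tau>0$ let $\Gamma_\tau=\{\rho^2:\operatorname{Im}\rho=\tau\}$; a point is inside $\Gamma_\tau$ if it equals $\rho^2$ with $|\operatorname{Im}\rho|<\tau$. There is a constant $C>0$ depending only on $\mathcal L$ such that for every $\tau_0>0$ for which all eigenvalues of $\mathcal L$ lie inside $\Gamma_{\tau_0}$ there is $\varepsilon>0$ (depending only on $\mathcal L$ and $\tau_0$) with the following property. Let $\tau\ge\tau_0$, let $\Gamma=\Gamma_\tau$ with either orientation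 (in particular, the counter-clockwise one), let $k\in\{1,\dots,m\}$, and let $\tilde\Delta,\tilde\Delta_k$ be entire functions such that $$\rho^{m+1}(\Delta-\tilde\Delta)(\rho^2)\in PW(\mathbf T),\qquad \rho^m(\Delta_k-\tilde\Delta_k)(\rho^2)\in PW(\mathbf T),$$ $$\delta_k:=\|\rho^{m+1}(\Delta-\tilde\Delta)(\rho^2)\|_{L_2(\mathbb R)}+\|\rho^m(\Delta_k-\tilde\Delta_k)(\rho^2)\|_{L_2(\mathbb R)}\le\varepsilon .$$ Put $\tilde M=-\tilde\Delta_k/\tilde\Delta$, $\hat M=M_k-\tilde M$. Then $\Delta$ and $\tilde\Delta$ have no zeros on $\Gamma$, the integral $$F(x,t)=-\frac1{2\pi i}\int_\Gamma\hat M(\mu)S_k(x,\mu)S_k(t,\mu)\,d\mu,\qquad x,t\in[0,T_k],$$ converges absolutely, and: 1. for each $x\in[0,T_k]$ the equation $$K(x,t)+F(x,t)+\int_0^xK(x,s)F(s,t)\,ds=0,\qquad 0\le t\le x,$$ has a solution $K(x,\cdot)$ that is continuous on $[0,x]$ and is unique among the integrable functions on $[0,x]$ satisfying the equation for all $t\in[0,x]$;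 2. $K(x,x)$ is absolutely continuous on $[0,T_k]$ and $\frac{d}{dx}K(x,x)\in L_2(0,T_k)$; 3. with $\tilde q(x):=q_k(x)+2\frac{d}{dx}K(x,x)$, for every $\lambda\in\mathbb C$ the function $\tilde S(x,\lambda):=S_k(x,\lambda)+\int_0^xK(x,t)S_k(t,\lambda)\,dt$ solves $$-\tilde S''+\tilde q\,\tilde S=\lambda\tilde S\ \text{ on }(0,T_k),\qquad \tilde S(0,\lambda)=0,\quad \tilde S'(0,\lambda)=1;$$ 4. $\|q_k-\tilde q\|_{L_2(0,T_k)}\le C\delta_k$. -/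

import Mathlib

open MeasureTheory Set
open scoped ENNReal

namespace LoopGraph

/-- `y` is a (Carathéodory) solution on `[0, T]` of `-y'' + q y = lam y`, and `dy` is its derivative:
`y` is differentiable with derivative `dy`, and `dy` is absolutely continuous with
`dy' = (q - lam) y` almost everywhere, written in integrated form. -/
structure IsSLSolution (q : ℝ → ℂ) (T : ℝ) (lam : ℂ) (y dy : ℝ → ℂ) : Prop where
  hasDeriv : ∀ x ∈ Icc 0 T, HasDerivWithinAt y (dy x) (Icc 0 T) x
  integrable : IntervalIntegrable (fun t => (q t - lam) * y t) volume 0 T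
  eqn : ∀ x ∈ Icc 0 T, dy x = dy 0 + ∫ t in (0 : ℝ)..x, (q t - lam) * y t

/-- The pair `(y, y')` where `y` is the solution of `-y'' + q y = lam y` on `[0, T]` with
`y(0) = α`, `y'(0) = β`. For `q` integrable on `(0, T)` such a pair exists and is unique on
`[0, T]` (values outside `[0, T]` are irrelevant). -/
noncomputable def cauchySolution (q : ℝ → ℂ) (T : ℝ) (lam α β : ℂ) : (ℝ → ℂ) × (ℝ → ℂ) :=
  Classical.epsilon fun p => IsSLSolution q T lam p.1 p.2 ∧ p.1 0 = α ∧ p.2 0 = β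

/-- The boundary value problem `L(q)` on the graph with a loop `e₀` (index `0`) and `m` boundary
edges `e₁, …, e_m` (indices `j.succ`, `j : Fin m`), with real square-integrable potentials of
zero mean. -/
structure Problem (m : ℕ) where
  T : Fin (m + 1) → ℝ
  T_pos : ∀ j, 0 < T j
  a : ℝ
  a_ne_zero : a ≠ 0
  q : Fin (m + 1) → ℝ → ℝ
  q_memLp : ∀ j, MemLp (q j) 2 (volume.restrict (Ioc 0 (T j)))
  q_mean : ∀ j, ∫ t in (0 : ℝ)..T j, q j t = 0

variable {m : ℕ}

namespace Problem

/-- The potential on the edge `j` as a complex-valued function. -/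
def qc (P : Problem m) (j : Fin (m + 1)) : ℝ → ℂ := fun x => (P.q j x : ℂ)

/-- `S_j(x, lam)`: `S_j(0) = 0`, `S_j'(0) = 1`. -/
noncomputable def S (P : Problem m) (j : Fin (m + 1)) (x : ℝ) (lam : ℂ) : ℂ :=
  (cauchySolution (P.qc j) (P.T j) lam 0 1).1 x

/-- `S_j'(x, lam)`. -/
noncomputable def dS (P : Problem m) (j : Fin (m + 1)) (x : ℝ) (lam : ℂ) : ℂ :=
  (cauchySolution (P.qc j) (P.T j) lam 0 1).2 x

/-- `C_j(x, lam)`: `C_j(0) = 1`, `C_j'(0) = 0`. -/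
noncomputable def C (P : Problem m) (j : Fin (m + 1)) (x : ℝ) (lam : ℂ) : ℂ :=
  (cauchySolution (P.qc j) (P.T j) lam 1 0).1 x

/-- `C_j'(x, lam)`. -/
noncomputable def dC (P : Problem m) (j : Fin (m + 1)) (x : ℝ) (lam : ℂ) : ℂ :=
  (cauchySolution (P.qc j) (P.T j) lam 1 0).2 x

/-- `lam` is an eigenvalue of the boundary value problem: there is a nontrivial system of solutions
on the edges satisfying the Dirichlet conditions at the boundary vertices and the matching
conditions at the internal vertex. -/
def IsEigenvalue (P : Problem m) (lam : ℂ) : Prop :=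
  ∃ y dy : Fin (m + 1) → ℝ → ℂ,
    (∀ j, IsSLSolution (P.qc j) (P.T j) lam (y j) (dy j)) ∧
    (∀ j : Fin m, y j.succ 0 = 0) ∧
    y 0 0 = P.a * y 0 (P.T 0) ∧
    (∀ j : Fin m, y 0 0 = y j.succ (P.T j.succ)) ∧
    dy 0 0 = (P.a : ℂ)⁻¹ * dy 0 (P.T 0) + ∑ j : Fin m, dy j.succ (P.T j.succ) ∧
    ∃ j, ∃ x ∈ Icc 0 (P.T j), y j x ≠ 0

/-- `h(lam) = S₀(T₀, lam)`. -/
noncomputable def h (P : Problem m) (lam : ℂ) : ℂ := P.S 0 (P.T 0) lam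

/-- `d(lam) = a C₀(T₀, lam) + a⁻¹ S₀'(T₀, lam)`. -/
noncomputable def d (P : Problem m) (lam : ℂ) : ℂ :=
  P.a * P.C 0 (P.T 0) lam + (P.a : ℂ)⁻¹ * P.dS 0 (P.T 0) lam

/-- `S_j(T_j, lam)` on the `j`-th boundary edge. -/
noncomputable def sEnd (P : Problem m) (j : Fin m) (lam : ℂ) : ℂ := P.S j.succ (P.T j.succ) lam

/-- `S_j'(T_j, lam)` on the `j`-th boundary edge. -/
noncomputable def dsEnd (P : Problem m) (j : Fin m) (lam : ℂ) : ℂ := P.dS j.succ (P.T j.succ) lam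

/-- `C_j(T_j, lam)` on the `j`-th boundary edge. -/
noncomputable def cEnd (P : Problem m) (j : Fin m) (lam : ℂ) : ℂ := P.C j.succ (P.T j.succ) lam

/-- `C_j'(T_j, lam)` on the `j`-th boundary edge. -/
noncomputable def dcEnd (P : Problem m) (j : Fin m) (lam : ℂ) : ℂ := P.dC j.succ (P.T j.succ) lam

noncomputable def DeltaPi (P : Problem m) (lam : ℂ) : ℂ := ∏ j : Fin m, P.sEnd j lam

noncomputable def DeltaK (P : Problem m) (lam : ℂ) : ℂ :=
  ∑ r : Fin m, P.dsEnd r lam * ∏ j ∈ Finset.univ.erase r, P.sEnd j lam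

noncomputable def DeltaPiEdge (P : Problem m) (k : Fin m) (lam : ℂ) : ℂ :=
  P.cEnd k lam * ∏ j ∈ Finset.univ.erase k, P.sEnd j lam

noncomputable def DeltaKEdge (P : Problem m) (k : Fin m) (lam : ℂ) : ℂ :=
  P.dcEnd k lam * ∏ j ∈ Finset.univ.erase k, P.sEnd j lam +
    P.cEnd k lam * ∑ r ∈ Finset.univ.erase k,
      P.dsEnd r lam * ∏ j ∈ (Finset.univ.erase k).erase r, P.sEnd j lam

/-- The characteristic function `Δ` of the problem. -/
noncomputable def Delta (P : Problem m) (lam : ℂ) : ℂ :=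
  (P.d lam - 2) * P.DeltaPi lam + P.a * P.h lam * P.DeltaK lam

/-- The characteristic function `Δ_k` of the problem in which the condition `y_k(0) = 0` is replaced
by `y_k'(0) = 0`. -/
noncomputable def DeltaEdge (P : Problem m) (k : Fin m) (lam : ℂ) : ℂ :=
  (P.d lam - 2) * P.DeltaPiEdge k lam + P.a * P.h lam * P.DeltaKEdge k lam

/-- The total length of the graph. -/
noncomputable def totalLength (P : Problem m) : ℝ := ∑ j, P.T j

/-- The Weyl function `M_k = -Δ_k / Δ`. -/
noncomputable def weyl (P : Problem m) (k : Fin m) (lam : ℂ) : ℂ :=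
  -(P.DeltaEdge k lam / P.Delta lam)

end Problem

/-- The Paley–Wiener class `PW(T)`: functions `ρ ↦ ∫_{-T}^T f(t) exp(i ρ t) dt`, `f ∈ L₂(-T, T)`. -/
def PaleyWiener (T : ℝ) (G : ℂ → ℂ) : Prop :=
  ∃ f : ℝ → ℂ, MemLp f 2 (volume.restrict (Ioc (-T) T)) ∧
    ∀ ρ : ℂ, G ρ = ∫ t in (-T)..T, f t * Complex.exp (Complex.I * ρ * t)

/-- `lam` lies inside the parabola `Γ = {ρ² : Im ρ = τ}`, i.e. in the component containing `0` of the
complement of `Γ`. -/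
def InsideParabola (τ : ℝ) (lam : ℂ) : Prop := ∃ ρ : ℂ, ρ ^ 2 = lam ∧ |ρ.im| < τ

/-- The point `σ + i τ` of the line `γ`. -/
noncomputable def linePoint (τ σ : ℝ) : ℂ := σ + τ * Complex.I

/-- The integrand `g(μ) dμ` on `Γ` in the parameter `σ`, where `μ = θ²`, `θ = σ + i τ`,
`dμ = 2 θ dσ`. -/
noncomputable def parabolaIntegrand (τ : ℝ) (g : ℂ → ℂ) (σ : ℝ) : ℂ :=
  g (linePoint τ σ ^ 2) * (2 * linePoint τ σ)

/-- The integral `∫_Γ g(μ) dμ` with the counter-clockwise circuit, for which `σ` runs from `+∞`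
to `-∞`; hence the minus sign. -/
noncomputable def parabolaIntegral (τ : ℝ) (g : ℂ → ℂ) : ℂ := -∫ σ : ℝ, parabolaIntegrand τ g σ

/-- The function `μ ↦ M̂(μ) S_k(x, μ) S_k(t, μ)`, where `M̂ = M_k - M̃`, `M̃ = -Δ̃_k / Δ̃`;
here `D = Δ̃` and `Dk = Δ̃_k`. -/
noncomputable def spectralKernel (P : Problem m) (k : Fin m) (D Dk : ℂ → ℂ) (x t : ℝ) (μ : ℂ) : ℂ :=
  (P.weyl k μ - -(Dk μ / D μ)) * P.S k.succ x μ * P.S k.succ t μ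

/-- `F(x, t) = -(1 / 2πi) ∫_Γ M̂(μ) S_k(x, μ) S_k(t, μ) dμ`, where `Γ` is traversed
counter-clockwise if `o = 1` and clockwise if `o = -1`. -/
noncomputable def kernelF (P : Problem m) (k : Fin m) (D Dk : ℂ → ℂ) (τ : ℝ) (o : ℂ)
    (x t : ℝ) : ℂ :=
  -(1 / (2 * Real.pi * Complex.I)) * (o * parabolaIntegral τ (spectralKernel P k D Dk x t))

/-- For fixed `x`, the function `κ` on `[0, x]` solves the Gelfand–Levitan-type equation
`κ(t) + F(x, t) + ∫₀ˣ κ(s) F(s, t) ds = 0`, `0 ≤ t ≤ x`. -/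
def SolvesGL (F : ℝ → ℝ → ℂ) (x : ℝ) (κ : ℝ → ℂ) : Prop :=
  ∀ t ∈ Icc 0 x, κ t + F x t + ∫ s in (0 : ℝ)..x, κ s * F s t = 0

/-- `g` is absolutely continuous on `[0, T]` and `dg ∈ L₂(0, T)` is its derivative. -/
def HasL2Deriv (T : ℝ) (g dg : ℝ → ℂ) : Prop :=
  MemLp dg 2 (volume.restrict (Ioc 0 T)) ∧
    ∀ x ∈ Icc 0 T, g x = g 0 + ∫ t in (0 : ℝ)..x, dg t

/-- `δ_k = ‖ρ^{m+1} (Δ - Δ̃)(ρ²)‖ + ‖ρ^m (Δ_k - Δ̃_k)(ρ²)‖`, norms of `L₂(ℝ)`. -/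
noncomputable def deviation (P : Problem m) (k : Fin m) (D Dk : ℂ → ℂ) : ℝ≥0∞ :=
  eLpNorm (fun ρ : ℝ => (ρ : ℂ) ^ (m + 1) * (P.Delta ((ρ : ℂ) ^ 2) - D ((ρ : ℂ) ^ 2))) 2 volume +
  eLpNorm (fun ρ : ℝ => (ρ : ℂ) ^ m * (P.DeltaEdge k ((ρ : ℂ) ^ 2) - Dk ((ρ : ℂ) ^ 2))) 2 volume

end LoopGraph

/-! Put μ = θ², θ = σ + iτ. Up to a factor of modulus 1/π, F(x,t) is the integral of w(σ) θ S(x,θ²)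
S(t,θ²) dσ, where w is M̂ on the line Im θ = τ. The proof bounds w in L₂ by the deviation, and shows
that every weight of small L₂ norm produces a transformation kernel with ‖dK‖ bounded by a constant
times ‖w‖.

Bound on w. Multiplied by ρ^m exp(iρ𝐓), Δ(ρ²) is asymptotically a product of normalized sines times
`leadQuot`, and ia times `leadQuot` is a combination with nonnegative coefficients of values
(1+z)/(1-z), |z| < 1, so its real part is bounded below (`exists_le_norm_leadQuot`). A zero of Δ is
an eigenvalue (`isEigenvalue_of_Delta_eq_zero`), so Δ has no zeros for Im ρ ≥ τ₀ and the normalized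
reciprocal is bounded there. Plancherel controls Paley–Wiener functions on horizontal lines by their
norm on the real axis. The identity `weylDiff_eq` then gives Δ̃ ≠ 0 and ‖w‖ ≤ c δ_k.

Inverse step. For compactly supported w the problem is algebraic (`GLData`). Solutions are regarded
as elements s(x) of the Banach algebra of continuous functions of λ on a disc, and w as a functional
ν. With H(x)φ = ∫₀ˣ ν(sφ) s, the commutator of H(x) with multiplication by λ is a boundary term of
rank two. Hence Y = (1+H)⁻¹ s satisfies the equation with potential q + 2 (d/dx)K(x,x), where K(x,t)
= -ν(Y(x)s(t)).

A general w is truncated to [-n,n]. F is bounded by Cauchy–Schwarz because θSS = O(1/θ). The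
derivative G of F in x need not converge absolutely, but its leading part ∫ w cos(θx) sin(θt) is
handled by Plancherel, in the mean over t and in L₂ on the diagonal, where cos·sin is half the sine
of the doubled angle. The Gelfand–Levitan equations turn this into Lipschitz estimates for K and
dK/dx on the diagonal in terms of ‖w - w'‖ (`exists_stability`). They give the limit
(`exists_transformation`), and comparison with w = 0 gives the bound for dK.

Independence of τ. Once Δ and Δ̃ have no zeros in a half-plane, the integrand decays like 1/|ρ| in
strips, so F does not change when the line is moved. All estimates are made on one line Im θ = s
chosen from the problem alone. Therefore C does not depend on τ₀, and only ε does. -/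

namespace LoopGraph

open Filter Topology

/-! ### Absolutely continuous functions as primitives -/

section Primitive

variable {E F G : Type*} [NormedAddCommGroup E] [NormedSpace ℝ E]
  [NormedAddCommGroup F] [NormedSpace ℝ F] [NormedAddCommGroup G] [NormedSpace ℝ G]

/-- `f` is absolutely continuous on `[0, T]` with integrable derivative `f'`. -/
structure IsPrim (T : ℝ) (f f' : ℝ → E) : Prop where
  integrable : IntervalIntegrable f' volume 0 T
  eqn : ∀ x ∈ Icc 0 T, f x = f 0 + ∫ t in (0 : ℝ)..x, f' t

theorem AbsolutelyContinuousOnInterval.bilinear (L : E →L[ℝ] F →L[ℝ] G) {f : ℝ → E} {g : ℝ → F}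
    {a b : ℝ} (hf : AbsolutelyContinuousOnInterval f a b)
    (hg : AbsolutelyContinuousOnInterval g a b) :
    AbsolutelyContinuousOnInterval (fun x => L (f x) (g x)) a b := by
  obtain ⟨C, hC⟩ := hf.exists_bound
  obtain ⟨D, hD⟩ := hg.exists_bound
  unfold AbsolutelyContinuousOnInterval at hf hg
  apply squeeze_zero' ?_ ?_
    (by simpa using (hg.const_mul (‖L‖ * C)).add (hf.const_mul (‖L‖ * D)))
  · exact Filter.Eventually.of_forall <| fun _ ↦ Finset.sum_nonneg (fun i hi ↦ dist_nonneg)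
  rw [eventually_inf_principal]
  filter_upwards with (n, I) hnI
  simp only [Finset.mul_sum, ← Finset.sum_add_distrib]
  refine Finset.sum_le_sum fun i hi => ?_
  have h1 := hC _ (hnI.left i hi |>.left)
  have h2 := hD _ (hnI.left i hi |>.right)
  rw [dist_eq_norm, dist_eq_norm, dist_eq_norm]
  have : L (f (I i).1) (g (I i).1) - L (f (I i).2) (g (I i).2)
      = L (f (I i).1) (g (I i).1 - g (I i).2) + L (f (I i).1 - f (I i).2) (g (I i).2) := by
    simp
  rw [this]
  refine (norm_add_le _ _).trans (add_le_add ?_ ?_)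
  · refine (L.le_opNorm₂ _ _).trans ?_
    gcongr
  · refine (L.le_opNorm₂ _ _).trans ?_
    rw [mul_right_comm]
    gcongr

namespace IsPrim

variable {T : ℝ} {f f' g g' : ℝ → E}

theorem intervalIntegrable (h : IsPrim T f f') {x y : ℝ} (hx : x ∈ Icc 0 T) (hy : y ∈ Icc 0 T) :
    IntervalIntegrable f' volume x y := by
  apply h.integrable.mono_set
  have hT : (0 : ℝ) ≤ T := hx.1.trans hx.2
  rw [uIcc_of_le hT]
  exact uIcc_subset_Icc hx hy

theorem continuousOn (h : IsPrim T f f') (hT : 0 ≤ T) : ContinuousOn f (Icc 0 T) := by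
  have h1 : ContinuousOn (fun x => f 0 + ∫ t in (0 : ℝ)..x, f' t) (Icc 0 T) := by
    refine continuousOn_const.add ?_
    have := intervalIntegral.continuousOn_primitive_interval' h.integrable (left_mem_uIcc)
    rwa [uIcc_of_le hT] at this
  exact h1.congr h.eqn

theorem absolutelyContinuous (h : IsPrim T f f') (hT : 0 ≤ T) :
    AbsolutelyContinuousOnInterval f 0 T := by
  have h2 := h.integrable.norm.absolutelyContinuousOnInterval_intervalIntegral (c := 0) (by simp)
  rw [absolutelyContinuousOnInterval_iff] at h2 ⊢
  intro ε hε
  obtain ⟨δ, hδ, h3⟩ := h2 ε hε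
  refine ⟨δ, hδ, fun I hI hs => lt_of_le_of_lt (Finset.sum_le_sum fun i hi => ?_) (h3 I hI hs)⟩
  have hm := hI.1 i hi
  rw [uIcc_of_le hT] at hm
  have h0 : (0 : ℝ) ∈ Icc 0 T := ⟨le_rfl, hT⟩
  have i1 := h.intervalIntegrable h0 hm.1
  have i2 := h.intervalIntegrable h0 hm.2
  rw [h.eqn _ hm.1, h.eqn _ hm.2, dist_add_left, dist_eq_norm, dist_eq_norm,
    intervalIntegral.integral_interval_sub_left i1 i2,
    intervalIntegral.integral_interval_sub_left i1.norm i2.norm]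
  exact (intervalIntegral.norm_integral_le_abs_integral_norm).trans (Real.norm_eq_abs _).ge

/-- Lebesgue differentiation. The two endpoints are discarded as a null set, since `f` is a
primitive only inside `[0, T]`. -/
theorem ae_hasDerivAt [CompleteSpace E] (h : IsPrim T f f') (hT : 0 ≤ T) :
    ∀ᵐ x, x ∈ uIcc 0 T → HasDerivAt f (f' x) x := by
  have h1 := h.integrable.ae_hasDerivAt_integral
  have e0 : ∀ᵐ x : ℝ, x ≠ 0 := by simp [ae_iff]
  have eT : ∀ᵐ x : ℝ, x ≠ T := by simp [ae_iff]
  filter_upwards [h1, e0, eT] with x hx h0 h3 hm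
  have := hx hm 0 (by simp)
  rw [uIcc_of_le hT] at hm
  refine (this.const_add (f 0)).congr_of_eventuallyEq ?_
  have : Ioo 0 T ∈ 𝓝 x := Ioo_mem_nhds (lt_of_le_of_ne hm.1 h0.symm) (lt_of_le_of_ne hm.2 h3)
  filter_upwards [this] with y hy
  exact h.eqn y (Ioo_subset_Icc_self hy)

/-- The difference between `f` and the primitive of `f'` is absolutely continuous with derivative
zero almost everywhere, hence constant. -/
theorem of_ae_hasDerivAt [CompleteSpace E] (hT : 0 ≤ T)
    (hac : AbsolutelyContinuousOnInterval f 0 T)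
    (hi : IntervalIntegrable f' volume 0 T) (hd : ∀ᵐ x, x ∈ uIcc 0 T → HasDerivAt f (f' x) x) :
    IsPrim T f f' := by
  refine ⟨hi, ?_⟩
  have h1 : IsPrim T (fun x => ∫ t in (0 : ℝ)..x, f' t) f' := ⟨hi, by simp⟩
  obtain ⟨C, hC⟩ := (hac.sub (h1.absolutelyContinuous hT)).const_of_ae_hasDerivAt_zero (by
    filter_upwards [hd, hi.ae_hasDerivAt_integral] with x h2 h3 hx
    simpa using (h2 hx).sub (h3 hx 0 (by simp)))
  intro x hx
  have e0 := hC 0 (by simp)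
  have ex := hC x (by rwa [uIcc_of_le hT])
  simp only [Pi.sub_apply, intervalIntegral.integral_same, sub_zero] at e0 ex
  rw [e0, ← ex]; abel

/-- The product rule in the generality needed later: scalar products, algebra products, and an
operator-valued function applied to a vector-valued one. -/
theorem bilinear [CompleteSpace E] [CompleteSpace F] [CompleteSpace G]
    (L : E →L[ℝ] F →L[ℝ] G) {u u' : ℝ → E} {v v' : ℝ → F} (hT : 0 ≤ T)
    (hu : IsPrim T u u') (hv : IsPrim T v v') :
    IsPrim T (fun x => L (u x) (v x)) (fun x => L (u x) (v' x) + L (u' x) (v x)) := by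
  have cu := hu.continuousOn hT
  have cv := hv.continuousOn hT
  apply of_ae_hasDerivAt hT
  · exact AbsolutelyContinuousOnInterval.bilinear L (hu.absolutelyContinuous hT)
      (hv.absolutelyContinuous hT)
  · have iu := hu.integrable
    have iv := hv.integrable
    rw [intervalIntegrable_iff_integrableOn_Icc_of_le hT] at iu iv ⊢
    obtain ⟨Cu, hCu⟩ := isCompact_Icc.exists_bound_of_continuousOn cu
    obtain ⟨Cv, hCv⟩ := isCompact_Icc.exists_bound_of_continuousOn cv
    refine Integrable.add ?_ ?_
    · refine Integrable.mono' (g := fun x => ‖L‖ * Cu * ‖v' x‖) (iv.norm.const_mul _) ?_ ?_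
      · exact L.aestronglyMeasurable_comp₂ (cu.aestronglyMeasurable measurableSet_Icc)
          iv.aestronglyMeasurable
      · filter_upwards [ae_restrict_mem measurableSet_Icc] with x hx
        refine (L.le_opNorm₂ _ _).trans ?_
        gcongr
        exact hCu x hx
    · refine Integrable.mono' (g := fun x => ‖L‖ * Cv * ‖u' x‖) (iu.norm.const_mul _) ?_ ?_
      · exact L.aestronglyMeasurable_comp₂ iu.aestronglyMeasurable
          (cv.aestronglyMeasurable measurableSet_Icc)
      · filter_upwards [ae_restrict_mem measurableSet_Icc] with x hx
        refine (L.le_opNorm₂ _ _).trans ?_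
        rw [mul_right_comm]
        gcongr
        exact hCv x hx
  · filter_upwards [hu.ae_hasDerivAt hT, hv.ae_hasDerivAt hT] with x h1 h2 hx
    exact L.hasDerivAt_of_bilinear (fun _ => h1 hx) (fun _ => h2 hx)

theorem add (hf : IsPrim T f f') (hg : IsPrim T g g') :
    IsPrim T (fun x => f x + g x) (fun x => f' x + g' x) := by
  refine ⟨hf.integrable.add hg.integrable, fun x hx => ?_⟩
  have h0 : (0 : ℝ) ∈ Icc 0 T := ⟨le_rfl, hx.1.trans hx.2⟩
  rw [intervalIntegral.integral_add (hf.intervalIntegrable h0 hx) (hg.intervalIntegrable h0 hx),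
    hf.eqn x hx, hg.eqn x hx]
  abel

theorem sub (hf : IsPrim T f f') (hg : IsPrim T g g') :
    IsPrim T (fun x => f x - g x) (fun x => f' x - g' x) := by
  refine ⟨hf.integrable.sub hg.integrable, fun x hx => ?_⟩
  have h0 : (0 : ℝ) ∈ Icc 0 T := ⟨le_rfl, hx.1.trans hx.2⟩
  rw [intervalIntegral.integral_sub (hf.intervalIntegrable h0 hx) (hg.intervalIntegrable h0 hx),
    hf.eqn x hx, hg.eqn x hx]
  abel

theorem clm [CompleteSpace E] [CompleteSpace F] (L : E →L[ℝ] F) (hf : IsPrim T f f') :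
    IsPrim T (fun x => L (f x)) (fun x => L (f' x)) := by
  refine ⟨⟨L.integrable_comp hf.integrable.1, L.integrable_comp hf.integrable.2⟩, fun x hx => ?_⟩
  have h0 : (0 : ℝ) ∈ Icc 0 T := ⟨le_rfl, hx.1.trans hx.2⟩
  rw [L.intervalIntegral_comp_comm (hf.intervalIntegrable h0 hx), hf.eqn x hx, map_add]

theorem congr {f₁ f₁' : ℝ → E} (hf : IsPrim T f f') (h : ∀ x ∈ Icc 0 T, f₁ x = f x)
    (h' : ∀ x ∈ Icc 0 T, f₁' x = f' x) (hT : 0 ≤ T) : IsPrim T f₁ f₁' := by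
  have h0 : (0 : ℝ) ∈ Icc 0 T := ⟨le_rfl, hT⟩
  refine ⟨hf.integrable.congr fun x hx => (h' x ?_).symm, fun x hx => ?_⟩
  · rw [uIoc_of_le hT] at hx
    exact Ioc_subset_Icc_self hx
  · rw [h x hx, h 0 h0, hf.eqn x hx]
    congr 1
    refine intervalIntegral.integral_congr fun t ht => (h' t ?_).symm
    rw [uIcc_of_le hx.1] at ht
    exact ⟨ht.1, ht.2.trans hx.2⟩

theorem of_hasDerivAt [CompleteSpace E] (hT : 0 ≤ T) (h : ∀ x ∈ Icc 0 T, HasDerivAt f (f' x) x)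
    (hc : ContinuousOn f' (Icc 0 T)) : IsPrim T f f' := by
  have hi : IntervalIntegrable f' volume 0 T := by
    apply ContinuousOn.intervalIntegrable
    rwa [uIcc_of_le hT]
  refine ⟨hi, fun x hx => ?_⟩
  have hs : uIcc 0 x ⊆ Icc 0 T := by
    rw [uIcc_of_le hx.1]; exact Icc_subset_Icc_right hx.2
  rw [intervalIntegral.integral_eq_sub_of_hasDerivAt (fun t ht => h t (hs ht))]
  · abel
  · exact (hc.mono hs).intervalIntegrable

theorem hasDerivWithinAt [CompleteSpace E] (hf : IsPrim T f f') (hc : ContinuousOn f' (Icc 0 T))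
    {x : ℝ} (hx : x ∈ Icc 0 T) : HasDerivWithinAt f (f' x) (Icc 0 T) x := by
  have hT : 0 ≤ T := hx.1.trans hx.2
  have h0 : (0 : ℝ) ∈ Icc 0 T := ⟨le_rfl, hT⟩
  have hm : StronglyMeasurableAtFilter f' (𝓝[Icc 0 T] x) volume :=
    hc.stronglyMeasurableAtFilter_nhdsWithin measurableSet_Icc x
  have : Fact (x ∈ Icc 0 T) := ⟨hx⟩
  have := intervalIntegral.integral_hasDerivWithinAt_right (s := Icc 0 T) (t := Icc 0 T) (hf.intervalIntegrable h0 hx) hm (hc x hx)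
  exact (this.const_add (f 0)).congr hf.eqn (hf.eqn x hx)

theorem of_hasDerivWithinAt [CompleteSpace E] (hT : 0 ≤ T)
    (h : ∀ x ∈ Icc 0 T, HasDerivWithinAt f (f' x) (Icc 0 T) x)
    (hc : ContinuousOn f' (Icc 0 T)) : IsPrim T f f' := by
  have hi : IntervalIntegrable f' volume 0 T := by
    apply ContinuousOn.intervalIntegrable
    rwa [uIcc_of_le hT]
  refine ⟨hi, fun x hx => ?_⟩
  have hs : Icc 0 x ⊆ Icc 0 T := Icc_subset_Icc_right hx.2
  rw [intervalIntegral.integral_eq_sub_of_hasDeriv_right_of_le hx.1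
    (fun t ht => (h t (hs ht)).continuousWithinAt.mono hs)]
  · abel
  · intro t ht
    have h1 : Icc 0 T ∈ 𝓝 t := Icc_mem_nhds ht.1 (ht.2.trans_le hx.2)
    exact ((h t (hs (Ioo_subset_Icc_self ht))).hasDerivAt h1).hasDerivWithinAt
  · apply ContinuousOn.intervalIntegrable
    rw [uIcc_of_le hx.1]
    exact hc.mono hs

end IsPrim

end Primitive

theorem isSLSolution_iff {q : ℝ → ℂ} {T : ℝ} {lam : ℂ} {y dy : ℝ → ℂ} (hT : 0 ≤ T) :
    IsSLSolution q T lam y dy ↔ IsPrim T y dy ∧ IsPrim T dy (fun t => (q t - lam) * y t) := by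
  constructor
  · intro h
    have h2 : IsPrim T dy (fun t => (q t - lam) * y t) := ⟨h.integrable, h.eqn⟩
    exact ⟨.of_hasDerivWithinAt hT h.hasDeriv (h2.continuousOn hT), h2⟩
  · rintro ⟨h1, h2⟩
    exact ⟨fun x hx => h1.hasDerivWithinAt (h2.continuousOn hT) hx, h2.integrable, h2.eqn⟩

/-! ### Solutions by Volterra operators and their analyticity in the spectral parameter -/

section Volterra

variable {T : ℝ} (hT : 0 ≤ T)

/-- Extension of a continuous function on `[0, T]` to the line. -/
noncomputable def ext (g : C(Icc (0 : ℝ) T, ℂ)) (t : ℝ) : ℂ := g (projIcc 0 T hT t)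

theorem continuous_ext (g : C(Icc (0 : ℝ) T, ℂ)) : Continuous (ext hT g) :=
  g.continuous.comp continuous_projIcc

theorem ext_apply (g : C(Icc (0 : ℝ) T, ℂ)) {t : ℝ} (ht : t ∈ Icc 0 T) : ext hT g t = g ⟨t, ht⟩ := by
  rw [ext, projIcc_of_mem hT ht]

theorem norm_ext_le (g : C(Icc (0 : ℝ) T, ℂ)) (t : ℝ) : ‖ext hT g t‖ ≤ ‖g‖ := g.norm_coe_le_norm _

theorem intervalIntegrable_mul_ext {k : ℝ → ℂ} (hk : IntervalIntegrable k volume 0 T)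
    (g : C(Icc (0 : ℝ) T, ℂ)) : IntervalIntegrable (fun t => k t * ext hT g t) volume 0 T :=
  hk.mul_continuousOn (continuous_ext hT g).continuousOn

theorem subinterval {E : Type*} [NormedAddCommGroup E] {k : ℝ → E}
    (hk : IntervalIntegrable k volume 0 T) {x : ℝ}
    (hx : x ∈ Icc 0 T) : IntervalIntegrable k volume 0 x := by
  apply hk.mono_set
  rw [uIcc_of_le hx.1, uIcc_of_le (hx.1.trans hx.2)]
  exact Icc_subset_Icc_right hx.2

/-- The operator `g ↦ ∫₀ˣ k g` on continuous functions. -/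
noncomputable def primOp (k : ℝ → ℂ) (hk : IntervalIntegrable k volume 0 T) :
    C(Icc (0 : ℝ) T, ℂ) →L[ℂ] C(Icc (0 : ℝ) T, ℂ) :=
  LinearMap.mkContinuous
    { toFun := fun g =>
        ⟨fun x => ∫ t in (0 : ℝ)..x, k t * ext hT g t, by
          have : IsPrim T (fun x => ∫ t in (0 : ℝ)..x, k t * ext hT g t)
            (fun t => k t * ext hT g t) := ⟨intervalIntegrable_mul_ext hT hk g, by simp⟩
          exact (continuousOn_iff_continuous_domRestrict.1 (this.continuousOn hT))⟩
      map_add' := fun g₁ g₂ => by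
        ext x
        change (∫ t in (0 : ℝ)..x, k t * LoopGraph.ext hT (g₁ + g₂) t) =
          (∫ t in (0 : ℝ)..x, k t * LoopGraph.ext hT g₁ t) +
            ∫ t in (0 : ℝ)..x, k t * LoopGraph.ext hT g₂ t
        rw [← intervalIntegral.integral_add
          (subinterval (intervalIntegrable_mul_ext hT hk g₁) x.2)
          (subinterval (intervalIntegrable_mul_ext hT hk g₂) x.2)]
        simp [LoopGraph.ext, mul_add]
      map_smul' := fun c g => by
        ext x
        change (∫ t in (0 : ℝ)..x, k t * LoopGraph.ext hT (c • g) t) =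
          c * ∫ t in (0 : ℝ)..x, k t * LoopGraph.ext hT g t
        rw [← intervalIntegral.integral_const_mul]
        congr 1; ext t
        simp [LoopGraph.ext]; ring }
    (∫ t in (0 : ℝ)..T, ‖k t‖) (fun g => by
      have h0 : 0 ≤ ∫ t in (0 : ℝ)..T, ‖k t‖ :=
        intervalIntegral.integral_nonneg hT fun _ _ => norm_nonneg _
      rw [ContinuousMap.norm_le _ (by positivity)]
      intro x
      change ‖∫ t in (0 : ℝ)..x, k t * LoopGraph.ext hT g t‖ ≤ _
      calc _ ≤ ∫ t in (0 : ℝ)..x, ‖k t‖ * ‖g‖ := by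
            refine intervalIntegral.norm_integral_le_of_norm_le x.2.1 (ae_of_all _ fun t _ => ?_)
              ((subinterval hk x.2).norm.mul_const _)
            rw [norm_mul]
            gcongr
            exact norm_ext_le hT g t
        _ = (∫ t in (0 : ℝ)..x, ‖k t‖) * ‖g‖ := intervalIntegral.integral_mul_const _ _
        _ ≤ _ := by
          gcongr
          exact intervalIntegral.integral_mono_interval le_rfl x.2.1 x.2.2
            (ae_of_all _ fun _ => norm_nonneg _) hk.norm)

theorem primOp_apply (k : ℝ → ℂ) (hk : IntervalIntegrable k volume 0 T)
    (g : C(Icc (0 : ℝ) T, ℂ)) (x : Icc (0 : ℝ) T) :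
    primOp hT k hk g x = ∫ t in (0 : ℝ)..x, k t * ext hT g t := rfl

theorem intervalIntegrable_one : IntervalIntegrable (fun _ => (1 : ℂ)) volume 0 T := by simp

variable {q : ℝ → ℂ} (hq : IntervalIntegrable q volume 0 T)

/-- The operator `g ↦ ∫₀ˣ (q - lam) g`. -/
noncomputable def potOp (lam : ℂ) : C(Icc (0 : ℝ) T, ℂ) →L[ℂ] C(Icc (0 : ℝ) T, ℂ) :=
  primOp hT q hq - lam • primOp hT (fun _ => 1) intervalIntegrable_one

theorem potOp_apply (lam : ℂ) (g : C(Icc (0 : ℝ) T, ℂ)) (x : Icc (0 : ℝ) T) :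
    potOp hT hq lam g x = ∫ t in (0 : ℝ)..x, (q t - lam) * ext hT g t := by
  have h1 := subinterval (intervalIntegrable_mul_ext hT hq g) x.2
  have h2 := (subinterval (intervalIntegrable_mul_ext hT intervalIntegrable_one g) x.2).const_mul lam
  simp only [potOp, _root_.sub_apply, _root_.smul_apply,
    ContinuousMap.sub_apply, ContinuousMap.smul_apply, primOp_apply, smul_eq_mul]
  rw [← intervalIntegral.integral_const_mul, ← intervalIntegral.integral_sub h1 h2]
  congr 1; ext t; ring

/-- The Volterra operator `g ↦ ∫₀ˣ ∫₀ᵗ (q - lam) g`. -/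
noncomputable def volterraOp (lam : ℂ) : C(Icc (0 : ℝ) T, ℂ) →L[ℂ] C(Icc (0 : ℝ) T, ℂ) :=
  primOp hT (fun _ => 1) intervalIntegrable_one * potOp hT hq lam

theorem volterraOp_apply (lam : ℂ) (g : C(Icc (0 : ℝ) T, ℂ)) (x : Icc (0 : ℝ) T) :
    volterraOp hT hq lam g x = ∫ t in (0 : ℝ)..x, ext hT (potOp hT hq lam g) t := by
  simp [volterraOp, primOp_apply]

/-- In each double integration the inner integral costs only the L¹ norm of `q - lam`, and the outer
one raises the power of `x`, which produces the factorial. -/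
theorem norm_volterraOp_pow_apply_le (lam : ℂ) (g : C(Icc (0 : ℝ) T, ℂ)) (n : ℕ)
    (x : Icc (0 : ℝ) T) :
    ‖(volterraOp hT hq lam ^ n) g x‖ ≤
      (∫ t in (0 : ℝ)..T, ‖q t - lam‖) ^ n * ‖g‖ * ((x : ℝ) ^ n / n.factorial) := by
  have hk : IntervalIntegrable (fun t => q t - lam) volume 0 T := hq.sub (by simp)
  set A := ∫ t in (0 : ℝ)..T, ‖q t - lam‖ with hA
  have hA0 : 0 ≤ A := intervalIntegral.integral_nonneg hT fun _ _ => norm_nonneg _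
  induction n generalizing x with
  | zero => simpa using g.norm_coe_le_norm x
  | succ n ih =>
    set G := (volterraOp hT hq lam ^ n) g
    have e : (volterraOp hT hq lam ^ (n + 1)) g = volterraOp hT hq lam G := by
      rw [pow_succ']; rfl
    rw [e, volterraOp_apply]
    have hb : ∀ s ∈ Icc (0 : ℝ) T, ‖ext hT (potOp hT hq lam G) s‖ ≤
        A ^ (n + 1) * ‖g‖ * (s ^ n / n.factorial) := by
      intro s hs
      rw [ext_apply hT _ hs, potOp_apply]
      calc _ ≤ ∫ t in (0 : ℝ)..s, ‖q t - lam‖ * (A ^ n * ‖g‖ * (s ^ n / n.factorial)) := by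
            refine intervalIntegral.norm_integral_le_of_norm_le hs.1 (ae_of_all _ fun t ht => ?_)
              ((subinterval hk hs).norm.mul_const _)
            rw [norm_mul, ext_apply hT _ ⟨ht.1.le, ht.2.trans hs.2⟩]
            gcongr
            refine (ih _).trans ?_
            have := ht.1.le
            have := ht.2
            gcongr
        _ = (∫ t in (0 : ℝ)..s, ‖q t - lam‖) * (A ^ n * ‖g‖ * (s ^ n / n.factorial)) :=
            intervalIntegral.integral_mul_const _ _
        _ ≤ A * (A ^ n * ‖g‖ * (s ^ n / n.factorial)) := by
          have := hs.1
          gcongr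
          exact intervalIntegral.integral_mono_interval le_rfl hs.1 hs.2
            (ae_of_all _ fun _ => norm_nonneg _) hk.norm
        _ = _ := by ring
    calc _ ≤ ∫ s in (0 : ℝ)..x, A ^ (n + 1) * ‖g‖ * (s ^ n / n.factorial) := by
          refine intervalIntegral.norm_integral_le_of_norm_le x.2.1 (ae_of_all _ fun t ht => ?_) ?_
          · exact hb t ⟨ht.1.le, ht.2.trans x.2.2⟩
          · apply Continuous.intervalIntegrable; fun_prop
      _ = A ^ (n + 1) * ‖g‖ * ((x : ℝ) ^ (n + 1) / (n + 1).factorial) := by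
          rw [intervalIntegral.integral_const_mul, intervalIntegral.integral_div, integral_pow]
          simp only [Nat.factorial_succ]
          push_cast
          field_simp
          simp

/-- The element `1 - a` is a factor of the unit `1 - a ^ n`, and its cofactor, a geometric sum,
commutes with it. -/
theorem isUnit_one_sub_of_norm_pow_lt {R : Type*} [NormedRing R] [CompleteSpace R] (a : R) (n : ℕ)
    (h : ‖a ^ n‖ < 1) : IsUnit (1 - a) := by
  have hu : IsUnit (1 - a ^ n) := isUnit_one_sub_of_norm_lt_one h
  have h1 : (1 - a) * (∑ i ∈ Finset.range n, a ^ i) = 1 - a ^ n := mul_neg_geom_sum a n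
  have h2 : (∑ i ∈ Finset.range n, a ^ i) * (1 - a) = 1 - a ^ n := geom_sum_mul_neg a n
  have hc : Commute (1 - a) (∑ i ∈ Finset.range n, a ^ i) := by
    rw [Commute, SemiconjBy, h1, h2]
  rw [← h1] at hu
  exact (hc.isUnit_mul_iff.1 hu).1

theorem isUnit_one_sub_volterraOp (lam : ℂ) : IsUnit (1 - volterraOp hT hq lam) := by
  set A := ∫ t in (0 : ℝ)..T, ‖q t - lam‖ with hA
  have hA0 : 0 ≤ A := intervalIntegral.integral_nonneg hT fun _ _ => norm_nonneg _
  have ht := FloorSemiring.tendsto_pow_div_factorial_atTop (A * T)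
  obtain ⟨n, hn⟩ := (ht.eventually (gt_mem_nhds (zero_lt_one' ℝ))).exists
  refine isUnit_one_sub_of_norm_pow_lt (volterraOp hT hq lam) n (lt_of_le_of_lt ?_ hn)
  refine ContinuousLinearMap.opNorm_le_bound _ (by positivity) fun g => ?_
  rw [ContinuousMap.norm_le _ (by positivity)]
  intro x
  refine (norm_volterraOp_pow_apply_le hT hq lam g n x).trans ?_
  have := x.2.1
  have := x.2.2
  calc _ ≤ A ^ n * ‖g‖ * (T ^ n / n.factorial) := by gcongr
    _ = _ := by rw [mul_pow]; ring

/-- The function `α + β x`. -/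
noncomputable def affineFun (T : ℝ) (α β : ℂ) : C(Icc (0 : ℝ) T, ℂ) :=
  ⟨fun x => α + β * (x : ℝ), by fun_prop⟩

/-- The solution with initial data `α`, `β` as a function of the spectral parameter. -/
noncomputable def solFun (α β lam : ℂ) : C(Icc (0 : ℝ) T, ℂ) :=
  Ring.inverse (1 - volterraOp hT hq lam) (affineFun T α β)

/-- The derivative of the solution with initial data `α`, `β`. -/
noncomputable def dsolFun (α β lam : ℂ) : C(Icc (0 : ℝ) T, ℂ) :=
  ContinuousMap.const _ β + potOp hT hq lam (solFun hT hq α β lam)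

theorem differentiable_pencil {R : Type*} [NormedRing R] [NormedAlgebra ℂ R] (A B : R) :
    Differentiable ℂ fun lam : ℂ => A - lam • B := by
  fun_prop

/-- Inversion is holomorphic on units. This is why all solutions are entire in `lam`, with values in
the continuous functions of `x`. -/
theorem differentiable_inverse_pencil {R : Type*} [NormedRing R] [NormedAlgebra ℂ R]
    [CompleteSpace R] (J A B : R) (hu : ∀ lam : ℂ, IsUnit (1 - J * (A - lam • B))) :
    Differentiable ℂ fun lam : ℂ => Ring.inverse (1 - J * (A - lam • B)) := by
  intro lam
  have h1 : DifferentiableAt ℂ (fun lam : ℂ => 1 - J * (A - lam • B)) lam := by fun_prop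
  exact (differentiableAt_inverse (𝕜 := ℂ) (hu lam)).comp lam h1

theorem differentiable_potOp : Differentiable ℂ (potOp hT hq) :=
  differentiable_pencil (primOp hT q hq) _

theorem differentiable_solFun (α β : ℂ) : Differentiable ℂ (solFun hT hq α β) := by
  have := differentiable_inverse_pencil (primOp hT (fun _ => 1) intervalIntegrable_one)
    (primOp hT q hq) (primOp hT (fun _ => 1) intervalIntegrable_one)
    (isUnit_one_sub_volterraOp hT hq)
  exact this.clm_apply (differentiable_const _)

theorem differentiable_dsolFun (α β : ℂ) : Differentiable ℂ (dsolFun hT hq α β) := by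
  unfold dsolFun
  exact (differentiable_const _).add
    ((differentiable_potOp hT hq).clm_apply (differentiable_solFun hT hq α β))

theorem solFun_eq (α β lam : ℂ) :
    solFun hT hq α β lam = affineFun T α β + volterraOp hT hq lam (solFun hT hq α β lam) := by
  have h := Ring.mul_inverse_cancel _ (isUnit_one_sub_volterraOp hT hq lam)
  have h2 := congrArg (fun f => f (affineFun T α β)) h
  change (1 - volterraOp hT hq lam) (solFun hT hq α β lam) = affineFun T α β at h2
  rw [← h2]
  simp

theorem isSLSolution_solFun (α β lam : ℂ) :
    IsSLSolution q T lam (ext hT (solFun hT hq α β lam)) (ext hT (dsolFun hT hq α β lam)) := by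
  have h0 : (0 : ℝ) ∈ Icc 0 T := ⟨le_rfl, hT⟩
  have e : ∀ x (hx : x ∈ Icc 0 T), ext hT (dsolFun hT hq α β lam) x =
      β + ∫ t in (0 : ℝ)..x, (q t - lam) * ext hT (solFun hT hq α β lam) t := by
    intro x hx
    rw [ext_apply hT _ hx, dsolFun, ContinuousMap.add_apply, potOp_apply]
    rfl
  rw [isSLSolution_iff hT]
  constructor
  · refine ⟨(continuous_ext hT _).intervalIntegrable _ _, fun x hx => ?_⟩
    have e2 : ∀ x (hx : x ∈ Icc 0 T), ext hT (solFun hT hq α β lam) x =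
        α + ∫ t in (0 : ℝ)..x, ext hT (dsolFun hT hq α β lam) t := by
      intro x hx
      conv_lhs => rw [ext_apply hT _ hx, solFun_eq, ContinuousMap.add_apply, volterraOp_apply]
      have : ∀ t, ext hT (dsolFun hT hq α β lam) t =
          β + ext hT (potOp hT hq lam (solFun hT hq α β lam)) t := fun t => rfl
      simp_rw [this]
      rw [intervalIntegral.integral_add (by simp) ((continuous_ext hT _).intervalIntegrable _ _)]
      simp [affineFun]
      ring
    rw [e2 x hx, e2 0 h0]
    simp
  · refine ⟨intervalIntegrable_mul_ext hT (hq.sub (by simp)) _, fun x hx => ?_⟩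
    rw [e x hx, e 0 h0]
    simp

theorem ext_solFun_zero (α β lam : ℂ) : ext hT (solFun hT hq α β lam) 0 = α := by
  have h0 : (0 : ℝ) ∈ Icc 0 T := ⟨le_rfl, hT⟩
  rw [ext_apply hT _ h0, solFun_eq, ContinuousMap.add_apply, volterraOp_apply]
  simp [affineFun]

theorem ext_dsolFun_zero (α β lam : ℂ) : ext hT (dsolFun hT hq α β lam) 0 = β := by
  have h0 : (0 : ℝ) ∈ Icc 0 T := ⟨le_rfl, hT⟩
  rw [ext_apply hT _ h0, dsolFun, ContinuousMap.add_apply, potOp_apply]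
  simp

/-- Uniqueness of the Cauchy problem: integrating twice, any solution satisfies `(1 - V) y = α + β
x` with the invertible `1 - V`. It identifies the solution picked by `cauchySolution` with `solFun`.
-/
theorem IsSLSolution.eq_solFun {lam : ℂ} {y dy : ℝ → ℂ}
    (h : IsSLSolution q T lam y dy) {x : ℝ} (hx : x ∈ Icc 0 T) :
    y x = ext hT (solFun hT hq (y 0) (dy 0) lam) x ∧
      dy x = ext hT (dsolFun hT hq (y 0) (dy 0) lam) x := by
  obtain ⟨h1, h2⟩ := (isSLSolution_iff hT).1 h
  have h0 : (0 : ℝ) ∈ Icc 0 T := ⟨le_rfl, hT⟩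
  let Y : C(Icc (0 : ℝ) T, ℂ) := ⟨fun x => y x, continuousOn_iff_continuous_domRestrict.1
    (h1.continuousOn hT)⟩
  have ye : ∀ t ∈ Icc 0 T, ext hT Y t = y t := fun t ht => by rw [ext_apply hT _ ht]; rfl
  have pe : ∀ t ∈ Icc 0 T, ext hT (potOp hT hq lam Y) t = dy t - dy 0 := by
    intro t ht
    rw [ext_apply hT _ ht, potOp_apply, h2.eqn t ht, add_sub_cancel_left]
    refine intervalIntegral.integral_congr fun s hs => ?_
    rw [uIcc_of_le ht.1] at hs
    simp only [ye s ⟨hs.1, hs.2.trans ht.2⟩]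
  have key : (1 - volterraOp hT hq lam) Y = affineFun T (y 0) (dy 0) := by
    ext x
    rw [_root_.sub_apply, ContinuousMap.sub_apply, volterraOp_apply,
      intervalIntegral.integral_congr (g := fun t => dy t - dy 0) (fun s hs => ?_)]
    · change y x - _ = y 0 + dy 0 * (x : ℝ)
      rw [intervalIntegral.integral_sub (subinterval h1.integrable x.2) (by simp), h1.eqn x x.2]
      simp
      ring
    · rw [uIcc_of_le x.2.1] at hs
      exact pe s ⟨hs.1, hs.2.trans x.2.2⟩
  have hY : solFun hT hq (y 0) (dy 0) lam = Y := by
    rw [solFun, ← key]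
    have h := Ring.inverse_mul_cancel _ (isUnit_one_sub_volterraOp hT hq lam)
    exact congrArg (fun f => f Y) h
  constructor
  · rw [hY, ye x hx]
  · have e : ext hT (dsolFun hT hq (y 0) (dy 0) lam) x =
      dy 0 + ext hT (potOp hT hq lam (solFun hT hq (y 0) (dy 0) lam)) x := rfl
    rw [e, hY, pe x hx]
    ring

theorem cauchySolution_spec (hT : 0 ≤ T) (hq : IntervalIntegrable q volume 0 T) (lam α β : ℂ) :
    IsSLSolution q T lam (cauchySolution q T lam α β).1 (cauchySolution q T lam α β).2 ∧
      (cauchySolution q T lam α β).1 0 = α ∧ (cauchySolution q T lam α β).2 0 = β := by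
  have : ∃ p : (ℝ → ℂ) × (ℝ → ℂ), IsSLSolution q T lam p.1 p.2 ∧ p.1 0 = α ∧ p.2 0 = β :=
    ⟨(_, _), isSLSolution_solFun hT hq α β lam, ext_solFun_zero hT hq α β lam,
      ext_dsolFun_zero hT hq α β lam⟩
  exact Classical.epsilon_spec this

theorem cauchySolution_fst (lam α β : ℂ) {x : ℝ} (hx : x ∈ Icc 0 T) :
    (cauchySolution q T lam α β).1 x = ext hT (solFun hT hq α β lam) x := by
  obtain ⟨h, h1, h2⟩ := cauchySolution_spec hT hq lam α β
  have := (h.eq_solFun hT hq hx).1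
  rwa [h1, h2] at this

theorem cauchySolution_snd (lam α β : ℂ) {x : ℝ} (hx : x ∈ Icc 0 T) :
    (cauchySolution q T lam α β).2 x = ext hT (dsolFun hT hq α β lam) x := by
  obtain ⟨h, h1, h2⟩ := cauchySolution_spec hT hq lam α β
  have := (h.eq_solFun hT hq hx).2
  rwa [h1, h2] at this

theorem continuous_uncurry_ext {f : ℂ → C(Icc (0 : ℝ) T, ℂ)} (hf : Continuous f) :
    Continuous fun p : ℝ × ℂ => ext hT (f p.2) p.1 := by
  unfold LoopGraph.ext
  have : Continuous fun p : ℝ × ℂ => (f p.2, projIcc 0 T hT p.1) :=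
    (hf.comp continuous_snd).prodMk (continuous_projIcc.comp continuous_fst)
  exact continuous_eval.comp this

theorem differentiable_ext_apply {f : ℂ → C(Icc (0 : ℝ) T, ℂ)} (hf : Differentiable ℂ f) (x : ℝ) :
    Differentiable ℂ fun lam => ext hT (f lam) x :=
  (ContinuousMap.evalCLM ℂ (projIcc 0 T hT x) : C(Icc (0 : ℝ) T, ℂ) →L[ℂ] ℂ).differentiable.comp hf

end Volterra

/-! ### Variation of constants and bounds for large spectral parameter -/

theorem IsPrim.mono {E : Type*} [NormedAddCommGroup E] [NormedSpace ℝ E] {T x : ℝ} {f f' : ℝ → E}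
    (h : IsPrim T f f') (hx : x ∈ Icc 0 T) : IsPrim x f f' :=
  ⟨subinterval h.integrable hx, fun y hy => h.eqn y ⟨hy.1, hy.2.trans hx.2⟩⟩

theorem IsPrim.mul {T : ℝ} {u u' v v' : ℝ → ℂ} (hT : 0 ≤ T) (hu : IsPrim T u u')
    (hv : IsPrim T v v') : IsPrim T (fun x => u x * v x) (fun x => u x * v' x + u' x * v x) :=
  IsPrim.bilinear (ContinuousLinearMap.mul ℝ ℂ) hT hu hv

theorem hasDerivAt_mul_sub (ρ : ℂ) (x t : ℝ) :
    HasDerivAt (fun t : ℝ => ρ * ((x - t : ℝ) : ℂ)) (ρ * ((-1 : ℝ) : ℂ)) t :=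
  (((hasDerivAt_id t).const_sub x).ofReal_comp).const_mul ρ

theorem hasDerivAt_sin_mul_sub (ρ : ℂ) (x t : ℝ) :
    HasDerivAt (fun t : ℝ => Complex.sin (ρ * ((x - t : ℝ) : ℂ)))
      (-ρ * Complex.cos (ρ * ((x - t : ℝ) : ℂ))) t := by
  have := (Complex.hasDerivAt_sin (ρ * ((x - t : ℝ) : ℂ))).comp t (hasDerivAt_mul_sub ρ x t)
  exact this.congr_deriv (by push_cast; ring)

theorem hasDerivAt_cos_mul_sub (ρ : ℂ) (x t : ℝ) :
    HasDerivAt (fun t : ℝ => Complex.cos (ρ * ((x - t : ℝ) : ℂ)))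
      (ρ * Complex.sin (ρ * ((x - t : ℝ) : ℂ))) t := by
  have := (Complex.hasDerivAt_cos (ρ * ((x - t : ℝ) : ℂ))).comp t (hasDerivAt_mul_sub ρ x t)
  exact this.congr_deriv (by push_cast; ring)

theorem norm_sin_mul_le (ρ : ℂ) {s : ℝ} (hs : 0 ≤ s) :
    ‖Complex.sin (ρ * s)‖ ≤ Real.exp (|ρ.im| * s) := by
  have h1 : ‖Complex.exp (-(ρ * s) * Complex.I)‖ ≤ Real.exp (|ρ.im| * s) := by
    rw [Complex.norm_exp]
    have := mul_le_mul_of_nonneg_right (le_abs_self ρ.im) hs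
    simpa using this
  have h2 : ‖Complex.exp (ρ * s * Complex.I)‖ ≤ Real.exp (|ρ.im| * s) := by
    rw [Complex.norm_exp]
    have := mul_le_mul_of_nonneg_right (neg_le_abs ρ.im) hs
    simpa using this
  rw [Complex.sin, norm_div, norm_mul, Complex.norm_I, mul_one, Complex.norm_two]
  have := norm_sub_le (Complex.exp (-(ρ * s) * Complex.I)) (Complex.exp (ρ * s * Complex.I))
  linarith

theorem norm_cos_mul_le (ρ : ℂ) {s : ℝ} (hs : 0 ≤ s) :
    ‖Complex.cos (ρ * s)‖ ≤ Real.exp (|ρ.im| * s) := by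
  have h1 : ‖Complex.exp (-(ρ * s) * Complex.I)‖ ≤ Real.exp (|ρ.im| * s) := by
    rw [Complex.norm_exp]
    have := mul_le_mul_of_nonneg_right (le_abs_self ρ.im) hs
    simpa using this
  have h2 : ‖Complex.exp (ρ * s * Complex.I)‖ ≤ Real.exp (|ρ.im| * s) := by
    rw [Complex.norm_exp]
    have := mul_le_mul_of_nonneg_right (neg_le_abs ρ.im) hs
    simpa using this
  rw [Complex.cos, norm_div, Complex.norm_two]
  have := norm_add_le (Complex.exp (ρ * s * Complex.I)) (Complex.exp (-(ρ * s) * Complex.I))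
  linarith

namespace IsSLSolution

variable {T : ℝ} {q : ℝ → ℂ} {ρ : ℂ} {y dy : ℝ → ℂ}

/-- Along `[0, x]` the function `sin(ρ(x-t))/ρ · y'(t) + cos(ρ(x-t)) · y(t)` goes from the free
solution at `t = 0` to `y(x)` at `t = x`, and in its derivative only the term with `q` survives. -/
theorem variation (h : IsSLSolution q T (ρ ^ 2) y dy) (hρ : ρ ≠ 0) {x : ℝ} (hx : x ∈ Icc 0 T) :
    y x = y 0 * Complex.cos (ρ * x) + dy 0 * (Complex.sin (ρ * x) / ρ) +
      ∫ t in (0 : ℝ)..x, Complex.sin (ρ * (x - t : ℝ)) / ρ * (q t * y t) := by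
  have hT := hx.1.trans hx.2
  obtain ⟨h1, h2⟩ := (isSLSolution_iff hT).1 h
  have c1 : IsPrim x (fun t : ℝ => Complex.sin (ρ * (x - t : ℝ)) / ρ)
      (fun t => -Complex.cos (ρ * (x - t : ℝ))) := by
    refine .of_hasDerivAt hx.1 (fun t _ => ?_) (by fun_prop)
    exact ((hasDerivAt_sin_mul_sub ρ x t).div_const ρ).congr_deriv (by field_simp)
  have c2 : IsPrim x (fun t : ℝ => Complex.cos (ρ * (x - t : ℝ)))
      (fun t => ρ * Complex.sin (ρ * (x - t : ℝ))) := by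
    refine .of_hasDerivAt hx.1 (fun t _ => ?_) (by fun_prop)
    exact hasDerivAt_cos_mul_sub ρ x t
  have hs := (c1.mul hx.1 (h2.mono hx)).add (c2.mul hx.1 (h1.mono hx))
  have e := hs.eqn x ⟨hx.1, le_rfl⟩
  simp only [sub_self, Complex.ofReal_zero, mul_zero, Complex.sin_zero, zero_div, zero_mul,
    Complex.cos_zero, one_mul, zero_add, sub_zero] at e
  rw [e]
  congr 1
  · ring
  · refine intervalIntegral.integral_congr fun t _ => ?_
    have key : ∀ s c d y q : ℂ,
        s / ρ * ((q - ρ ^ 2) * y) + -c * d + (c * d + ρ * s * y) = s / ρ * (q * y) := by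
      intros; field_simp; ring
    exact key _ _ _ _ _

/-- The same argument with `cos(ρ(x-t)) · y'(t) - ρ sin(ρ(x-t)) · y(t)`, whose value at `t = x` is
`y'(x)`. -/
theorem variation_deriv (h : IsSLSolution q T (ρ ^ 2) y dy) {x : ℝ} (hx : x ∈ Icc 0 T) :
    dy x = -(y 0 * ρ * Complex.sin (ρ * x)) + dy 0 * Complex.cos (ρ * x) +
      ∫ t in (0 : ℝ)..x, Complex.cos (ρ * (x - t : ℝ)) * (q t * y t) := by
  have hT := hx.1.trans hx.2
  obtain ⟨h1, h2⟩ := (isSLSolution_iff hT).1 h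
  have c1 : IsPrim x (fun t : ℝ => -ρ * Complex.sin (ρ * (x - t : ℝ)))
      (fun t => ρ ^ 2 * Complex.cos (ρ * (x - t : ℝ))) := by
    refine .of_hasDerivAt hx.1 (fun t _ => ?_) (by fun_prop)
    exact ((hasDerivAt_sin_mul_sub ρ x t).const_mul (-ρ)).congr_deriv (by ring)
  have c2 : IsPrim x (fun t : ℝ => Complex.cos (ρ * (x - t : ℝ)))
      (fun t => ρ * Complex.sin (ρ * (x - t : ℝ))) := by
    refine .of_hasDerivAt hx.1 (fun t _ => ?_) (by fun_prop)
    exact hasDerivAt_cos_mul_sub ρ x t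
  have hs := (c2.mul hx.1 (h2.mono hx)).add (c1.mul hx.1 (h1.mono hx))
  have e := hs.eqn x ⟨hx.1, le_rfl⟩
  simp only [sub_self, Complex.ofReal_zero, mul_zero, Complex.sin_zero, zero_mul, add_zero,
    Complex.cos_zero, one_mul, sub_zero] at e
  rw [e]
  congr 1
  · ring
  · refine intervalIntegral.integral_congr fun t _ => ?_
    have key : ∀ s c d y q : ℂ,
        c * ((q - ρ ^ 2) * y) + ρ * s * d + (-ρ * s * d + ρ ^ 2 * c * y) = c * (q * y) := by
      intros; ring
    exact key _ _ _ _ _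

section Bounds

variable (hq : IntervalIntegrable q volume 0 T) (h : IsSLSolution q T (ρ ^ 2) y dy)
  (hρ : ρ ≠ 0) (hQ : 2 * (∫ t in (0 : ℝ)..T, ‖q t‖) ≤ ‖ρ‖)

include hq in
theorem norm_integral_le {k : ℝ → ℂ} {B M : ℝ} (hB : 0 ≤ B) (hM : 0 ≤ M) {x : ℝ}
    (hx : x ∈ Icc 0 T)
    (hk : ∀ t ∈ Icc 0 x, ‖k t‖ ≤ B * Real.exp (|ρ.im| * (x - t)))
    (hy : ∀ t ∈ Icc 0 x, ‖y t‖ ≤ M * Real.exp (|ρ.im| * t)) :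
    ‖∫ t in (0 : ℝ)..x, k t * (q t * y t)‖ ≤
      B * M * (∫ t in (0 : ℝ)..T, ‖q t‖) * Real.exp (|ρ.im| * x) := by
  calc _ ≤ ∫ t in (0 : ℝ)..x, ‖q t‖ * (B * M * Real.exp (|ρ.im| * x)) := by
        refine intervalIntegral.norm_integral_le_of_norm_le hx.1 (ae_of_all _ fun t ht => ?_)
          ((subinterval hq hx).norm.mul_const _)
        have ht' : t ∈ Icc 0 x := ⟨ht.1.le, ht.2⟩
        rw [norm_mul, norm_mul]
        calc _ ≤ (B * Real.exp (|ρ.im| * (x - t))) * (‖q t‖ * (M * Real.exp (|ρ.im| * t))) := by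
              gcongr
              · exact hk t ht'
              · exact hy t ht'
          _ = ‖q t‖ * (B * M * (Real.exp (|ρ.im| * (x - t)) * Real.exp (|ρ.im| * t))) := by ring
          _ = _ := by rw [← Real.exp_add]; ring_nf
    _ = (∫ t in (0 : ℝ)..x, ‖q t‖) * (B * M * Real.exp (|ρ.im| * x)) :=
        intervalIntegral.integral_mul_const _ _
    _ ≤ (∫ t in (0 : ℝ)..T, ‖q t‖) * (B * M * Real.exp (|ρ.im| * x)) := by
        gcongr
        exact intervalIntegral.integral_mono_interval le_rfl hx.1 hx.2
          (ae_of_all _ fun _ => norm_nonneg _) hq.norm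
    _ = _ := by ring

theorem norm_sin_kernel_le (hρ : ρ ≠ 0) (x : ℝ) : ∀ t ∈ Icc 0 x,
    ‖Complex.sin (ρ * (x - t : ℝ)) / ρ‖ ≤ ‖ρ‖⁻¹ * Real.exp (|ρ.im| * (x - t)) := by
  intro t ht
  rw [norm_div, div_eq_inv_mul]
  gcongr
  exact norm_sin_mul_le ρ (sub_nonneg.2 ht.2)

theorem norm_free_le (hρ : ρ ≠ 0) {x : ℝ} (hx : 0 ≤ x) (α β : ℂ) :
    ‖α * Complex.cos (ρ * x) + β * (Complex.sin (ρ * x) / ρ)‖ ≤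
      (‖α‖ + ‖β‖ / ‖ρ‖) * Real.exp (|ρ.im| * x) := by
  refine (norm_add_le _ _).trans ?_
  rw [norm_mul, norm_mul, norm_div, add_mul]
  have h1 := norm_sin_mul_le ρ hx
  have h2 := norm_cos_mul_le ρ hx
  refine add_le_add (by gcongr) ?_
  calc _ ≤ ‖β‖ * (Real.exp (|ρ.im| * x) / ‖ρ‖) := by gcongr
    _ = _ := by ring

include hq h hρ hQ in
theorem norm_le {x : ℝ} (hx : x ∈ Icc 0 T) :
    ‖y x‖ ≤ 2 * (‖y 0‖ + ‖dy 0‖ / ‖ρ‖) * Real.exp (|ρ.im| * x) := by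
  have hT := hx.1.trans hx.2
  obtain ⟨h1, h2⟩ := (isSLSolution_iff hT).1 h
  have hc : ContinuousOn (fun x => ‖y x‖ * Real.exp (-(|ρ.im| * x))) (Icc 0 T) :=
    (h1.continuousOn hT).norm.mul (by fun_prop)
  obtain ⟨x₀, hx₀, hmax⟩ := isCompact_Icc.exists_isMaxOn ⟨0, ⟨le_rfl, hT⟩⟩ hc
  set M := ‖y x₀‖ * Real.exp (-(|ρ.im| * x₀)) with hM
  have hb : ∀ t ∈ Icc 0 T, ‖y t‖ ≤ M * Real.exp (|ρ.im| * t) := by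
    intro t ht
    have : ‖y t‖ * Real.exp (-(|ρ.im| * t)) ≤ M := hmax ht
    calc ‖y t‖ = ‖y t‖ * Real.exp (-(|ρ.im| * t)) * Real.exp (|ρ.im| * t) := by
          rw [mul_assoc, ← Real.exp_add]; simp
      _ ≤ _ := by gcongr
  have hM0 : 0 ≤ M := by positivity
  have hv := h.variation hρ hx₀
  have hi := norm_integral_le (ρ := ρ) (y := y) hq (inv_nonneg.2 (norm_nonneg ρ)) hM0 hx₀
    (norm_sin_kernel_le hρ x₀) (fun t ht => hb t ⟨ht.1, ht.2.trans hx₀.2⟩)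
  have hρ' : 0 < ‖ρ‖ := norm_pos_iff.2 hρ
  -- At the point where the weighted modulus attains its maximum `M`, the integral term is at most
  -- `M / 2`, because twice the L¹ norm of `q` does not exceed `‖ρ‖`; it is absorbed.
  have hM2 : M ≤ 2 * (‖y 0‖ + ‖dy 0‖ / ‖ρ‖) := by
    have h3 : ‖y x₀‖ ≤ (‖y 0‖ + ‖dy 0‖ / ‖ρ‖) * Real.exp (|ρ.im| * x₀) +
        M / 2 * Real.exp (|ρ.im| * x₀) := by
      calc ‖y x₀‖ = _ := congrArg _ hv
        _ ≤ _ := norm_add_le _ _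
        _ ≤ _ := by
          refine add_le_add (norm_free_le hρ hx₀.1 _ _) (hi.trans ?_)
          gcongr
          rw [mul_comm (‖ρ‖⁻¹), mul_assoc, div_eq_mul_inv]
          gcongr
          rw [inv_mul_le_iff₀ hρ']
          linarith
    have h4 : M ≤ ‖y 0‖ + ‖dy 0‖ / ‖ρ‖ + M / 2 := by
      have := mul_le_mul_of_nonneg_right h3 (Real.exp_pos (-(|ρ.im| * x₀))).le
      rw [← add_mul, mul_assoc, ← Real.exp_add] at this
      simpa using this
    linarith
  refine (hb x hx).trans ?_
  gcongr

include hq h hρ hQ in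
theorem norm_sub_free_le {x : ℝ} (hx : x ∈ Icc 0 T) :
    ‖y x - (y 0 * Complex.cos (ρ * x) + dy 0 * (Complex.sin (ρ * x) / ρ))‖ ≤
      2 * (‖y 0‖ + ‖dy 0‖ / ‖ρ‖) * (∫ t in (0 : ℝ)..T, ‖q t‖) / ‖ρ‖ * Real.exp (|ρ.im| * x) := by
  have hi := norm_integral_le (ρ := ρ) (y := y) hq (inv_nonneg.2 (norm_nonneg ρ))
    (M := 2 * (‖y 0‖ + ‖dy 0‖ / ‖ρ‖)) (by positivity) hx
    (norm_sin_kernel_le hρ x) (fun t ht => norm_le hq h hρ hQ ⟨ht.1, ht.2.trans hx.2⟩)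
  rw [h.variation hρ hx, add_sub_cancel_left]
  refine hi.trans (le_of_eq ?_)
  ring

include hq h hρ hQ in
theorem norm_deriv_sub_free_le {x : ℝ} (hx : x ∈ Icc 0 T) :
    ‖dy x - (-(y 0 * ρ * Complex.sin (ρ * x)) + dy 0 * Complex.cos (ρ * x))‖ ≤
      2 * (‖y 0‖ + ‖dy 0‖ / ‖ρ‖) * (∫ t in (0 : ℝ)..T, ‖q t‖) * Real.exp (|ρ.im| * x) := by
  have hi := norm_integral_le (ρ := ρ) (y := y) hq zero_le_one
    (M := 2 * (‖y 0‖ + ‖dy 0‖ / ‖ρ‖)) (by positivity) hx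
    (k := fun t => Complex.cos (ρ * (x - t : ℝ)))
    (fun t ht => by rw [one_mul]; exact norm_cos_mul_le ρ (sub_nonneg.2 ht.2))
    (fun t ht => norm_le hq h hρ hQ ⟨ht.1, ht.2.trans hx.2⟩)
  rw [h.variation_deriv hx, add_sub_cancel_left]
  refine hi.trans (le_of_eq ?_)
  ring

end Bounds

/-- The Wronskian of two solutions is constant. -/
theorem wronskian {lam : ℂ} {y₁ dy₁ y₂ dy₂ : ℝ → ℂ} (h₁ : IsSLSolution q T lam y₁ dy₁)
    (h₂ : IsSLSolution q T lam y₂ dy₂) {x : ℝ} (hx : x ∈ Icc 0 T) :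
    y₁ x * dy₂ x - dy₁ x * y₂ x = y₁ 0 * dy₂ 0 - dy₁ 0 * y₂ 0 := by
  have hT := hx.1.trans hx.2
  obtain ⟨h1, h1'⟩ := (isSLSolution_iff hT).1 h₁
  obtain ⟨h2, h2'⟩ := (isSLSolution_iff hT).1 h₂
  have := ((h1.mul hT h2').sub (h1'.mul hT h2)).eqn x hx
  rw [this]
  convert add_zero _
  convert intervalIntegral.integral_zero with t
  ring

end IsSLSolution

/-! ### Plancherel's theorem for the integral transform -/

section Plancherel

open FourierTransform SchwartzMap

/-- The abstract L₂ transform and the transform given by the integral define the same tempered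
distribution, as the transform can be moved to the test function in both; locally integrable
functions with equal pairings agree almost everywhere. -/
theorem fourier_ae_eq {f : ℝ → ℂ} (h1 : Integrable f) (h2 : MemLp f 2) :
    ((𝓕 (h2.toLp f) : Lp ℂ 2 (volume : Measure ℝ)) : ℝ → ℂ) =ᵐ[volume] 𝓕 f := by
  have hcont : Continuous (𝓕 f) :=
    VectorFourier.fourierIntegral_continuous Real.continuous_fourierChar
      (by exact continuous_inner) h1
  refine ae_eq_of_integral_contDiff_smul_eq
    ((Lp.memLp _).locallyIntegrable (by norm_num)) hcont.locallyIntegrable fun g hg hc => ?_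
  have hc' : HasCompactSupport (fun x => (g x : ℂ)) := hc.comp_left Complex.ofReal_zero
  let G : 𝓢(ℝ, ℂ) := hc'.toSchwartzMap (Complex.ofRealCLM.contDiff.comp hg)
  have e0 := congrArg (fun u => u G) (Lp.fourier_toTemperedDistribution_eq (h2.toLp f))
  simp only [TemperedDistribution.fourier_apply, Lp.toTemperedDistribution_apply] at e0
  have eG : ∀ x, G x = (g x : ℂ) := fun x => rfl
  have hGi : Integrable (fun x => G x) := G.integrable
  have e1 : ∫ x, (𝓕 G) x • (h2.toLp f) x = ∫ x, (𝓕 G) x • f x := by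
    refine integral_congr_ae ?_
    filter_upwards [h2.coeFn_toLp] with x hx
    rw [hx]
  have e2 : ∫ x, (𝓕 G) x • f x = ∫ x, G x • 𝓕 f x := by
    have := VectorFourier.integral_fourierIntegral_smul_eq_flip (L := innerₗ ℝ)
      Real.continuous_fourierChar (by exact continuous_inner) hGi h1
    rw [flip_innerₗ] at this
    rw [fourier_coe]
    exact this
  rw [e1, e2] at e0
  simp only [eG] at e0
  simpa [Complex.real_smul] using e0.symm

theorem eLpNorm_fourier {f : ℝ → ℂ} (h1 : Integrable f) (h2 : MemLp f 2) :
    eLpNorm (𝓕 f) 2 volume = eLpNorm f 2 volume := by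
  rw [← eLpNorm_congr_ae (fourier_ae_eq h1 h2), ← eLpNorm_congr_ae h2.coeFn_toLp]
  have h := Lp.norm_fourier_eq (h2.toLp f)
  rw [Lp.norm_def, Lp.norm_def] at h
  exact (ENNReal.toReal_eq_toReal_iff' (Lp.eLpNorm_ne_top _) (Lp.eLpNorm_ne_top _)).1 h

theorem eLpNorm_comp_mul_left {g : ℝ → ℂ} (hg : AEStronglyMeasurable g) {c : ℝ} (hc : c ≠ 0) :
    eLpNorm (fun x => g (c * x)) 2 volume =
      ENNReal.ofReal (|c⁻¹|) ^ (1 / 2 : ℝ) * eLpNorm g 2 volume := by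
  have hm : Measure.map (c * ·) (volume : Measure ℝ) = ENNReal.ofReal |c⁻¹| • volume :=
    Real.map_volume_mul_left hc
  have h := eLpNorm_map_measure (p := 2) (μ := (volume : Measure ℝ)) (f := (c * ·)) (g := g)
    (by rw [hm]; exact hg.smul_measure _) (by fun_prop)
  rw [hm, eLpNorm_smul_measure_of_ne_top (by norm_num)] at h
  simpa [Function.comp_def] using h.symm

theorem eLpNorm_exp_transform {f : ℝ → ℂ} (h1 : Integrable f) (h2 : MemLp f 2) :
    eLpNorm (fun σ : ℝ => ∫ t, f t * Complex.exp (Complex.I * σ * t)) 2 volume =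
      ENNReal.ofReal (2 * Real.pi) ^ (1 / 2 : ℝ) * eLpNorm f 2 volume := by
  have hcont : Continuous (𝓕 f) :=
    VectorFourier.fourierIntegral_continuous Real.continuous_fourierChar
      (by exact continuous_inner) h1
  have e : (fun σ : ℝ => ∫ t, f t * Complex.exp (Complex.I * σ * t)) =
      fun σ => 𝓕 f (-(2 * Real.pi)⁻¹ * σ) := by
    ext σ
    rw [Real.fourier_real_eq_integral_exp_smul]
    congr 1; ext t
    rw [smul_eq_mul, mul_comm]
    congr 2
    push_cast
    field_simp
  rw [e, eLpNorm_comp_mul_left hcont.aestronglyMeasurable (by simp [Real.pi_ne_zero]),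
    eLpNorm_fourier h1 h2]
  congr 3
  rw [neg_inv, inv_inv, abs_neg, abs_of_pos Real.two_pi_pos]

end Plancherel

/-! ### Cauchy–Schwarz inequalities -/

section Hoelder

variable {α : Type*} [MeasurableSpace α] {μ : Measure α}

theorem integrable_norm_mul_norm {f g : α → ℂ} (hf : MemLp f 2 μ) (hg : MemLp g 2 μ) :
    Integrable (fun x => ‖f x‖ * ‖g x‖) μ :=
  hf.norm.integrable_mul hg.norm

/-- The Cauchy–Schwarz inequality. -/
theorem integral_norm_mul_norm_le {f g : α → ℂ} (hf : MemLp f 2 μ) (hg : MemLp g 2 μ) :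
    ∫ x, ‖f x‖ * ‖g x‖ ∂μ ≤ (eLpNorm f 2 μ).toReal * (eLpNorm g 2 μ).toReal := by
  have h := eLpNorm_smul_le_mul_eLpNorm (p := 2) (q := 2) (r := 1) (μ := μ) hg.1 hf.1
  rw [eLpNorm_one_eq_lintegral_enorm] at h
  rw [← ENNReal.toReal_mul]
  have e : ∫ x, ‖f x‖ * ‖g x‖ ∂μ = (∫⁻ x, ‖(f • g) x‖ₑ ∂μ).toReal := by
    rw [← integral_norm_eq_lintegral_enorm (hf.1.smul hg.1)]
    simp
  rw [e]
  exact ENNReal.toReal_mono (ENNReal.mul_ne_top hf.2.ne hg.2.ne) h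

theorem integral_norm_le_of_memLp [IsFiniteMeasure μ] {f : α → ℂ} (hf : MemLp f 2 μ) :
    ∫ x, ‖f x‖ ∂μ ≤ √(μ.real univ) * (eLpNorm f 2 μ).toReal := by
  have h := integral_norm_mul_norm_le hf (memLp_const (1 : ℂ) (p := 2) (μ := μ))
  simp only [norm_one, mul_one] at h
  refine h.trans (le_of_eq ?_)
  rw [mul_comm]
  congr 1
  rw [eLpNorm_const' _ (by norm_num) (by norm_num)]
  simp [Real.sqrt_eq_rpow, Measure.real, ENNReal.toReal_rpow]

end Hoelder

/-! ### Paley–Wiener functions on horizontal lines -/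

theorem norm_intervalIntegral_mul_exp_le {T : ℝ} (hT : 0 ≤ T) {f : ℝ → ℂ}
    (hf : IntegrableOn f (Ioc (-T) T)) (ρ : ℂ) :
    ‖∫ t in (-T)..T, f t * Complex.exp (Complex.I * ρ * t)‖ ≤
      Real.exp (T * |ρ.im|) * ∫ t in Ioc (-T) T, ‖f t‖ := by
  rw [intervalIntegral.integral_of_le (by linarith), ← integral_const_mul]
  refine norm_integral_le_of_norm_le (hf.norm.const_mul _) ?_
  filter_upwards [ae_restrict_mem measurableSet_Ioc] with t ht
  rw [norm_mul, mul_comm, Complex.norm_exp]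
  gcongr
  have : (Complex.I * ρ * (t : ℂ)).re = -(ρ.im * t) := by simp
  rw [this]
  calc -(ρ.im * t) ≤ |ρ.im * t| := neg_le_abs _
    _ = |t| * |ρ.im| := by rw [abs_mul, mul_comm]
    _ ≤ _ := by
      gcongr
      exact abs_le.2 ⟨ht.1.le, ht.2⟩

namespace PaleyWiener

/-- Moving to the line at height `τ` multiplies the density by `exp(-τt)`, which is bounded on the
support; then Plancherel applies. -/
theorem eLpNorm_line {T : ℝ} (hT : 0 ≤ T) {f : ℝ → ℂ}
    (hf : MemLp f 2 (volume.restrict (Ioc (-T) T))) (τ : ℝ) :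
    eLpNorm (fun σ : ℝ => ∫ t in (-T)..T, f t * Complex.exp (Complex.I * linePoint τ σ * t)) 2
      volume = ENNReal.ofReal (2 * Real.pi) ^ (1 / 2 : ℝ) *
        eLpNorm (fun t : ℝ => f t * Complex.exp (-(τ * t : ℝ))) 2
          (volume.restrict (Ioc (-T) T)) := by
  set g : ℝ → ℂ := (Ioc (-T) T).indicator (fun t : ℝ => f t * Complex.exp (-(τ * t : ℝ))) with hg
  have hm : MemLp (fun t : ℝ => f t * Complex.exp (-(τ * t : ℝ))) 2
      (volume.restrict (Ioc (-T) T)) := by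
    refine MemLp.of_le_mul (c := Real.exp (|τ| * T)) hf
      (hf.1.mul (by fun_prop)) ?_
    filter_upwards [ae_restrict_mem measurableSet_Ioc] with t ht
    rw [norm_mul, mul_comm, Complex.norm_exp]
    gcongr
    simp only [Complex.neg_re, Complex.ofReal_re]
    calc -(τ * t) ≤ |τ * t| := neg_le_abs _
      _ = |τ| * |t| := abs_mul _ _
      _ ≤ _ := by
        gcongr
        exact abs_le.2 ⟨ht.1.le, ht.2⟩
  have h2 : MemLp g 2 volume := (memLp_indicator_iff_restrict measurableSet_Ioc).2 hm
  have h1 : Integrable g := by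
    rw [hg, integrable_indicator_iff measurableSet_Ioc]
    exact hm.integrable (by norm_num)
  have := eLpNorm_exp_transform h1 h2
  rw [hg, eLpNorm_indicator_eq_eLpNorm_restrict measurableSet_Ioc] at this
  rw [← this]
  congr 1
  ext σ
  rw [intervalIntegral.integral_of_le (by linarith), ← integral_indicator measurableSet_Ioc]
  congr 1; ext t
  by_cases ht : t ∈ Ioc (-T) T
  · simp only [indicator_of_mem ht, mul_assoc, ← Complex.exp_add, linePoint]
    congr 2
    push_cast
    linear_combination (τ : ℂ) * t * Complex.I_sq
  · simp [indicator_of_notMem ht]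

theorem one_le_two_pi_rpow : 1 ≤ ENNReal.ofReal (2 * Real.pi) ^ (1 / 2 : ℝ) := by
  rw [ENNReal.ofReal_rpow_of_pos Real.two_pi_pos]
  rw [ENNReal.one_le_ofReal]
  apply Real.one_le_rpow _ (by norm_num)
  linarith [Real.two_le_pi]

variable {T : ℝ} {G : ℂ → ℂ}

/-- Plancherel has the constant `√(2π)` here; it is at least 1 and may be dropped. -/
theorem eLpNorm_le (hT : 0 ≤ T) {f : ℝ → ℂ} (hf : MemLp f 2 (volume.restrict (Ioc (-T) T)))
    (hG : ∀ ρ : ℂ, G ρ = ∫ t in (-T)..T, f t * Complex.exp (Complex.I * ρ * t)) :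
    eLpNorm f 2 (volume.restrict (Ioc (-T) T)) ≤ eLpNorm (fun σ : ℝ => G σ) 2 volume := by
  have h := eLpNorm_line hT hf 0
  simp only [linePoint, Complex.ofReal_zero, zero_mul, add_zero, neg_zero, Complex.exp_zero,
    mul_one, ← hG] at h
  rw [h]
  exact le_mul_of_one_le_left (by positivity) one_le_two_pi_rpow

theorem norm_le (hT : 0 ≤ T) (h : PaleyWiener T G)
    (hfin : eLpNorm (fun σ : ℝ => G σ) 2 volume ≠ ∞) (ρ : ℂ) :
    ‖G ρ‖ ≤ √(2 * T) * (eLpNorm (fun σ : ℝ => G σ) 2 volume).toReal * Real.exp (T * |ρ.im|) := by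
  obtain ⟨f, hf, hG⟩ := h
  have h1 := ENNReal.toReal_mono hfin (eLpNorm_le hT hf hG)
  rw [hG]
  refine (norm_intervalIntegral_mul_exp_le hT (hf.integrable (by norm_num)) ρ).trans ?_
  rw [mul_comm]
  gcongr
  refine (integral_norm_le_of_memLp hf).trans ?_
  have : (volume.restrict (Ioc (-T) T)).real univ = 2 * T := by
    rw [measureReal_restrict_apply_univ, Real.volume_real_Ioc_of_le (by linarith)]; ring
  rw [this]
  gcongr

theorem eLpNorm_line_le (hT : 0 ≤ T) (h : PaleyWiener T G) (τ : ℝ) :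
    eLpNorm (fun σ : ℝ => G (linePoint τ σ)) 2 volume ≤
      ENNReal.ofReal (√(2 * Real.pi) * Real.exp (|τ| * T)) *
        eLpNorm (fun σ : ℝ => G σ) 2 volume := by
  obtain ⟨f, hf, hG⟩ := h
  simp only [hG (linePoint _ _), eLpNorm_line hT hf]
  rw [ENNReal.ofReal_mul (Real.sqrt_nonneg _), Real.sqrt_eq_rpow,
    ENNReal.ofReal_rpow_of_pos Real.two_pi_pos, mul_assoc]
  gcongr
  refine le_trans ?_ (mul_le_mul_right (eLpNorm_le hT hf hG) _)
  refine eLpNorm_le_mul_eLpNorm_of_ae_le_mul ?_ 2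
  filter_upwards [ae_restrict_mem measurableSet_Ioc] with t ht
  rw [norm_mul, mul_comm, Complex.norm_exp]
  gcongr
  simp only [Complex.neg_re, Complex.ofReal_re]
  calc -(τ * t) ≤ |τ * t| := neg_le_abs _
    _ = |τ| * |t| := abs_mul _ _
    _ ≤ _ := by
      gcongr
      exact abs_le.2 ⟨ht.1.le, ht.2⟩

end PaleyWiener

/-! ### The Gelfand–Levitan method in a commutative Banach algebra -/

theorem isUnit_one_add_of_norm_pow_lt {R : Type*} [NormedRing R] [CompleteSpace R] (a : R) (n : ℕ)
    (h : ‖a ^ n‖ < 1) : IsUnit (1 + a) := by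
  rw [← sub_neg_eq_add]
  refine isUnit_one_sub_of_norm_pow_lt (-a) n ?_
  rcases n.even_or_odd with hn | hn
  · rwa [hn.neg_pow]
  · rwa [hn.neg_pow, norm_neg]

/-- Data of a Gelfand–Levitan problem whose solutions `s` of `s'' = (q - z) s` take values in a
commutative Banach algebra and whose spectral measure is a functional `ν`, the kernel
`ν (s x * s t)` being small. -/
structure GLData (B : Type*) [NormedCommRing B] [NormedAlgebra ℂ B] where
  T : ℝ
  T_pos : 0 < T
  q : ℝ → ℂ
  z : B
  ν : B →L[ℂ] ℂ
  s : ℝ → B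
  s1 : ℝ → B
  cont_s : Continuous s
  cont_s1 : Continuous s1
  prim_s : IsPrim T s s1
  prim_s1 : IsPrim T s1 (fun t => q t • s t - z * s t)
  s_zero : s 0 = 0
  s1_zero : s1 0 = 1
  small : ∀ x ∈ Icc 0 T, ∀ t ∈ Icc 0 T, T * ‖ν (s x * s t)‖ ≤ 1 / 2

namespace GLData

variable {B : Type*} [NormedCommRing B] [NormedAlgebra ℂ B] [CompleteSpace B] (𝒟 : GLData B)

/-- The rank-one operator `φ ↦ ν (s t φ) s t`. -/
noncomputable def h (t : ℝ) : B →L[ℂ] B :=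
  (𝒟.ν ∘L ContinuousLinearMap.mul ℂ B (𝒟.s t)).smulRight (𝒟.s t)

theorem h_apply (t : ℝ) (φ : B) : 𝒟.h t φ = 𝒟.ν (𝒟.s t * φ) • 𝒟.s t := rfl

theorem continuous_h : Continuous 𝒟.h := by
  have := 𝒟.cont_s
  unfold h
  have h1 : Continuous fun t => 𝒟.ν ∘L ContinuousLinearMap.mul ℂ B (𝒟.s t) := by fun_prop
  exact ((ContinuousLinearMap.smulRightL ℂ B B).continuous.comp h1).clm_apply this

/-- The operator `φ ↦ ∫₀ˣ ν (s t φ) s t`. -/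
noncomputable def H (x : ℝ) : B →L[ℂ] B := ∫ t in (0 : ℝ)..x, 𝒟.h t

theorem H_apply (x : ℝ) (φ : B) : 𝒟.H x φ = ∫ t in (0 : ℝ)..x, 𝒟.ν (𝒟.s t * φ) • 𝒟.s t := by
  rw [H, ContinuousLinearMap.intervalIntegral_apply (𝒟.continuous_h.intervalIntegrable _ _)]
  rfl

theorem hasDerivAt_H (x : ℝ) : HasDerivAt 𝒟.H (𝒟.h x) x :=
  𝒟.continuous_h.integral_hasStrictDerivAt 0 x |>.hasDerivAt

theorem nu_mul_H (x : ℝ) (b φ : B) :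
    𝒟.ν (b * 𝒟.H x φ) = ∫ t in (0 : ℝ)..x, 𝒟.ν (𝒟.s t * φ) * 𝒟.ν (b * 𝒟.s t) := by
  have hc : Continuous fun t => 𝒟.ν (𝒟.s t * φ) • 𝒟.s t := by
    have := 𝒟.cont_s
    fun_prop
  have := (𝒟.ν ∘L ContinuousLinearMap.mul ℂ B b).intervalIntegral_comp_comm
    (hc.intervalIntegrable (μ := volume) 0 x)
  rw [← H_apply] at this
  simp only [ContinuousLinearMap.comp_apply, ContinuousLinearMap.mul_apply', map_smul,
    smul_eq_mul] at this
  exact this.symm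

/-- The operator norm of `H x` need not be small; only the scalar kernel `ν (s x * s t)` is. But
powers of `H x` are iterated integrals of that kernel, so they decay geometrically, and one power of
norm below 1 suffices. -/
theorem isUnit_one_add_H {x : ℝ} (hx : x ∈ Icc 0 𝒟.T) : IsUnit (1 + 𝒟.H x) := by
  have hT := 𝒟.T_pos
  obtain ⟨C, hC⟩ := (isCompact_Icc (a := (0 : ℝ)) (b := 𝒟.T)).exists_bound_of_continuousOn
    𝒟.cont_s.continuousOn
  have hC0 : 0 ≤ C := (norm_nonneg _).trans (hC x hx)
  have key : ∀ (n : ℕ) (φ : B), ∀ t ∈ Icc 0 𝒟.T,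
      ‖𝒟.ν (𝒟.s t * (𝒟.H x ^ n) φ)‖ ≤ ‖𝒟.ν‖ * C * ‖φ‖ * (1 / 2) ^ n := by
    intro n φ
    induction n with
    | zero =>
      intro t ht
      simp only [pow_zero, mul_one, one_apply_eq_self, mul_assoc]
      refine (𝒟.ν.le_opNorm _).trans ?_
      gcongr
      refine (norm_mul_le _ _).trans ?_
      gcongr
      exact hC t ht
    | succ n ih =>
      intro t ht
      have e : (𝒟.H x ^ (n + 1)) φ = 𝒟.H x ((𝒟.H x ^ n) φ) := by rw [pow_succ']; rfl
      rw [e, nu_mul_H]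
      -- One more factor `H x` costs the kernel bound `1/(2T)` times an interval of length at most
      -- `T`, that is, a factor 1/2.
      calc _ ≤ ‖𝒟.ν‖ * C * ‖φ‖ * (1 / 2) ^ n * (1 / (2 * 𝒟.T)) * |x - 0| := by
            refine intervalIntegral.norm_integral_le_of_norm_le_const fun u hu => ?_
            rw [uIoc_of_le hx.1] at hu
            have hu' : u ∈ Icc 0 𝒟.T := ⟨hu.1.le, hu.2.trans hx.2⟩
            rw [norm_mul]
            gcongr
            · exact ih u hu'
            · rw [le_div_iff₀ (by positivity)]
              linarith [𝒟.small t ht u hu']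
        _ ≤ ‖𝒟.ν‖ * C * ‖φ‖ * (1 / 2) ^ n * (1 / (2 * 𝒟.T)) * 𝒟.T := by
            gcongr
            rw [sub_zero, abs_of_nonneg hx.1]
            exact hx.2
        _ = _ := by field_simp; ring
  have key2 : ∀ n : ℕ, ‖𝒟.H x ^ (n + 1)‖ ≤ ‖𝒟.ν‖ * C * C * 𝒟.T * (1 / 2) ^ n := by
    intro n
    refine ContinuousLinearMap.opNorm_le_bound _ (by positivity) fun φ => ?_
    have e : (𝒟.H x ^ (n + 1)) φ = 𝒟.H x ((𝒟.H x ^ n) φ) := by rw [pow_succ']; rfl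
    rw [e, H_apply]
    calc _ ≤ ‖𝒟.ν‖ * C * ‖φ‖ * (1 / 2) ^ n * C * |x - 0| := by
          refine intervalIntegral.norm_integral_le_of_norm_le_const fun u hu => ?_
          rw [uIoc_of_le hx.1] at hu
          have hu' : u ∈ Icc 0 𝒟.T := ⟨hu.1.le, hu.2.trans hx.2⟩
          rw [norm_smul]
          gcongr
          · exact key n φ u hu'
          · exact hC u hu'
      _ ≤ ‖𝒟.ν‖ * C * ‖φ‖ * (1 / 2) ^ n * C * 𝒟.T := by
          gcongr
          rw [sub_zero, abs_of_nonneg hx.1]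
          exact hx.2
      _ = _ := by ring
  have ht : Tendsto (fun n : ℕ => ‖𝒟.ν‖ * C * C * 𝒟.T * (1 / 2 : ℝ) ^ n) atTop (𝓝 0) := by
    simpa using (tendsto_pow_atTop_nhds_zero_of_lt_one (by norm_num : (0 : ℝ) ≤ 1 / 2)
      (by norm_num)).const_mul (‖𝒟.ν‖ * C * C * 𝒟.T)
  obtain ⟨n, hn⟩ := (ht.eventually (gt_mem_nhds (zero_lt_one' ℝ))).exists
  exact isUnit_one_add_of_norm_pow_lt (𝒟.H x) (n + 1) ((key2 n).trans_lt hn)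

/-- The inverse of `1 + H x`. -/
noncomputable def A (x : ℝ) : B →L[ℂ] B := Ring.inverse (1 + 𝒟.H x)

theorem hasDerivAt_A {x : ℝ} (hx : x ∈ Icc 0 𝒟.T) :
    HasDerivAt 𝒟.A (-(𝒟.A x * 𝒟.h x * 𝒟.A x)) x := by
  have hu := 𝒟.isUnit_one_add_H hx
  have h1 := (hasFDerivAt_ringInverse (𝕜 := ℝ) hu.unit)
  have h2 := h1.comp_hasDerivAt_of_eq x ((𝒟.hasDerivAt_H x).const_add 1) (by simp)
  refine h2.congr_deriv ?_
  simp [A, ← Ring.inverse_unit, mul_assoc]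

theorem A_add {x : ℝ} (hx : x ∈ Icc 0 𝒟.T) (φ : B) : 𝒟.A x φ + 𝒟.H x (𝒟.A x φ) = φ :=
  congrArg (fun f => f φ) (Ring.mul_inverse_cancel _ (𝒟.isUnit_one_add_H hx))

theorem A_of_add {x : ℝ} (hx : x ∈ Icc 0 𝒟.T) (φ : B) : 𝒟.A x (φ + 𝒟.H x φ) = φ :=
  congrArg (fun f => f φ) (Ring.inverse_mul_cancel _ (𝒟.isUnit_one_add_H hx))

/-- The transformed solution. -/
noncomputable def Y (x : ℝ) : B := 𝒟.A x (𝒟.s x)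

/-- The Gelfand–Levitan kernel. -/
noncomputable def K (x t : ℝ) : ℂ := -𝒟.ν (𝒟.Y x * 𝒟.s t)

/-- The derivative of the transformed solution. -/
noncomputable def Y1 (x : ℝ) : B := 𝒟.A x (𝒟.s1 x + 𝒟.K x x • 𝒟.s x)

/-- The derivative of the Gelfand–Levitan kernel with respect to the first variable. -/
noncomputable def L (x t : ℝ) : ℂ := -𝒟.ν (𝒟.Y1 x * 𝒟.s t)

/-- The derivative of the Gelfand–Levitan kernel along the diagonal. -/
noncomputable def dκ (x : ℝ) : ℂ := -𝒟.ν (𝒟.Y x * 𝒟.s1 x + 𝒟.Y1 x * 𝒟.s x)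

theorem Y_eq {x : ℝ} (hx : x ∈ Icc 0 𝒟.T) :
    𝒟.Y x = 𝒟.s x + ∫ t in (0 : ℝ)..x, 𝒟.K x t • 𝒟.s t := by
  have h1 := 𝒟.A_add hx (𝒟.s x)
  rw [H_apply] at h1
  simp only [K, neg_smul, intervalIntegral.integral_neg]
  rw [← sub_eq_add_neg, eq_sub_iff_add_eq]
  simp only [mul_comm (𝒟.Y x)]
  exact h1

theorem Y1_eq {x : ℝ} (hx : x ∈ Icc 0 𝒟.T) :
    𝒟.Y1 x = 𝒟.s1 x + 𝒟.K x x • 𝒟.s x + ∫ t in (0 : ℝ)..x, 𝒟.L x t • 𝒟.s t := by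
  have h1 := 𝒟.A_add hx (𝒟.s1 x + 𝒟.K x x • 𝒟.s x)
  rw [H_apply] at h1
  simp only [L, neg_smul, intervalIntegral.integral_neg]
  rw [← sub_eq_add_neg, eq_sub_iff_add_eq]
  simp only [mul_comm (𝒟.Y1 x)]
  exact h1

theorem continuousOn_A : ContinuousOn 𝒟.A (Icc 0 𝒟.T) :=
  fun _ hx => (𝒟.hasDerivAt_A hx).continuousAt.continuousWithinAt

theorem continuousOn_Y : ContinuousOn 𝒟.Y (Icc 0 𝒟.T) :=
  𝒟.continuousOn_A.clm_apply 𝒟.cont_s.continuousOn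

theorem continuousOn_K_diag : ContinuousOn (fun x => 𝒟.K x x) (Icc 0 𝒟.T) :=
  (𝒟.ν.continuous.comp_continuousOn (𝒟.continuousOn_Y.mul 𝒟.cont_s.continuousOn)).neg

theorem continuousOn_Y1 : ContinuousOn 𝒟.Y1 (Icc 0 𝒟.T) :=
  𝒟.continuousOn_A.clm_apply (𝒟.cont_s1.continuousOn.add
    (𝒟.continuousOn_K_diag.smul 𝒟.cont_s.continuousOn))

theorem continuousOn_dκ : ContinuousOn 𝒟.dκ (Icc 0 𝒟.T) :=
  (𝒟.ν.continuous.comp_continuousOn ((𝒟.continuousOn_Y.mul 𝒟.cont_s1.continuousOn).add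
    (𝒟.continuousOn_Y1.mul 𝒟.cont_s.continuousOn))).neg

theorem prim_A : IsPrim 𝒟.T 𝒟.A (fun x => -(𝒟.A x * 𝒟.h x * 𝒟.A x)) :=
  .of_hasDerivAt 𝒟.T_pos.le (fun _ hx => 𝒟.hasDerivAt_A hx)
    ((𝒟.continuousOn_A.mul 𝒟.continuous_h.continuousOn).mul 𝒟.continuousOn_A).neg

theorem IsPrim.clm_apply {T : ℝ} (hT : 0 ≤ T) {u u' : ℝ → B →L[ℂ] B} {v v' : ℝ → B}
    (hu : IsPrim T u u') (hv : IsPrim T v v') :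
    IsPrim T (fun x => u x (v x)) (fun x => u x (v' x) + u' x (v x)) :=
  IsPrim.bilinear (ContinuousLinearMap.restrictScalarsL ℂ B B ℝ ℝ) hT hu hv

theorem IsPrim.smul {T : ℝ} (hT : 0 ≤ T) {u u' : ℝ → ℂ} {v v' : ℝ → B}
    (hu : IsPrim T u u') (hv : IsPrim T v v') :
    IsPrim T (fun x => u x • v x) (fun x => u x • v' x + u' x • v x) :=
  IsPrim.bilinear (ContinuousLinearMap.lsmul ℝ ℂ) hT hu hv

theorem IsPrim.mul' {T : ℝ} (hT : 0 ≤ T) {u u' v v' : ℝ → B}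
    (hu : IsPrim T u u') (hv : IsPrim T v v') :
    IsPrim T (fun x => u x * v x) (fun x => u x * v' x + u' x * v x) :=
  IsPrim.bilinear (ContinuousLinearMap.mul ℝ B) hT hu hv

/-- Since `A' = -A h A` and `h(x) Y(x) = ν(s Y) s = -K(x,x) s`, differentiating `A s` leads to `A
(s' + K(x,x) s)`. -/
theorem prim_Y : IsPrim 𝒟.T 𝒟.Y 𝒟.Y1 := by
  refine (IsPrim.clm_apply 𝒟.T_pos.le 𝒟.prim_A 𝒟.prim_s).congr (fun x _ => rfl) (fun x _ => ?_)
    𝒟.T_pos.le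
  have e : (-(𝒟.A x * 𝒟.h x * 𝒟.A x)) (𝒟.s x) = -𝒟.A x (𝒟.h x (𝒟.Y x)) := rfl
  rw [e, Y1, h_apply, map_add, ← map_neg, ← neg_smul, K, mul_comm (𝒟.Y x)]

theorem prim_K_diag : IsPrim 𝒟.T (fun x => 𝒟.K x x) 𝒟.dκ := by
  have h1 := IsPrim.mul' 𝒟.T_pos.le 𝒟.prim_Y 𝒟.prim_s
  exact h1.clm ((-𝒟.ν).restrictScalars ℝ)

/-- The commutator of multiplication by `z` and `H x`. -/
theorem commutator {x : ℝ} (hx : x ∈ Icc 0 𝒟.T) (φ : B) :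
    𝒟.z * 𝒟.H x φ - 𝒟.H x (𝒟.z * φ) =
      𝒟.ν (𝒟.s1 x * φ) • 𝒟.s x - 𝒟.ν (𝒟.s x * φ) • 𝒟.s1 x := by
  have hT := 𝒟.T_pos.le
  let νφ : B →L[ℝ] ℂ := (𝒟.ν ∘L (ContinuousLinearMap.mul ℂ B).flip φ).restrictScalars ℝ
  -- The derivative of `ν(s'φ) s - ν(sφ) s'` is the integrand of the commutator: the terms with `q`
  -- and with two derivatives cancel. At 0 the expression vanishes because `s 0 = 0`.
  have p1 := IsPrim.smul hT (𝒟.prim_s1.clm νφ) 𝒟.prim_s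
  have p2 := IsPrim.smul hT (𝒟.prim_s.clm νφ) 𝒟.prim_s1
  have e := (p1.sub p2).eqn x hx
  have ev : ∀ b, νφ b = 𝒟.ν (b * φ) := fun b => rfl
  simp only [ev, 𝒟.s_zero, smul_zero, zero_mul, map_zero, zero_smul, sub_zero, zero_add] at e
  rw [e, H_apply, H_apply]
  have c1 : Continuous fun t => 𝒟.ν (𝒟.s t * φ) • 𝒟.s t := by
    have := 𝒟.cont_s
    fun_prop
  have c2 : Continuous fun t => 𝒟.ν (𝒟.s t * (𝒟.z * φ)) • 𝒟.s t := by
    have := 𝒟.cont_s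
    fun_prop
  have e3 := (ContinuousLinearMap.mul ℂ B 𝒟.z).intervalIntegral_comp_comm
    (c1.intervalIntegrable (μ := volume) 0 x)
  simp only [ContinuousLinearMap.mul_apply'] at e3
  rw [← e3, ← intervalIntegral.integral_sub]
  · refine intervalIntegral.integral_congr fun t _ => ?_
    have e4 : 𝒟.ν ((𝒟.q t • 𝒟.s t - 𝒟.z * 𝒟.s t) * φ) =
        𝒟.q t * 𝒟.ν (𝒟.s t * φ) - 𝒟.ν (𝒟.s t * (𝒟.z * φ)) := by
      rw [sub_mul, map_sub, smul_mul_assoc, map_smul, smul_eq_mul]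
      congr 2; ring
    simp only [e4, smul_sub, sub_smul, smul_smul, mul_smul_comm]
    rw [mul_comm (𝒟.q t)]
    abel
  · exact (continuous_const.mul c1).intervalIntegrable _ _
  · exact c2.intervalIntegrable _ _

/-- After application of `1 + H` both sides involve only `s` and `s'`. Moving `z` through `H` leaves
the boundary terms of the commutator; one of them matches the derivative of `K(x,x) s`, and the
other completes the second copy of `dκ`. -/
theorem prim_Y1 : IsPrim 𝒟.T 𝒟.Y1
    (fun x => (𝒟.q x + 2 * 𝒟.dκ x) • 𝒟.Y x - 𝒟.z * 𝒟.Y x) := by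
  have hT := 𝒟.T_pos.le
  have h1 := IsPrim.clm_apply hT 𝒟.prim_A
    (𝒟.prim_s1.add (IsPrim.smul hT 𝒟.prim_K_diag 𝒟.prim_s))
  refine h1.congr (fun x _ => rfl) (fun x hx => ?_) hT
  have e : (-(𝒟.A x * 𝒟.h x * 𝒟.A x)) (𝒟.s1 x + 𝒟.K x x • 𝒟.s x) =
    -𝒟.A x (𝒟.h x (𝒟.Y1 x)) := rfl
  rw [e, ← map_neg, ← map_add, ← 𝒟.A_of_add hx ((𝒟.q x + 2 * 𝒟.dκ x) • 𝒟.Y x - 𝒟.z * 𝒟.Y x)]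
  congr 1
  have hc := 𝒟.commutator hx (𝒟.Y x)
  have hs : 𝒟.Y x + 𝒟.H x (𝒟.Y x) = 𝒟.s x := 𝒟.A_add hx (𝒟.s x)
  have hk : 𝒟.dκ x = -(𝒟.ν (𝒟.s1 x * 𝒟.Y x) + 𝒟.ν (𝒟.s x * 𝒟.Y1 x)) := by
    rw [dκ, map_add, mul_comm, mul_comm (𝒟.Y1 x)]
  have hK : 𝒟.K x x = -𝒟.ν (𝒟.s x * 𝒟.Y x) := by rw [K, mul_comm]
  rw [map_sub, map_smul, h_apply]
  have e1 : 𝒟.H x (𝒟.z * 𝒟.Y x) = 𝒟.z * (𝒟.s x - 𝒟.Y x) -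
      (𝒟.ν (𝒟.s1 x * 𝒟.Y x) • 𝒟.s x - 𝒟.ν (𝒟.s x * 𝒟.Y x) • 𝒟.s1 x) := by
    rw [← hc, ← hs]; abel_nf
  have e2 : 𝒟.H x (𝒟.Y x) = 𝒟.s x - 𝒟.Y x := by rw [← hs]; abel
  rw [e1, e2, hK, hk]
  generalize 𝒟.ν (𝒟.s1 x * 𝒟.Y x) = a
  generalize 𝒟.ν (𝒟.s x * 𝒟.Y1 x) = b
  generalize 𝒟.ν (𝒟.s x * 𝒟.Y x) = c
  simp only [smul_sub, mul_sub]
  module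

theorem Y1_zero : 𝒟.Y1 0 = 1 := by
  rw [𝒟.Y1_eq ⟨le_rfl, 𝒟.T_pos.le⟩, 𝒟.s_zero, 𝒟.s1_zero]
  simp

/-- The Gelfand–Levitan equation. -/
theorem K_eq {x : ℝ} (hx : x ∈ Icc 0 𝒟.T) (t : ℝ) :
    𝒟.K x t = -𝒟.ν (𝒟.s x * 𝒟.s t) - ∫ u in (0 : ℝ)..x, 𝒟.K x u * 𝒟.ν (𝒟.s u * 𝒟.s t) := by
  have h1 : 𝒟.Y x = 𝒟.s x - 𝒟.H x (𝒟.Y x) := by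
    rw [eq_sub_iff_add_eq]; exact 𝒟.A_add hx (𝒟.s x)
  rw [K, h1, sub_mul, map_sub, mul_comm (𝒟.H x (𝒟.Y x)), nu_mul_H]
  simp only [K, neg_mul, intervalIntegral.integral_neg]
  simp only [mul_comm (𝒟.Y x), mul_comm (𝒟.s t)]
  ring

theorem L_eq {x : ℝ} (hx : x ∈ Icc 0 𝒟.T) (t : ℝ) :
    𝒟.L x t = -𝒟.ν (𝒟.s1 x * 𝒟.s t) - 𝒟.K x x * 𝒟.ν (𝒟.s x * 𝒟.s t) -
      ∫ u in (0 : ℝ)..x, 𝒟.L x u * 𝒟.ν (𝒟.s u * 𝒟.s t) := by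
  have h1 : 𝒟.Y1 x = 𝒟.s1 x + 𝒟.K x x • 𝒟.s x - 𝒟.H x (𝒟.Y1 x) := by
    rw [eq_sub_iff_add_eq]; exact 𝒟.A_add hx (𝒟.s1 x + 𝒟.K x x • 𝒟.s x)
  rw [L, h1, sub_mul, map_sub, mul_comm (𝒟.H x (𝒟.Y1 x)), nu_mul_H, add_mul, map_add,
    smul_mul_assoc, map_smul, smul_eq_mul]
  simp only [L, neg_mul, intervalIntegral.integral_neg]
  simp only [mul_comm (𝒟.Y1 x), mul_comm (𝒟.s t)]
  ring

/-- The diagonal derivative is expressed through the scalar kernels `ν(s s)` and `ν(s' s)` alone.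
Only these kernels remain controlled when the truncation is removed, so every later estimate starts
from such formulas. -/
theorem dκ_eq {x : ℝ} (hx : x ∈ Icc 0 𝒟.T) :
    𝒟.dκ x = -2 * 𝒟.ν (𝒟.s1 x * 𝒟.s x) - 𝒟.K x x * 𝒟.ν (𝒟.s x * 𝒟.s x) -
      (∫ u in (0 : ℝ)..x, 𝒟.K x u * 𝒟.ν (𝒟.s1 x * 𝒟.s u)) -
      ∫ u in (0 : ℝ)..x, 𝒟.L x u * 𝒟.ν (𝒟.s u * 𝒟.s x) := by
  have h1 : 𝒟.Y x = 𝒟.s x - 𝒟.H x (𝒟.Y x) := by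
    rw [eq_sub_iff_add_eq]; exact 𝒟.A_add hx (𝒟.s x)
  have h2 : 𝒟.L x x = _ := 𝒟.L_eq hx x
  have h3 : 𝒟.dκ x = -𝒟.ν (𝒟.Y x * 𝒟.s1 x) + 𝒟.L x x := by
    rw [dκ, L, map_add]; ring
  rw [h3, h2, h1, sub_mul, map_sub, mul_comm (𝒟.H x (𝒟.Y x)), nu_mul_H]
  simp only [K, neg_mul, intervalIntegral.integral_neg]
  simp only [mul_comm (𝒟.Y x), mul_comm (𝒟.s x) (𝒟.s1 x)]
  ring

end GLData

/-! ### Stability of the Gelfand–Levitan equation with a small kernel -/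

/-- The `L¹` bound for the Fredholm equation with a small kernel. -/
theorem fredholm_bound {T η x : ℝ} (hx : x ∈ Icc 0 T) (hη : 0 ≤ η) (hTη : T * η ≤ 1 / 2)
    {h : ℝ → ℂ} {g : ℝ → ℝ} (ih : IntervalIntegrable h volume 0 x)
    (ig : IntervalIntegrable g volume 0 x)
    (hb : ∀ t ∈ Icc 0 x, ‖h t‖ ≤ g t + η * ∫ u in (0 : ℝ)..x, ‖h u‖) :
    ∫ u in (0 : ℝ)..x, ‖h u‖ ≤ 2 * ∫ u in (0 : ℝ)..x, g u := by
  have h0 : 0 ≤ ∫ u in (0 : ℝ)..x, ‖h u‖ :=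
    intervalIntegral.integral_nonneg hx.1 fun _ _ => norm_nonneg _
  have h1 := intervalIntegral.integral_mono_on hx.1 ih.norm
    (ig.add (intervalIntegrable_const (c := η * ∫ u in (0 : ℝ)..x, ‖h u‖))) hb
  rw [intervalIntegral.integral_add ig intervalIntegrable_const,
    intervalIntegral.integral_const, smul_eq_mul, sub_zero] at h1
  -- After integration over `[0, x]` the kernel term is at most half of the left-hand side and is
  -- absorbed.
  have h2 : x * η ≤ 1 / 2 := (mul_le_mul_of_nonneg_right hx.2 hη).trans hTη
  nlinarith

/-- A triple `(K, L, dκ)` satisfying the Gelfand–Levitan equation with kernel `F`, its derivative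
with respect to `x` (`G` being the derivative of `F`), and the formula for `d/dx K(x, x)`. -/
structure GLSol (T : ℝ) (F G K L : ℝ → ℝ → ℂ) (dκ : ℝ → ℂ) : Prop where
  cont_F : Continuous fun p : ℝ × ℝ => F p.1 p.2
  cont_G : ∀ x ∈ Icc 0 T, Continuous (G x)
  cont_K : ∀ x ∈ Icc 0 T, Continuous (K x)
  cont_L : ∀ x ∈ Icc 0 T, Continuous (L x)
  K_eq : ∀ x ∈ Icc 0 T, ∀ t ∈ Icc 0 T, K x t = -F x t - ∫ u in (0 : ℝ)..x, K x u * F u t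
  L_eq : ∀ x ∈ Icc 0 T, ∀ t ∈ Icc 0 T,
    L x t = -G x t - K x x * F x t - ∫ u in (0 : ℝ)..x, L x u * F u t
  dκ_eq : ∀ x ∈ Icc 0 T, dκ x = -2 * G x x - K x x * F x x -
    (∫ u in (0 : ℝ)..x, K x u * G x u) - ∫ u in (0 : ℝ)..x, L x u * F u x

theorem norm_integral_mul_le {x d : ℝ} (hx : 0 ≤ x) {f g : ℝ → ℂ}
    (hf : IntervalIntegrable f volume 0 x) (hg : ∀ t ∈ Icc 0 x, ‖g t‖ ≤ d) :
    ‖∫ u in (0 : ℝ)..x, f u * g u‖ ≤ d * ∫ u in (0 : ℝ)..x, ‖f u‖ := by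
  rw [← intervalIntegral.integral_const_mul]
  refine intervalIntegral.norm_integral_le_of_norm_le hx (ae_of_all _ fun t ht => ?_)
    (hf.norm.const_mul _)
  rw [norm_mul, mul_comm]
  gcongr
  exact hg t ⟨ht.1.le, ht.2⟩

theorem norm_integral_mul_le' {x d : ℝ} (hx : 0 ≤ x) {f g : ℝ → ℂ}
    (hf : IntervalIntegrable f volume 0 x) (hg : ∀ t ∈ Icc 0 x, ‖g t‖ ≤ d) :
    ‖∫ u in (0 : ℝ)..x, g u * f u‖ ≤ d * ∫ u in (0 : ℝ)..x, ‖f u‖ := by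
  simpa only [mul_comm] using norm_integral_mul_le hx hf hg

namespace GLSol

variable {T : ℝ} {F G K L F' G' K' L' : ℝ → ℝ → ℂ} {dκ dκ' : ℝ → ℂ}

/-- The solution for zero weight; comparison with it turns the Lipschitz estimate into a bound for
the diagonal derivative itself. -/
theorem zero (T : ℝ) : GLSol T (fun _ _ => 0) (fun _ _ => 0) (fun _ _ => 0) (fun _ _ => 0)
    (fun _ => 0) := by
  constructor <;> intros <;> first | fun_prop | simp

theorem cont_F_right (h : GLSol T F G K L dκ) (t : ℝ) : Continuous fun u => F u t :=
  h.cont_F.comp (by fun_prop : Continuous fun u : ℝ => (u, t))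

variable {η d : ℝ}

theorem integral_K_le (h : GLSol T F G K L dκ) (hTη : T * η ≤ 1 / 2)
    (hF : ∀ x ∈ Icc 0 T, ∀ t ∈ Icc 0 T, ‖F x t‖ ≤ η) {x : ℝ} (hx : x ∈ Icc 0 T) :
    ∫ u in (0 : ℝ)..x, ‖K x u‖ ≤ 1 := by
  have hη : 0 ≤ η := (norm_nonneg _).trans (hF x hx x hx)
  have ik := (h.cont_K x hx).intervalIntegrable (μ := volume) 0 x
  have := fredholm_bound hx hη hTη (g := fun _ => η) ik (by simp) fun t ht => by
    have ht' : t ∈ Icc 0 T := ⟨ht.1, ht.2.trans hx.2⟩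
    rw [h.K_eq x hx t ht']
    refine (norm_sub_le _ _).trans (add_le_add ?_ ?_)
    · rw [norm_neg]; exact hF x hx t ht'
    · exact norm_integral_mul_le hx.1 ik fun u hu => hF u ⟨hu.1, hu.2.trans hx.2⟩ t ht'
  rw [intervalIntegral.integral_const, smul_eq_mul, sub_zero] at this
  have h2 : x * η ≤ 1 / 2 := (mul_le_mul_of_nonneg_right hx.2 hη).trans hTη
  linarith

theorem norm_K_le (h : GLSol T F G K L dκ) (hTη : T * η ≤ 1 / 2)
    (hF : ∀ x ∈ Icc 0 T, ∀ t ∈ Icc 0 T, ‖F x t‖ ≤ η) {x t : ℝ} (hx : x ∈ Icc 0 T)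
    (ht : t ∈ Icc 0 T) : ‖K x t‖ ≤ 2 * η := by
  have hη : 0 ≤ η := (norm_nonneg _).trans (hF x hx x hx)
  have ik := (h.cont_K x hx).intervalIntegrable (μ := volume) 0 x
  rw [h.K_eq x hx t ht]
  have h1 := norm_integral_mul_le (g := fun u => F u t) hx.1 ik
    fun u hu => hF u ⟨hu.1, hu.2.trans hx.2⟩ t ht
  have h2 := h.integral_K_le hTη hF hx
  refine (norm_sub_le _ _).trans ?_
  rw [norm_neg]
  have := hF x hx t ht
  nlinarith

/-- The derivative `G` of the kernel is controlled only in the mean over `t`, so `L` is estimated in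
L¹ and not uniformly. -/
theorem integral_L_le (h : GLSol T F G K L dκ) (hTη : T * η ≤ 1 / 2)
    (hF : ∀ x ∈ Icc 0 T, ∀ t ∈ Icc 0 T, ‖F x t‖ ≤ η)
    (hG : ∀ x ∈ Icc 0 T, ∫ t in (0 : ℝ)..x, ‖G x t‖ ≤ η) {x : ℝ} (hx : x ∈ Icc 0 T) :
    ∫ u in (0 : ℝ)..x, ‖L x u‖ ≤ 4 * η := by
  have hη : 0 ≤ η := (norm_nonneg _).trans (hF x hx x hx)
  have il := (h.cont_L x hx).intervalIntegrable (μ := volume) 0 x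
  have ig := ((h.cont_G x hx).intervalIntegrable (μ := volume) 0 x).norm
  have := fredholm_bound hx hη hTη (g := fun t => ‖G x t‖ + 2 * η * η) il (ig.add (by simp))
    fun t ht => by
      have ht' : t ∈ Icc 0 T := ⟨ht.1, ht.2.trans hx.2⟩
      rw [h.L_eq x hx t ht']
      refine (norm_sub_le _ _).trans (add_le_add ((norm_sub_le _ _).trans (add_le_add ?_ ?_)) ?_)
      · rw [norm_neg]
      · rw [norm_mul]
        gcongr
        · exact h.norm_K_le hTη hF hx hx
        · exact hF x hx t ht'
      · exact norm_integral_mul_le hx.1 il fun u hu => hF u ⟨hu.1, hu.2.trans hx.2⟩ t ht'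
  rw [intervalIntegral.integral_add ig (by simp), intervalIntegral.integral_const, smul_eq_mul,
    sub_zero] at this
  have h2 : x * η ≤ 1 / 2 := (mul_le_mul_of_nonneg_right hx.2 hη).trans hTη
  have := hG x hx
  nlinarith

section Difference

variable (h : GLSol T F G K L dκ) (h' : GLSol T F' G' K' L' dκ') (hTη : T * η ≤ 1 / 2)
  (hF : ∀ x ∈ Icc 0 T, ∀ t ∈ Icc 0 T, ‖F x t‖ ≤ η)
  (hF' : ∀ x ∈ Icc 0 T, ∀ t ∈ Icc 0 T, ‖F' x t‖ ≤ η)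
  (hd : ∀ x ∈ Icc 0 T, ∀ t ∈ Icc 0 T, ‖F x t - F' x t‖ ≤ d)

include h h' hTη hF hF' hd

/-- The difference of the solutions satisfies the same Fredholm equation with free term `-(F - F') -
∫ K' (F - F')`, which is at most `2d` because the L¹ norm of `K'` is at most 1. -/
theorem norm_K_sub_le_aux {x t : ℝ} (hx : x ∈ Icc 0 T) (ht : t ∈ Icc 0 T) :
    ‖K x t - K' x t‖ ≤ 2 * d + η * ∫ u in (0 : ℝ)..x, ‖K x u - K' x u‖ := by
  have hd0 : 0 ≤ d := (norm_nonneg _).trans (hd x hx x hx)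
  have ck := h.cont_K x hx
  have ck' := h'.cont_K x hx
  have cF := h.cont_F_right t
  have cF' := h'.cont_F_right t
  have e : K x t - K' x t = -(F x t - F' x t) - (∫ u in (0 : ℝ)..x, (K x u - K' x u) * F u t) -
      ∫ u in (0 : ℝ)..x, K' x u * (F u t - F' u t) := by
    rw [h.K_eq x hx t ht, h'.K_eq x hx t ht]
    have : (∫ u in (0 : ℝ)..x, (K x u - K' x u) * F u t) +
        ∫ u in (0 : ℝ)..x, K' x u * (F u t - F' u t) =
        (∫ u in (0 : ℝ)..x, K x u * F u t) - ∫ u in (0 : ℝ)..x, K' x u * F' u t := by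
      rw [← intervalIntegral.integral_add, ← intervalIntegral.integral_sub]
      · congr 1; ext u; ring
      all_goals exact Continuous.intervalIntegrable (by fun_prop) _ _
    linear_combination this
  rw [e]
  have h1 := norm_integral_mul_le (f := fun u => K x u - K' x u) (g := fun u => F u t) hx.1
    ((ck.sub ck').intervalIntegrable _ _)
    fun u hu => hF u ⟨hu.1, hu.2.trans hx.2⟩ t ht
  have h2 := norm_integral_mul_le (f := fun u => K' x u) (g := fun u => F u t - F' u t) hx.1
    (ck'.intervalIntegrable _ _) fun u hu => hd u ⟨hu.1, hu.2.trans hx.2⟩ t ht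
  have h3 := h'.integral_K_le hTη hF' hx
  have h4 := hd x hx t ht
  refine (norm_sub_le _ _).trans ?_
  refine (add_le_add_left (norm_sub_le _ _) _).trans ?_
  rw [norm_neg]
  nlinarith

theorem integral_K_sub_le {x : ℝ} (hx : x ∈ Icc 0 T) :
    ∫ u in (0 : ℝ)..x, ‖K x u - K' x u‖ ≤ 4 * T * d := by
  have hη : 0 ≤ η := (norm_nonneg _).trans (hF x hx x hx)
  have hd0 : 0 ≤ d := (norm_nonneg _).trans (hd x hx x hx)
  have := fredholm_bound hx hη hTη (g := fun _ => 2 * d)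
    (((h.cont_K x hx).sub (h'.cont_K x hx)).intervalIntegrable (μ := volume) 0 x) (by simp)
    fun t ht => norm_K_sub_le_aux h h' hTη hF hF' hd hx ⟨ht.1, ht.2.trans hx.2⟩
  rw [intervalIntegral.integral_const, smul_eq_mul, sub_zero] at this
  have := hx.2
  simp only [Pi.sub_apply] at *
  nlinarith

theorem norm_K_sub_le {x t : ℝ} (hx : x ∈ Icc 0 T) (ht : t ∈ Icc 0 T) :
    ‖K x t - K' x t‖ ≤ 4 * d := by
  have hη : 0 ≤ η := (norm_nonneg _).trans (hF x hx x hx)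
  have hd0 : 0 ≤ d := (norm_nonneg _).trans (hd x hx x hx)
  have h1 := norm_K_sub_le_aux h h' hTη hF hF' hd hx ht
  have h2 := integral_K_sub_le h h' hTη hF hF' hd hx
  have h3 : η * (∫ u in (0 : ℝ)..x, ‖K x u - K' x u‖) ≤ η * (4 * T * d) := by gcongr
  nlinarith

variable (hG : ∀ x ∈ Icc 0 T, ∫ t in (0 : ℝ)..x, ‖G x t‖ ≤ η)
  (hG' : ∀ x ∈ Icc 0 T, ∫ t in (0 : ℝ)..x, ‖G' x t‖ ≤ η)
  (hdG : ∀ x ∈ Icc 0 T, ∫ t in (0 : ℝ)..x, ‖G x t - G' x t‖ ≤ d)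

theorem norm_K_mul_F_sub_le {x t : ℝ} (hx : x ∈ Icc 0 T) (ht : t ∈ Icc 0 T) :
    ‖K x x * F x t - K' x x * F' x t‖ ≤ 6 * d * η := by
  have hη : 0 ≤ η := (norm_nonneg _).trans (hF x hx x hx)
  have hd0 : 0 ≤ d := (norm_nonneg _).trans (hd x hx x hx)
  have e : K x x * F x t - K' x x * F' x t =
      (K x x - K' x x) * F x t + K' x x * (F x t - F' x t) := by ring
  rw [e]
  refine (norm_add_le _ _).trans ?_
  rw [norm_mul, norm_mul]
  have h1 := norm_K_sub_le h h' hTη hF hF' hd hx hx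
  have h2 := h'.norm_K_le hTη hF' hx hx
  calc _ ≤ (4 * d) * η + (2 * η) * d := by
        gcongr
        · exact hF x hx t ht
        · exact hd x hx t ht
    _ = _ := by ring

include hG' hdG

theorem integral_L_sub_le {x : ℝ} (hx : x ∈ Icc 0 T) :
    ∫ u in (0 : ℝ)..x, ‖L x u - L' x u‖ ≤ 12 * d := by
  have hη : 0 ≤ η := (norm_nonneg _).trans (hF x hx x hx)
  have hd0 : 0 ≤ d := (norm_nonneg _).trans (hd x hx x hx)
  have cl := h.cont_L x hx
  have cl' := h'.cont_L x hx
  have cg := h.cont_G x hx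
  have cg' := h'.cont_G x hx
  have ig : IntervalIntegrable (fun t => ‖G x t - G' x t‖) volume 0 x :=
    Continuous.intervalIntegrable (by fun_prop) _ _
  have il : IntervalIntegrable (fun t => L x t - L' x t) volume 0 x :=
    Continuous.intervalIntegrable (by fun_prop) _ _
  have key := fredholm_bound hx hη hTη (h := fun t => L x t - L' x t)
    (g := fun t => ‖G x t - G' x t‖ + (6 * d * η + 4 * η * d)) il (ig.add (by simp))
    fun t ht => by
      have ht' : t ∈ Icc 0 T := ⟨ht.1, ht.2.trans hx.2⟩
      have cF := h.cont_F_right t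
      have cF' := h'.cont_F_right t
      have e : L x t - L' x t = -(G x t - G' x t) - (K x x * F x t - K' x x * F' x t) -
          (∫ u in (0 : ℝ)..x, (L x u - L' x u) * F u t) -
          ∫ u in (0 : ℝ)..x, L' x u * (F u t - F' u t) := by
        rw [h.L_eq x hx t ht', h'.L_eq x hx t ht']
        have : (∫ u in (0 : ℝ)..x, (L x u - L' x u) * F u t) +
            ∫ u in (0 : ℝ)..x, L' x u * (F u t - F' u t) =
            (∫ u in (0 : ℝ)..x, L x u * F u t) - ∫ u in (0 : ℝ)..x, L' x u * F' u t := by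
          rw [← intervalIntegral.integral_add, ← intervalIntegral.integral_sub]
          · congr 1; ext u; ring
          all_goals exact Continuous.intervalIntegrable (by fun_prop) _ _
        linear_combination this
      have h1 := norm_integral_mul_le (f := fun u => L x u - L' x u) (g := fun u => F u t) hx.1 il
        fun u hu => hF u ⟨hu.1, hu.2.trans hx.2⟩ t ht'
      have h2 := norm_integral_mul_le (f := fun u => L' x u) (g := fun u => F u t - F' u t) hx.1
        (cl'.intervalIntegrable _ _) fun u hu => hd u ⟨hu.1, hu.2.trans hx.2⟩ t ht'
      have h3 := h'.integral_L_le hTη hF' hG' hx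
      have h4 := norm_K_mul_F_sub_le h h' hTη hF hF' hd hx ht'
      rw [e]
      refine (norm_sub_le _ _).trans ?_
      refine (add_le_add_left (norm_sub_le _ _) _).trans ?_
      refine (add_le_add_left (add_le_add_left (norm_sub_le _ _) _) _).trans ?_
      rw [norm_neg]
      nlinarith
  rw [intervalIntegral.integral_add ig (by simp), intervalIntegral.integral_const, smul_eq_mul,
    sub_zero] at key
  have h2 : x * η ≤ 1 / 2 := (mul_le_mul_of_nonneg_right hx.2 hη).trans hTη
  have := hdG x hx
  nlinarith

include hG

/-- Only the diagonal value of `G - G'` has no pointwise bound, so it is kept on the left. The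
remaining five terms contribute `6 + 4 + 2 + 12 + 4 = 28` times `η d`. -/
theorem norm_dκ_sub_le {x : ℝ} (hx : x ∈ Icc 0 T) :
    ‖(dκ x - dκ' x) + 2 * (G x x - G' x x)‖ ≤ 28 * η * d := by
  have hη : 0 ≤ η := (norm_nonneg _).trans (hF x hx x hx)
  have hd0 : 0 ≤ d := (norm_nonneg _).trans (hd x hx x hx)
  have ck := h.cont_K x hx
  have ck' := h'.cont_K x hx
  have cl := h.cont_L x hx
  have cl' := h'.cont_L x hx
  have cg := h.cont_G x hx
  have cg' := h'.cont_G x hx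
  have cF := h.cont_F_right x
  have cF' := h'.cont_F_right x
  have e : (dκ x - dκ' x) + 2 * (G x x - G' x x) = -(K x x * F x x - K' x x * F' x x) -
      ((∫ u in (0 : ℝ)..x, (K x u - K' x u) * G x u) +
        ∫ u in (0 : ℝ)..x, K' x u * (G x u - G' x u)) -
      ((∫ u in (0 : ℝ)..x, (L x u - L' x u) * F u x) +
        ∫ u in (0 : ℝ)..x, L' x u * (F u x - F' u x)) := by
    rw [h.dκ_eq x hx, h'.dκ_eq x hx]
    have e1 : (∫ u in (0 : ℝ)..x, (L x u - L' x u) * F u x) +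
        ∫ u in (0 : ℝ)..x, L' x u * (F u x - F' u x) =
        (∫ u in (0 : ℝ)..x, L x u * F u x) - ∫ u in (0 : ℝ)..x, L' x u * F' u x := by
      rw [← intervalIntegral.integral_add, ← intervalIntegral.integral_sub]
      · congr 1; ext u; ring
      all_goals exact Continuous.intervalIntegrable (by fun_prop) _ _
    have e2 : (∫ u in (0 : ℝ)..x, (K x u - K' x u) * G x u) +
        ∫ u in (0 : ℝ)..x, K' x u * (G x u - G' x u) =
        (∫ u in (0 : ℝ)..x, K x u * G x u) - ∫ u in (0 : ℝ)..x, K' x u * G' x u := by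
      rw [← intervalIntegral.integral_add, ← intervalIntegral.integral_sub]
      · congr 1; ext u; ring
      all_goals exact Continuous.intervalIntegrable (by fun_prop) _ _
    rw [e1, e2]
    ring
  have il : IntervalIntegrable (fun t => L x t - L' x t) volume 0 x :=
    Continuous.intervalIntegrable (by fun_prop) _ _
  have igd : IntervalIntegrable (fun t => G x t - G' x t) volume 0 x :=
    Continuous.intervalIntegrable (by fun_prop) _ _
  have n1 := norm_K_mul_F_sub_le h h' hTη hF hF' hd hx hx
  have n2 := norm_integral_mul_le' (g := fun u => K x u - K' x u) (f := fun u => G x u) hx.1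
    (cg.intervalIntegrable _ _)
    fun u hu => norm_K_sub_le h h' hTη hF hF' hd hx ⟨hu.1, hu.2.trans hx.2⟩
  have n3 := norm_integral_mul_le' (g := fun u => K' x u) (f := fun u => G x u - G' x u) hx.1 igd
    fun u hu => h'.norm_K_le hTη hF' hx ⟨hu.1, hu.2.trans hx.2⟩
  have n4 := norm_integral_mul_le (f := fun u => L x u - L' x u) (g := fun u => F u x) hx.1 il
    fun u hu => hF u ⟨hu.1, hu.2.trans hx.2⟩ x hx
  have n5 := norm_integral_mul_le (f := fun u => L' x u) (g := fun u => F u x - F' u x) hx.1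
    (cl'.intervalIntegrable _ _) fun u hu => hd u ⟨hu.1, hu.2.trans hx.2⟩ x hx
  have n6 := h'.integral_L_le hTη hF' hG' hx
  have n7 := integral_L_sub_le h h' hTη hF hF' hd hG' hdG hx
  rw [e]
  refine (norm_sub_le _ _).trans ?_
  refine (add_le_add (norm_sub_le _ _) (norm_add_le _ _)).trans ?_
  refine (add_le_add_left (add_le_add_right (norm_add_le _ _) _) _).trans ?_
  rw [norm_neg]
  have m2 : 4 * d * (∫ u in (0 : ℝ)..x, ‖G x u‖) ≤ 4 * d * η := by gcongr; exact hG x hx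
  have m3 : 2 * η * (∫ u in (0 : ℝ)..x, ‖G x u - G' x u‖) ≤ 2 * η * d := by
    gcongr; exact hdG x hx
  have m4 : η * (∫ u in (0 : ℝ)..x, ‖L x u - L' x u‖) ≤ η * (12 * d) := by gcongr
  have m5 : d * (∫ u in (0 : ℝ)..x, ‖L' x u‖) ≤ d * (4 * η) := by gcongr
  linarith

end Difference

end GLSol

/-! ### The sine-type solution on a horizontal line -/

theorem linePoint_im (τ σ : ℝ) : (linePoint τ σ).im = τ := by simp [linePoint]

theorem linePoint_re (τ σ : ℝ) : (linePoint τ σ).re = σ := by simp [linePoint]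

@[fun_prop]
theorem continuous_linePoint (τ : ℝ) : Continuous (linePoint τ) := by
  unfold linePoint; fun_prop

theorem le_norm_linePoint {τ : ℝ} (hτ : 0 < τ) (σ : ℝ) : τ ≤ ‖linePoint τ σ‖ := by
  have := Complex.abs_im_le_norm (linePoint τ σ)
  rwa [linePoint_im, abs_of_pos hτ] at this

theorem abs_le_norm_linePoint (τ σ : ℝ) : |σ| ≤ ‖linePoint τ σ‖ := by
  have := Complex.abs_re_le_norm (linePoint τ σ)
  rwa [linePoint_re] at this

theorem linePoint_ne_zero {τ : ℝ} (hτ : 0 < τ) (σ : ℝ) : linePoint τ σ ≠ 0 :=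
  norm_pos_iff.1 (hτ.trans_le (le_norm_linePoint hτ σ))

theorem norm_linePoint_sq (τ σ : ℝ) : ‖linePoint τ σ‖ ^ 2 = σ ^ 2 + τ ^ 2 := by
  rw [← Complex.normSq_eq_norm_sq, Complex.normSq_apply, linePoint_re, linePoint_im]; ring

theorem memLp_inv_linePoint {τ : ℝ} (hτ : 0 < τ) :
    MemLp (fun σ : ℝ => (linePoint τ σ)⁻¹) 2 volume := by
  have hc : Continuous fun σ : ℝ => (linePoint τ σ)⁻¹ :=
    (continuous_linePoint τ).inv₀ (linePoint_ne_zero hτ)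
  rw [memLp_two_iff_integrable_sq_norm hc.aestronglyMeasurable]
  -- The constant comes from `1 + σ² ≤ (1 + τ⁻²)(σ² + τ²)`.
  refine Integrable.mono' (g := fun σ => (1 + τ⁻¹ ^ 2) * (1 + σ ^ 2)⁻¹)
    (integrable_inv_one_add_sq.const_mul _) (by fun_prop) (ae_of_all _ fun σ => ?_)
  rw [Real.norm_of_nonneg (by positivity), norm_inv, inv_pow, norm_linePoint_sq,
    ← div_eq_mul_inv, inv_eq_one_div, div_le_div_iff₀ (by positivity) (by positivity), inv_pow]
  have h1 : (τ ^ 2)⁻¹ * τ ^ 2 = 1 := by field_simp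
  have h2 : 0 ≤ (τ ^ 2)⁻¹ * σ ^ 2 := by positivity
  nlinarith [sq_nonneg τ]

section Edge

variable {T : ℝ} (hT : 0 ≤ T) {q : ℝ → ℂ} (hq : IntervalIntegrable q volume 0 T)

/-- The solution with initial data `0`, `1`. -/
@[irreducible] noncomputable def sSol (x : ℝ) (lam : ℂ) : ℂ := ext hT (solFun hT hq 0 1 lam) x

/-- The derivative of the solution with initial data `0`, `1`. -/
@[irreducible] noncomputable def dsSol (x : ℝ) (lam : ℂ) : ℂ := ext hT (dsolFun hT hq 0 1 lam) x

theorem continuous_sSol : Continuous fun p : ℝ × ℂ => sSol hT hq p.1 p.2 := by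
  simp only [sSol]
  exact continuous_uncurry_ext hT (differentiable_solFun hT hq 0 1).continuous

theorem continuous_dsSol : Continuous fun p : ℝ × ℂ => dsSol hT hq p.1 p.2 := by
  simp only [dsSol]
  exact continuous_uncurry_ext hT (differentiable_dsolFun hT hq 0 1).continuous

theorem _root_.Continuous.sSol {X : Type*} [TopologicalSpace X] {f : X → ℝ} {g : X → ℂ}
    (hf : Continuous f) (hg : Continuous g) : Continuous fun p => sSol hT hq (f p) (g p) := by
  have := (continuous_sSol hT hq).comp (hf.prodMk hg)
  simpa only [Function.comp_def] using this

theorem _root_.Continuous.dsSol {X : Type*} [TopologicalSpace X] {f : X → ℝ} {g : X → ℂ}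
    (hf : Continuous f) (hg : Continuous g) : Continuous fun p => dsSol hT hq (f p) (g p) := by
  have := (continuous_dsSol hT hq).comp (hf.prodMk hg)
  simpa only [Function.comp_def] using this

/-- For `‖θ‖ ≥ 2Q` these are the large-parameter bounds. The rest of the line lies over a compact
set of `(x, σ)`, where continuity gives a bound and the factor `‖θ⁻¹‖` is bounded below. -/
theorem exists_sSol_bounds {τ : ℝ} (hτ : 0 < τ) : ∃ C : ℝ, 0 < C ∧ ∀ σ : ℝ, ∀ x ∈ Icc 0 T,
    ‖linePoint τ σ * sSol hT hq x (linePoint τ σ ^ 2)‖ ≤ C ∧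
    ‖dsSol hT hq x (linePoint τ σ ^ 2)‖ ≤ C ∧
    ‖Complex.sin (linePoint τ σ * x)‖ ≤ C ∧ ‖Complex.cos (linePoint τ σ * x)‖ ≤ C ∧
    ‖linePoint τ σ * sSol hT hq x (linePoint τ σ ^ 2) - Complex.sin (linePoint τ σ * x)‖ ≤
      C * ‖(linePoint τ σ)⁻¹‖ ∧
    ‖dsSol hT hq x (linePoint τ σ ^ 2) - Complex.cos (linePoint τ σ * x)‖ ≤
      C * ‖(linePoint τ σ)⁻¹‖ := by
  set Q := ∫ t in (0 : ℝ)..T, ‖q t‖ with hQ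
  have hQ0 : 0 ≤ Q := intervalIntegral.integral_nonneg hT fun _ _ => norm_nonneg _
  set E := Real.exp (τ * T) with hE
  have hE1 : ∀ x ∈ Icc 0 T, Real.exp (τ * x) ≤ E := fun x hx => by
    rw [hE]; gcongr; exact hx.2
  have cS := continuous_sSol hT hq
  have cS1 := continuous_dsSol hT hq
  have cS' : Continuous fun p : ℝ × ℝ =>
      linePoint τ p.2 * sSol hT hq p.1 (linePoint τ p.2 ^ 2) - Complex.sin (linePoint τ p.2 * p.1) := by
    have := cS.comp (by fun_prop : Continuous fun p : ℝ × ℝ => (p.1, linePoint τ p.2 ^ 2))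
    simp only [Function.comp_def] at this
    fun_prop
  have cS1' : Continuous fun p : ℝ × ℝ =>
      dsSol hT hq p.1 (linePoint τ p.2 ^ 2) - Complex.cos (linePoint τ p.2 * p.1) := by
    have := cS1.comp (by fun_prop : Continuous fun p : ℝ × ℝ => (p.1, linePoint τ p.2 ^ 2))
    simp only [Function.comp_def] at this
    fun_prop
  have hK : IsCompact (Icc 0 T ×ˢ Icc (-(2 * Q + 1)) (2 * Q + 1)) := isCompact_Icc.prod isCompact_Icc
  obtain ⟨C1, hC1⟩ := hK.exists_bound_of_continuousOn cS'.continuousOn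
  obtain ⟨C2, hC2⟩ := hK.exists_bound_of_continuousOn cS1'.continuousOn
  -- The first summand serves large `‖θ‖`, the second one the compact part, where `1 ≤ (2Q + 1)
  -- ‖θ⁻¹‖`.
  set D := 2 * Q * E + (|C1| + |C2|) * (2 * Q + 1) with hD
  have hD0 : 0 ≤ D := by positivity
  have main : ∀ σ : ℝ, ∀ x ∈ Icc 0 T,
    ‖linePoint τ σ * sSol hT hq x (linePoint τ σ ^ 2) - Complex.sin (linePoint τ σ * x)‖ ≤
      D * ‖(linePoint τ σ)⁻¹‖ ∧
    ‖dsSol hT hq x (linePoint τ σ ^ 2) - Complex.cos (linePoint τ σ * x)‖ ≤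
      D * ‖(linePoint τ σ)⁻¹‖ := by
    intro σ x hx
    have hne := linePoint_ne_zero hτ σ
    have hpos : 0 < ‖linePoint τ σ‖ := norm_pos_iff.2 hne
    rcases le_or_gt (2 * Q) ‖linePoint τ σ‖ with hl | hl
    · have sol := isSLSolution_solFun hT hq 0 1 (linePoint τ σ ^ 2)
      have b1 := sol.norm_sub_free_le hq hne hl hx
      have b2 := sol.norm_deriv_sub_free_le hq hne hl hx
      rw [ext_solFun_zero, ext_dsolFun_zero, linePoint_im, abs_of_pos hτ] at b1 b2
      simp only [norm_zero, norm_one, zero_mul, zero_add, one_mul, neg_zero] at b1 b2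
      have hDE : 2 * Q * E ≤ D := by rw [hD]; exact le_add_of_nonneg_right (by positivity)
      constructor
      · have e : linePoint τ σ * sSol hT hq x (linePoint τ σ ^ 2) - Complex.sin (linePoint τ σ * x) =
          linePoint τ σ * (ext hT (solFun hT hq 0 1 (linePoint τ σ ^ 2)) x -
            Complex.sin (linePoint τ σ * x) / linePoint τ σ) := by
          rw [sSol]; field_simp
        rw [e, norm_mul, norm_inv]
        calc _ ≤ ‖linePoint τ σ‖ * (2 * (1 / ‖linePoint τ σ‖) * Q / ‖linePoint τ σ‖ * E) := by
              gcongr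
              refine b1.trans ?_
              gcongr
              exact hE1 x hx
          _ = 2 * Q * E * ‖linePoint τ σ‖⁻¹ := by field_simp
          _ ≤ _ := by gcongr
      · rw [norm_inv]
        calc _ ≤ 2 * (1 / ‖linePoint τ σ‖) * Q * E := by
              rw [dsSol]
              refine b2.trans ?_
              gcongr
              exact hE1 x hx
          _ = 2 * Q * E * ‖linePoint τ σ‖⁻¹ := by field_simp
          _ ≤ _ := by gcongr
    · have hσ : σ ∈ Icc (-(2 * Q + 1)) (2 * Q + 1) :=
        abs_le.1 ((abs_le_norm_linePoint τ σ).trans (by linarith))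
      have h1 : 1 ≤ (2 * Q + 1) * ‖(linePoint τ σ)⁻¹‖ := by
        rw [norm_inv, ← div_eq_mul_inv, le_div_iff₀ hpos]; linarith
      have hDC : (|C1| + |C2|) * (2 * Q + 1) ≤ D := by
        rw [hD]; exact le_add_of_nonneg_left (by positivity)
      have h2 : |C1| + |C2| ≤ D * ‖(linePoint τ σ)⁻¹‖ := by
        calc _ = (|C1| + |C2|) * 1 := (mul_one _).symm
          _ ≤ (|C1| + |C2|) * ((2 * Q + 1) * ‖(linePoint τ σ)⁻¹‖) := by gcongr
          _ = (|C1| + |C2|) * (2 * Q + 1) * ‖(linePoint τ σ)⁻¹‖ := by ring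
          _ ≤ _ := by gcongr
      have m1 := hC1 (x, σ) ⟨hx, hσ⟩
      have m2 := hC2 (x, σ) ⟨hx, hσ⟩
      have a1 := le_abs_self C1
      have a2 := le_abs_self C2
      have a3 := abs_nonneg C1
      have a4 := abs_nonneg C2
      exact ⟨by simp only at m1; linarith, by simp only at m2; linarith⟩
  have hE0 : 0 < E := Real.exp_pos _
  have hinv : ∀ σ, ‖(linePoint τ σ)⁻¹‖ ≤ τ⁻¹ := fun σ => by
    rw [norm_inv]; exact inv_anti₀ hτ (le_norm_linePoint hτ σ)
  have hDτ : 0 ≤ D * τ⁻¹ := by positivity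
  refine ⟨E + D + D * τ⁻¹, by positivity, fun σ x hx => ?_⟩
  obtain ⟨m1, m2⟩ := main σ x hx
  have hs := norm_sin_mul_le (linePoint τ σ) hx.1
  have hc := norm_cos_mul_le (linePoint τ σ) hx.1
  rw [linePoint_im, abs_of_pos hτ] at hs hc
  replace hs := hs.trans (hE1 x hx)
  replace hc := hc.trans (hE1 x hx)
  have m3 : D * ‖(linePoint τ σ)⁻¹‖ ≤ D * τ⁻¹ := by gcongr; exact hinv σ
  have m4 : D * ‖(linePoint τ σ)⁻¹‖ ≤ (E + D + D * τ⁻¹) * ‖(linePoint τ σ)⁻¹‖ := by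
    gcongr; linarith
  have t1 := norm_le_norm_add_norm_sub' (linePoint τ σ * sSol hT hq x (linePoint τ σ ^ 2))
    (Complex.sin (linePoint τ σ * x))
  have t2 := norm_le_norm_add_norm_sub' (dsSol hT hq x (linePoint τ σ ^ 2))
    (Complex.cos (linePoint τ σ * x))
  exact ⟨by linarith, by linarith, by linarith, by linarith, m1.trans m4, m2.trans m4⟩

end Edge

/-! ### Kernels generated by an L₂ weight -/

/-- The `L₂(ℝ)` norm as a real number. -/
noncomputable def l2norm (w : ℝ → ℂ) : ℝ := (eLpNorm w 2 volume).toReal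

theorem l2norm_nonneg (w : ℝ → ℂ) : 0 ≤ l2norm w := ENNReal.toReal_nonneg

theorem continuous_exp_transform {f : ℝ → ℂ} (hf : Integrable f) :
    Continuous fun y : ℝ => ∫ t, f t * Complex.exp (Complex.I * y * t) := by
  refine continuous_of_dominated (bound := fun t => ‖f t‖) (fun y => ?_) (fun y => ?_) hf.norm ?_
  · exact hf.1.mul (by fun_prop)
  · refine ae_of_all _ fun t => ?_
    rw [norm_mul, Complex.norm_exp]
    simp
  · exact ae_of_all _ fun t => by fun_prop

theorem norm_exp_transform_two (w : ℝ → ℂ) (h1 : Integrable w) (h2 : MemLp w 2) :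
    l2norm (fun y : ℝ => ∫ t, w t * Complex.exp (Complex.I * y * t)) ≤
      √(2 * Real.pi) * l2norm w := by
  rw [l2norm, eLpNorm_exp_transform h1 h2, ENNReal.toReal_mul, l2norm,
    ENNReal.ofReal_rpow_of_pos Real.two_pi_pos, ENNReal.toReal_ofReal (by positivity),
    Real.sqrt_eq_rpow]

theorem memLp_exp_transform {w : ℝ → ℂ} (h1 : Integrable w) (h2 : MemLp w 2) :
    MemLp (fun y : ℝ => ∫ t, w t * Complex.exp (Complex.I * y * t)) 2 volume := by
  refine ⟨(continuous_exp_transform h1).aestronglyMeasurable, ?_⟩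
  rw [eLpNorm_exp_transform h1 h2]
  exact ENNReal.mul_lt_top (ENNReal.rpow_lt_top_of_nonneg (by norm_num) ENNReal.ofReal_ne_top) h2.2

section Kernels

variable {T : ℝ} (hT : 0 ≤ T) {q : ℝ → ℂ} (hq : IntervalIntegrable q volume 0 T) (τ : ℝ)

/-- The solution `S(x, θ²)` at the point `θ = σ + iτ`. -/
@[irreducible] noncomputable def lineS (x σ : ℝ) : ℂ := sSol hT hq x (linePoint τ σ ^ 2)

/-- The derivative `S'(x, θ²)` at the point `θ = σ + iτ`. -/
@[irreducible] noncomputable def lineDS (x σ : ℝ) : ℂ := dsSol hT hq x (linePoint τ σ ^ 2)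

/-- The kernel `∫ w(σ) θ S(x, θ²) S(t, θ²) dσ`, `θ = σ + iτ`. -/
noncomputable def kerF (w : ℝ → ℂ) (x t : ℝ) : ℂ := ∫ σ, w σ * (linePoint τ σ *
  (lineS hT hq τ x σ * lineS hT hq τ t σ))

/-- The derivative of the kernel with respect to the first variable. -/
noncomputable def kerG (w : ℝ → ℂ) (x t : ℝ) : ℂ := ∫ σ, w σ * (linePoint τ σ *
  (lineDS hT hq τ x σ * lineS hT hq τ t σ))

theorem continuous_lineS : Continuous fun p : ℝ × ℝ => lineS hT hq τ p.1 p.2 := by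
  simp only [lineS]
  have h : Continuous fun p : ℝ × ℝ => ((p.1, linePoint τ p.2 ^ 2) : ℝ × ℂ) :=
    continuous_fst.prodMk (((continuous_linePoint τ).comp continuous_snd).pow 2)
  simpa only [Function.comp_def] using (continuous_sSol hT hq).comp h

theorem continuous_lineDS : Continuous fun p : ℝ × ℝ => lineDS hT hq τ p.1 p.2 := by
  simp only [lineDS]
  have h : Continuous fun p : ℝ × ℝ => ((p.1, linePoint τ p.2 ^ 2) : ℝ × ℂ) :=
    continuous_fst.prodMk (((continuous_linePoint τ).comp continuous_snd).pow 2)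
  simpa only [Function.comp_def] using (continuous_dsSol hT hq).comp h

/-- Outside `[0, T]` the solutions are extended by their endpoint values, so bounds on the interval
hold for all real `x` and the kernels are continuous on the whole plane. -/
theorem sSol_proj (x : ℝ) (lam : ℂ) : sSol hT hq x lam = sSol hT hq (projIcc 0 T hT x) lam := by
  simp [sSol, LoopGraph.ext]

theorem dsSol_proj (x : ℝ) (lam : ℂ) : dsSol hT hq x lam = dsSol hT hq (projIcc 0 T hT x) lam := by
  simp [dsSol, LoopGraph.ext]

/-- Uniform bounds for the solutions on the line `Im θ = τ`. -/
structure LineBounds (C : ℝ) : Prop where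
  pos : 0 < C
  sol : ∀ σ x : ℝ, ‖linePoint τ σ * lineS hT hq τ x σ‖ ≤ C
  dsol : ∀ σ x : ℝ, ‖lineDS hT hq τ x σ‖ ≤ C
  sin : ∀ σ : ℝ, ∀ x ∈ Icc 0 T, ‖Complex.sin (linePoint τ σ * x)‖ ≤ C
  cos : ∀ σ : ℝ, ∀ x ∈ Icc 0 T, ‖Complex.cos (linePoint τ σ * x)‖ ≤ C
  sol_sub : ∀ σ : ℝ, ∀ x ∈ Icc 0 T, ‖linePoint τ σ * lineS hT hq τ x σ -
    Complex.sin (linePoint τ σ * x)‖ ≤ C * ‖(linePoint τ σ)⁻¹‖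
  dsol_sub : ∀ σ : ℝ, ∀ x ∈ Icc 0 T, ‖lineDS hT hq τ x σ -
    Complex.cos (linePoint τ σ * x)‖ ≤ C * ‖(linePoint τ σ)⁻¹‖

variable {τ}

theorem exists_lineBounds (hτ : 0 < τ) : ∃ C, LineBounds hT hq τ C := by
  obtain ⟨C, hC, h⟩ := exists_sSol_bounds hT hq hτ
  refine ⟨C, hC, fun σ x => ?_, fun σ x => ?_, fun σ x hx => (h σ x hx).2.2.1,
    fun σ x hx => (h σ x hx).2.2.2.1, fun σ x hx => ?_, fun σ x hx => ?_⟩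
  · rw [lineS, sSol_proj]; exact (h σ _ (projIcc 0 T hT x).2).1
  · rw [lineDS, dsSol_proj]; exact (h σ _ (projIcc 0 T hT x).2).2.1
  · rw [lineS]; exact (h σ x hx).2.2.2.2.1
  · rw [lineDS]; exact (h σ x hx).2.2.2.2.2

variable (hτ : 0 < τ) {C : ℝ} (hC : LineBounds hT hq τ C)
include hτ hC

namespace LineBounds

/-- Each solution carries a factor `1/θ`, so against the single `θ` of the measure one `1/θ` is
left. This is the square-integrable decay that pairs with an L₂ weight. -/
theorem norm_F_le (σ x t : ℝ) : ‖linePoint τ σ *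
    (lineS hT hq τ x σ * lineS hT hq τ t σ)‖ ≤
      C ^ 2 * ‖(linePoint τ σ)⁻¹‖ := by
  have hne := linePoint_ne_zero hτ σ
  have e : linePoint τ σ *
    (lineS hT hq τ x σ * lineS hT hq τ t σ) =
    (linePoint τ σ * lineS hT hq τ x σ) *
    (linePoint τ σ * lineS hT hq τ t σ) * (linePoint τ σ)⁻¹ := by field_simp
  rw [e, norm_mul, norm_mul, pow_two C]
  have := hC.pos
  gcongr
  · exact hC.sol σ x
  · exact hC.sol σ t

omit hτ in
theorem norm_G_le (σ x t : ℝ) : ‖linePoint τ σ *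
    (lineDS hT hq τ x σ * lineS hT hq τ t σ)‖ ≤ C ^ 2 := by
  have e : linePoint τ σ *
    (lineDS hT hq τ x σ * lineS hT hq τ t σ) =
    lineDS hT hq τ x σ *
    (linePoint τ σ * lineS hT hq τ t σ) := by ring
  rw [e, norm_mul, pow_two C]
  have := hC.pos
  gcongr
  · exact hC.dsol σ x
  · exact hC.sol σ t

omit hτ in
-- Differentiation in `x` costs the decay, so the integrand of `kerG` is only bounded. Subtracting
-- its trigonometric leading part restores a factor `1/θ`.
theorem norm_G_sub_le (σ : ℝ) {x t : ℝ} (hx : x ∈ Icc 0 T) (ht : t ∈ Icc 0 T) :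
    ‖linePoint τ σ * (lineDS hT hq τ x σ * lineS hT hq τ t σ) -
      Complex.cos (linePoint τ σ * x) * Complex.sin (linePoint τ σ * t)‖ ≤
      2 * C ^ 2 * ‖(linePoint τ σ)⁻¹‖ := by
  have hb := hC.sol σ t
  have hbs := hC.sol_sub σ t ht
  have e1 : linePoint τ σ * (lineDS hT hq τ x σ * lineS hT hq τ t σ) =
    lineDS hT hq τ x σ * (linePoint τ σ * lineS hT hq τ t σ) := mul_left_comm _ _ _
  rw [e1]
  have hcos := hC.cos σ x hx
  have hd := hC.dsol_sub σ x hx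
  set c := Complex.cos (linePoint τ σ * x)
  set a := lineDS hT hq τ x σ
  generalize linePoint τ σ * lineS hT hq τ t σ = b at *
  set s := Complex.sin (linePoint τ σ * t)
  have e : a * b - c * s = (a - c) * b + c * (b - s) := by ring
  rw [e]
  refine (norm_add_le _ _).trans ?_
  rw [norm_mul, norm_mul]
  have := hC.pos
  calc _ ≤ C * ‖(linePoint τ σ)⁻¹‖ * C + C * (C * ‖(linePoint τ σ)⁻¹‖) := by
        refine add_le_add ?_ ?_
        · exact mul_le_mul hd hb (norm_nonneg _) (by positivity)
        · exact mul_le_mul hcos hbs (norm_nonneg _) hC.pos.le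
    _ = _ := by ring

end LineBounds

omit hC in
theorem integrable_mul_of_le {w k : ℝ → ℂ} {M : ℝ} (hw : MemLp w 2)
    (hk : AEStronglyMeasurable k)
    (hb : ∀ σ, ‖k σ‖ ≤ M * ‖(linePoint τ σ)⁻¹‖) : Integrable fun σ => w σ * k σ := by
  refine Integrable.mono' ((integrable_norm_mul_norm hw (memLp_inv_linePoint hτ)).const_mul M)
    (hw.1.mul hk) (ae_of_all _ fun σ => ?_)
  rw [norm_mul]
  calc _ ≤ ‖w σ‖ * (M * ‖(linePoint τ σ)⁻¹‖) := by gcongr; exact hb σ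
    _ = _ := by ring

omit hC in
theorem norm_integral_mul_le_of_le {w k : ℝ → ℂ} {M : ℝ} (hM : 0 ≤ M) (hw : MemLp w 2)
    (hb : ∀ σ, ‖k σ‖ ≤ M * ‖(linePoint τ σ)⁻¹‖) :
    ‖∫ σ, w σ * k σ‖ ≤ M * l2norm (fun σ => (linePoint τ σ)⁻¹) * l2norm w := by
  have h1 := integral_norm_mul_norm_le hw (memLp_inv_linePoint hτ)
  have h2 : ‖∫ σ, w σ * k σ‖ ≤ ∫ σ, M * (‖w σ‖ * ‖(linePoint τ σ)⁻¹‖) := by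
    refine norm_integral_le_of_norm_le
      ((integrable_norm_mul_norm hw (memLp_inv_linePoint hτ)).const_mul M) (ae_of_all _ fun σ => ?_)
    rw [norm_mul]
    calc _ ≤ ‖w σ‖ * (M * ‖(linePoint τ σ)⁻¹‖) := by gcongr; exact hb σ
      _ = _ := by ring
  rw [integral_const_mul] at h2
  refine h2.trans ?_
  rw [mul_assoc]
  gcongr
  rw [mul_comm]
  exact h1

theorem integrable_kerF {w : ℝ → ℂ} (hw : MemLp w 2) (x t : ℝ) :
    Integrable fun σ => w σ * (linePoint τ σ *
      (lineS hT hq τ x σ * lineS hT hq τ t σ)) := by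
  have h1 : Continuous fun σ => lineS hT hq τ x σ :=
    (continuous_lineS hT hq τ).comp (by fun_prop : Continuous fun σ : ℝ => (x, σ))
  have h2 : Continuous fun σ => lineS hT hq τ t σ :=
    (continuous_lineS hT hq τ).comp (by fun_prop : Continuous fun σ : ℝ => (t, σ))
  exact integrable_mul_of_le hτ hw
    (Continuous.aestronglyMeasurable (by fun_prop)) fun σ => hC.norm_F_le hT hq hτ σ x t

theorem norm_kerF_le {w : ℝ → ℂ} (hw : MemLp w 2) (x t : ℝ) :
    ‖kerF hT hq τ w x t‖ ≤ C ^ 2 * l2norm (fun σ => (linePoint τ σ)⁻¹) * l2norm w :=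
  norm_integral_mul_le_of_le hτ (sq_nonneg C) hw fun σ => hC.norm_F_le hT hq hτ σ x t

theorem kerF_sub {w w' : ℝ → ℂ} (hw : MemLp w 2) (hw' : MemLp w' 2) (x t : ℝ) :
    kerF hT hq τ (w - w') x t = kerF hT hq τ w x t - kerF hT hq τ w' x t := by
  rw [kerF, kerF, kerF, ← integral_sub (integrable_kerF hT hq hτ hC hw x t)
    (integrable_kerF hT hq hτ hC hw' x t)]
  simp only [Pi.sub_apply, sub_mul]

theorem continuous_kerF {w : ℝ → ℂ} (hw : MemLp w 2) :
    Continuous fun p : ℝ × ℝ => kerF hT hq τ w p.1 p.2 := by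
  have hc := continuous_lineS hT hq τ
  refine continuous_of_dominated (bound := fun σ => C ^ 2 * (‖w σ‖ * ‖(linePoint τ σ)⁻¹‖))
    (fun p => (integrable_kerF hT hq hτ hC hw p.1 p.2).1) (fun p => ae_of_all _ fun σ => ?_)
    ((integrable_norm_mul_norm hw (memLp_inv_linePoint hτ)).const_mul _)
    (ae_of_all _ fun σ => ?_)
  · rw [norm_mul]
    calc _ ≤ ‖w σ‖ * (C ^ 2 * ‖(linePoint τ σ)⁻¹‖) := by gcongr; exact hC.norm_F_le hT hq hτ σ _ _
      _ = _ := by ring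
  · have h1 : Continuous fun p : ℝ × ℝ => lineS hT hq τ p.1 σ :=
      hc.comp (by fun_prop : Continuous fun p : ℝ × ℝ => (p.1, σ))
    have h2 : Continuous fun p : ℝ × ℝ => lineS hT hq τ p.2 σ :=
      hc.comp (by fun_prop : Continuous fun p : ℝ × ℝ => (p.2, σ))
    fun_prop

omit hτ in
theorem integrable_kerG {w : ℝ → ℂ} (hw : Integrable w) (x t : ℝ) :
    Integrable fun σ => w σ * (linePoint τ σ *
      (lineDS hT hq τ x σ * lineS hT hq τ t σ)) := by
  have h1 : Continuous fun σ => lineDS hT hq τ x σ :=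
    (continuous_lineDS hT hq τ).comp (by fun_prop : Continuous fun σ : ℝ => (x, σ))
  have h2 : Continuous fun σ => lineS hT hq τ t σ :=
    (continuous_lineS hT hq τ).comp (by fun_prop : Continuous fun σ : ℝ => (t, σ))
  refine Integrable.mul_bdd (c := C ^ 2) hw (Continuous.aestronglyMeasurable (by fun_prop))
    (ae_of_all _ fun σ => hC.norm_G_le hT hq σ x t)

omit hτ in
theorem kerG_sub {w w' : ℝ → ℂ} (hw : Integrable w) (hw' : Integrable w') (x t : ℝ) :
    kerG hT hq τ (w - w') x t = kerG hT hq τ w x t - kerG hT hq τ w' x t := by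
  rw [kerG, kerG, kerG, ← integral_sub (integrable_kerG hT hq hC hw x t)
    (integrable_kerG hT hq hC hw' x t)]
  simp only [Pi.sub_apply, sub_mul]

omit hτ in
theorem continuous_kerG {w : ℝ → ℂ} (hw : Integrable w) :
    Continuous fun p : ℝ × ℝ => kerG hT hq τ w p.1 p.2 := by
  have hc := continuous_lineS hT hq τ
  have hc' := continuous_lineDS hT hq τ
  refine continuous_of_dominated (bound := fun σ => ‖w σ‖ * C ^ 2)
    (fun p => (integrable_kerG hT hq hC hw p.1 p.2).1) (fun p => ae_of_all _ fun σ => ?_)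
    (hw.norm.mul_const _) (ae_of_all _ fun σ => ?_)
  · rw [norm_mul]
    gcongr
    exact hC.norm_G_le hT hq σ _ _
  · have h1 : Continuous fun p : ℝ × ℝ => lineDS hT hq τ p.1 σ :=
      hc'.comp (by fun_prop : Continuous fun p : ℝ × ℝ => (p.1, σ))
    have h2 : Continuous fun p : ℝ × ℝ => lineS hT hq τ p.2 σ :=
      hc.comp (by fun_prop : Continuous fun p : ℝ × ℝ => (p.2, σ))
    fun_prop

omit hτ in
theorem continuous_kerG_diag {w : ℝ → ℂ} (hw : Integrable w) :
    Continuous fun x => kerG hT hq τ w x x :=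
  (continuous_kerG hT hq hC hw).comp (by fun_prop : Continuous fun x : ℝ => (x, x))

theorem norm_kerG_sub_main_le {w : ℝ → ℂ} (h1 : Integrable w) (h2 : MemLp w 2) {x t : ℝ}
    (hx : x ∈ Icc 0 T) (ht : t ∈ Icc 0 T) :
    ‖kerG hT hq τ w x t -
      ∫ σ, w σ * (Complex.cos (linePoint τ σ * x) * Complex.sin (linePoint τ σ * t))‖ ≤
      2 * C ^ 2 * l2norm (fun σ => (linePoint τ σ)⁻¹) * l2norm w := by
  have hi : Integrable fun σ => w σ *
      (Complex.cos (linePoint τ σ * x) * Complex.sin (linePoint τ σ * t)) := by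
    refine h1.mul_bdd (c := C * C) (Continuous.aestronglyMeasurable (by fun_prop))
      (ae_of_all _ fun σ => ?_)
    rw [norm_mul]
    have := hC.pos
    gcongr
    · exact hC.cos σ x hx
    · exact hC.sin σ t ht
  rw [kerG, ← integral_sub (integrable_kerG hT hq hC h1 x t) hi]
  simp only [← mul_sub]
  exact norm_integral_mul_le_of_le hτ (by positivity) h2
    fun σ => hC.norm_G_sub_le hT hq σ hx ht

omit hτ hC in
theorem exp_line (τ σ y : ℝ) : Complex.exp (linePoint τ σ * y * Complex.I) =
    Real.exp (-(τ * y)) * Complex.exp (Complex.I * y * σ) := by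
  rw [Complex.ofReal_exp, ← Complex.exp_add, linePoint]
  congr 1
  push_cast
  linear_combination (τ : ℂ) * y * Complex.I_sq

omit hτ hC in
-- On the line Im θ = τ the sine splits into `exp(±iσt)` with real weights `exp(∓τt)`, which
-- exhibits the integral as values of a Fourier transform at `t` and `-t`.
theorem integral_mul_sin {u : ℝ → ℂ} (hu : Integrable u) (t : ℝ) :
    ∫ σ, u σ * Complex.sin (linePoint τ σ * t) =
      Complex.I / 2 * (Real.exp (τ * t) * (∫ σ, u σ * Complex.exp (Complex.I * (-t : ℝ) * σ)) -
        Real.exp (-(τ * t)) * ∫ σ, u σ * Complex.exp (Complex.I * t * σ)) := by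
  have hi : ∀ y : ℝ, Integrable fun σ : ℝ => u σ * Complex.exp (Complex.I * y * σ) := by
    intro y
    refine hu.mul_bdd (c := 1) (Continuous.aestronglyMeasurable (by fun_prop)) (ae_of_all _ fun σ => ?_)
    rw [Complex.norm_exp]; simp
  rw [← integral_const_mul, ← integral_const_mul,
    ← integral_sub ((hi _).const_mul _) ((hi _).const_mul _), ← integral_const_mul]
  congr 1; ext σ
  have e1 := exp_line τ σ t
  have e2 := exp_line τ σ (-t)
  rw [mul_neg, neg_neg] at e2
  rw [Complex.sin, e1, ← neg_mul, show -linePoint τ σ * (t : ℂ) * Complex.I =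
    linePoint τ σ * ((-t : ℝ) : ℂ) * Complex.I by push_cast; ring, e2]
  push_cast
  ring

omit hC in
theorem norm_integral_mul_sin_le {u : ℝ → ℂ} (hu : Integrable u) {t : ℝ} (ht : t ∈ Icc 0 T) :
    ‖∫ σ, u σ * Complex.sin (linePoint τ σ * t)‖ ≤ Real.exp (τ * T) *
      (‖∫ σ, u σ * Complex.exp (Complex.I * (-t : ℝ) * σ)‖ +
        ‖∫ σ, u σ * Complex.exp (Complex.I * t * σ)‖) := by
  rw [integral_mul_sin hu]
  have h1 : Real.exp (τ * t) ≤ Real.exp (τ * T) := by gcongr; exact ht.2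
  have h2 : Real.exp (-(τ * t)) ≤ Real.exp (τ * T) := by
    gcongr
    have := mul_nonneg hτ.le ht.1
    have := mul_nonneg hτ.le (ht.1.trans ht.2)
    linarith
  rw [norm_mul, norm_div, Complex.norm_I, Complex.norm_two, mul_add]
  set A := ∫ σ, u σ * Complex.exp (Complex.I * (-t : ℝ) * σ)
  set B := ∫ σ, u σ * Complex.exp (Complex.I * t * σ)
  have h3 : ‖(Real.exp (τ * t) : ℂ) * A - (Real.exp (-(τ * t)) : ℂ) * B‖ ≤
      Real.exp (τ * T) * ‖A‖ + Real.exp (τ * T) * ‖B‖ := by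
    refine (norm_sub_le _ _).trans ?_
    rw [norm_mul, norm_mul, Complex.norm_real, Complex.norm_real, Real.norm_of_nonneg (by positivity),
      Real.norm_of_nonneg (by positivity)]
    gcongr
  have h4 : 0 ≤ ‖(Real.exp (τ * t) : ℂ) * A - (Real.exp (-(τ * t)) : ℂ) * B‖ := norm_nonneg _
  linarith

/-- For fixed `x` the cosine is absorbed into the weight, and the leading part becomes a Fourier
transform in `t`, controlled by Plancherel. Integrability of `w` only makes the integral meaningful;
the constant sees the L₂ norm alone. -/
theorem integral_norm_kerG_le : ∃ M : ℝ, 0 ≤ M ∧ ∀ w : ℝ → ℂ, Integrable w → MemLp w 2 →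
    ∀ x ∈ Icc 0 T, ∫ t in (0 : ℝ)..x, ‖kerG hT hq τ w x t‖ ≤ M * l2norm w := by
  set R := 2 * C ^ 2 * l2norm (fun σ => (linePoint τ σ)⁻¹) with hR
  have hCp := hC.pos
  have hR0 : 0 ≤ R := by have := l2norm_nonneg (fun σ => (linePoint τ σ)⁻¹); positivity
  set E := Real.exp (τ * T)
  -- The term `T * R` bounds the remainder over an interval of length at most `T`. The other is
  -- Cauchy–Schwarz on `(-T, T)`, then Plancherel, then the bound `C` for the cosine.
  refine ⟨T * R + E * (√(2 * T) * (√(2 * Real.pi) * C)), by positivity, fun w h1 h2 x hx => ?_⟩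
  set u : ℝ → ℂ := fun σ => w σ * Complex.cos (linePoint τ σ * x) with hu
  have hcm : AEStronglyMeasurable fun σ => Complex.cos (linePoint τ σ * x) :=
    Continuous.aestronglyMeasurable (by fun_prop)
  have u1 : Integrable u := h1.mul_bdd (c := C) hcm (ae_of_all _ fun σ => hC.cos σ x hx)
  have ule : ∀ᵐ σ, ‖u σ‖ ≤ C * ‖w σ‖ := ae_of_all _ fun σ => by
    rw [hu, norm_mul, mul_comm]; gcongr; exact hC.cos σ x hx
  have u2 : MemLp u 2 := h2.of_le_mul (h1.1.mul hcm) ule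
  have u3 : l2norm u ≤ C * l2norm w := by
    have := eLpNorm_le_mul_eLpNorm_of_ae_le_mul ule 2
    have := ENNReal.toReal_mono (ENNReal.mul_ne_top ENNReal.ofReal_ne_top h2.2.ne) this
    rwa [ENNReal.toReal_mul, ENNReal.toReal_ofReal hCp.le] at this
  set U : ℝ → ℂ := fun y => ∫ σ, u σ * Complex.exp (Complex.I * y * σ) with hU
  have cU : Continuous U := continuous_exp_transform u1
  have hb : ∀ t ∈ Icc 0 x, ‖kerG hT hq τ w x t‖ ≤ R * l2norm w + E * (‖U (-t)‖ + ‖U t‖) := by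
    intro t ht
    have ht' : t ∈ Icc 0 T := ⟨ht.1, ht.2.trans hx.2⟩
    have a1 := norm_kerG_sub_main_le hT hq hτ hC h1 h2 hx ht'
    have a2 := norm_integral_mul_sin_le hτ u1 ht'
    simp only [hu, mul_assoc] at a2 a1
    have a3 := norm_le_norm_add_norm_sub' (kerG hT hq τ w x t)
      (∫ σ, w σ * (Complex.cos (linePoint τ σ * x) * Complex.sin (linePoint τ σ * t)))
    simp only [hU, hu, mul_assoc, hR]
    linarith
  have cG : Continuous fun t => kerG hT hq τ w x t :=
    (continuous_kerG hT hq hC h1).comp (by fun_prop : Continuous fun t : ℝ => (x, t))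
  have i1 : IntervalIntegrable (fun t => ‖U (-t)‖ + ‖U t‖) volume 0 x :=
    Continuous.intervalIntegrable (by fun_prop) _ _
  have s1 := intervalIntegral.integral_mono_on hx.1 (cG.norm.intervalIntegrable (μ := volume) 0 x)
    ((intervalIntegrable_const (c := R * l2norm w)).add (i1.const_mul E)) hb
  rw [intervalIntegral.integral_add intervalIntegrable_const (i1.const_mul E),
    intervalIntegral.integral_const, intervalIntegral.integral_const_mul, sub_zero, smul_eq_mul,
    intervalIntegral.integral_add (Continuous.intervalIntegrable (by fun_prop) _ _)
      (Continuous.intervalIntegrable (by fun_prop) _ _),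
    intervalIntegral.integral_comp_neg (fun t => ‖U t‖), neg_zero,
    intervalIntegral.integral_add_adjacent_intervals (Continuous.intervalIntegrable (by fun_prop) _ _)
      (Continuous.intervalIntegrable (by fun_prop) _ _)] at s1
  have s2 : ∫ t in (-x)..x, ‖U t‖ ≤ √(2 * T) * (√(2 * Real.pi) * C) * l2norm w := by
    have b1 : ∫ t in (-x)..x, ‖U t‖ ≤ ∫ t in (-T)..T, ‖U t‖ :=
      intervalIntegral.integral_mono_interval (by linarith [hx.2]) (by linarith [hx.1]) hx.2
        (ae_of_all _ fun _ => norm_nonneg _) (Continuous.intervalIntegrable (by fun_prop) _ _)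
    have mU : MemLp U 2 := memLp_exp_transform u1 u2
    have b2 := integral_norm_le_of_memLp (mU.mono_measure
      (Measure.restrict_le_self (s := Ioc (-T) T)))
    rw [measureReal_restrict_apply_univ, Real.volume_real_Ioc_of_le (by linarith)] at b2
    have b3 : (eLpNorm U 2 (volume.restrict (Ioc (-T) T))).toReal ≤ l2norm U :=
      ENNReal.toReal_mono mU.2.ne (eLpNorm_mono_measure _ Measure.restrict_le_self)
    have b4 := norm_exp_transform_two u u1 u2
    have b5 : ∫ t in (-T)..T, ‖U t‖ = ∫ t in Ioc (-T) T, ‖U t‖ :=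
      intervalIntegral.integral_of_le (by linarith)
    rw [show T - -T = 2 * T by ring] at b2
    calc _ ≤ _ := b1
      _ ≤ _ := b5.le.trans b2
      _ ≤ √(2 * T) * (√(2 * Real.pi) * (C * l2norm w)) := by
        gcongr
        exact b3.trans (b4.trans (by gcongr))
      _ = _ := by ring
  have s3 : x * (R * l2norm w) ≤ T * (R * l2norm w) := by
    have := l2norm_nonneg w
    gcongr
    exact hx.2
  have s4 : E * ∫ t in (-x)..x, ‖U t‖ ≤ E * (√(2 * T) * (√(2 * Real.pi) * C) * l2norm w) := by
    gcongr
  linarith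

theorem eLpNorm_kerG_diag_le : ∃ M : ℝ, 0 ≤ M ∧ ∀ w : ℝ → ℂ, Integrable w → MemLp w 2 →
    eLpNorm (fun x => kerG hT hq τ w x x) 2 (volume.restrict (Ioc 0 T)) ≤
      ENNReal.ofReal (M * l2norm w) := by
  set R := 2 * C ^ 2 * l2norm (fun σ => (linePoint τ σ)⁻¹) with hR
  have hCp := hC.pos
  have hR0 : 0 ≤ R := by have := l2norm_nonneg (fun σ => (linePoint τ σ)⁻¹); positivity
  set E := Real.exp (τ * (2 * T))
  -- The remainder is constant in `x`, which gives `√T * R`. The two Plancherel constants belong to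
  -- the transform at `2x` and `-2x`; the gain from the change of scale is dropped.
  refine ⟨√T * R + E * (√(2 * Real.pi) + √(2 * Real.pi)), by positivity, fun w h1 h2 => ?_⟩
  set V : ℝ → ℂ := fun y => ∫ σ, w σ * Complex.exp (Complex.I * y * σ) with hV
  have cV : Continuous V := continuous_exp_transform h1
  have mV : MemLp V 2 := memLp_exp_transform h1 h2
  have hw0 := l2norm_nonneg w
  have hb : ∀ x ∈ Ioc 0 T, ‖kerG hT hq τ w x x‖ ≤
      R * l2norm w + E * (‖V (-2 * x)‖ + ‖V (2 * x)‖) := by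
    intro x hx
    have hx' : x ∈ Icc 0 T := Ioc_subset_Icc_self hx
    have a1 := norm_kerG_sub_main_le hT hq hτ hC h1 h2 hx' hx'
    have hx2 : 2 * x ∈ Icc 0 (2 * T) := ⟨by linarith [hx.1], by linarith [hx.2]⟩
    have a2 := norm_integral_mul_sin_le hτ h1 hx2
    -- On the diagonal the double-angle formula leaves a single sine of `2θx` with a weight free of
    -- `x`, so Plancherel applies in the variable `x`.
    have e : ∫ σ, w σ * (Complex.cos (linePoint τ σ * x) * Complex.sin (linePoint τ σ * x)) =
        (∫ σ, w σ * Complex.sin (linePoint τ σ * (2 * x : ℝ))) * (1 / 2) := by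
      rw [← integral_mul_const]
      congr 1; ext σ
      have : linePoint τ σ * ((2 * x : ℝ) : ℂ) = 2 * (linePoint τ σ * x) := by push_cast; ring
      rw [this, Complex.sin_two_mul]
      ring
    rw [e] at a1
    have a3 := norm_le_norm_add_norm_sub' (kerG hT hq τ w x x)
      ((∫ σ, w σ * Complex.sin (linePoint τ σ * (2 * x : ℝ))) * (1 / 2))
    rw [norm_mul] at a3
    have a4 : ‖(1 / 2 : ℂ)‖ = 1 / 2 := by norm_num
    rw [a4] at a3
    simp only [hV, neg_mul]
    have a5 := norm_nonneg (∫ σ, w σ * Complex.sin (linePoint τ σ * (2 * x : ℝ)))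
    linarith
  have cG : Continuous fun x => kerG hT hq τ w x x := continuous_kerG_diag hT hq hC h1
  have n1 : eLpNorm (fun x : ℝ => V (-2 * x)) 2 volume ≤ ENNReal.ofReal (√(2 * Real.pi) * l2norm w) ∧
      eLpNorm (fun x : ℝ => V (2 * x)) 2 volume ≤ ENNReal.ofReal (√(2 * Real.pi) * l2norm w) := by
    have b4 : eLpNorm V 2 volume ≤ ENNReal.ofReal (√(2 * Real.pi) * l2norm w) := by
      rw [← ENNReal.ofReal_toReal mV.2.ne]
      exact ENNReal.ofReal_le_ofReal (norm_exp_transform_two w h1 h2)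
    have b5 : ENNReal.ofReal |(2 : ℝ)⁻¹| ^ (1 / 2 : ℝ) ≤ 1 :=
      ENNReal.rpow_le_one (by rw [ENNReal.ofReal_le_one]; norm_num [abs_le]) (by norm_num)
    constructor
    · rw [eLpNorm_comp_mul_left cV.aestronglyMeasurable (by norm_num), inv_neg, abs_neg]
      exact (mul_le_of_le_one_left' b5).trans b4
    · rw [eLpNorm_comp_mul_left cV.aestronglyMeasurable (by norm_num)]
      exact (mul_le_of_le_one_left' b5).trans b4
  have hfin : (volume.restrict (Ioc 0 T)) univ = ENNReal.ofReal T := by simp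
  calc _ ≤ eLpNorm ((fun _ : ℝ => R * l2norm w) +
        ((fun x : ℝ => E * ‖V (-2 * x)‖) + fun x : ℝ => E * ‖V (2 * x)‖)) 2
          (volume.restrict (Ioc 0 T)) := by
        refine eLpNorm_mono_ae_real ?_
        filter_upwards [ae_restrict_mem measurableSet_Ioc] with x hx
        simp only [Pi.add_apply]
        linarith [hb x hx]
    _ ≤ eLpNorm (fun _ : ℝ => R * l2norm w) 2 (volume.restrict (Ioc 0 T)) +
        (eLpNorm (fun x : ℝ => E * ‖V (-2 * x)‖) 2 (volume.restrict (Ioc 0 T)) +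
          eLpNorm (fun x : ℝ => E * ‖V (2 * x)‖) 2 (volume.restrict (Ioc 0 T))) := by
        have c1 : Continuous fun x : ℝ => E * ‖V (-2 * x)‖ := by fun_prop
        have c2 : Continuous fun x : ℝ => E * ‖V (2 * x)‖ := by fun_prop
        refine (eLpNorm_add_le (by fun_prop) (c1.add c2).aestronglyMeasurable (by norm_num)).trans ?_
        gcongr
        exact eLpNorm_add_le c1.aestronglyMeasurable c2.aestronglyMeasurable (by norm_num)
    _ ≤ ENNReal.ofReal (√T * R * l2norm w) +
        (ENNReal.ofReal (E * (√(2 * Real.pi) * l2norm w)) +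
          ENNReal.ofReal (E * (√(2 * Real.pi) * l2norm w))) := by
        have hE0 : 0 ≤ E := (Real.exp_pos _).le
        have key : ∀ f : ℝ → ℂ, eLpNorm f 2 volume ≤ ENNReal.ofReal (√(2 * Real.pi) * l2norm w) →
            eLpNorm (fun x : ℝ => E * ‖f x‖) 2 (volume.restrict (Ioc 0 T)) ≤
            ENNReal.ofReal (E * (√(2 * Real.pi) * l2norm w)) := by
          intro f hf
          rw [ENNReal.ofReal_mul hE0]
          calc _ ≤ ENNReal.ofReal E * eLpNorm f 2 (volume.restrict (Ioc 0 T)) := by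
                refine eLpNorm_le_mul_eLpNorm_of_ae_le_mul (ae_of_all _ fun x => ?_) 2
                rw [norm_mul, norm_norm, Real.norm_of_nonneg hE0]
            _ ≤ _ := by
                gcongr
                exact (eLpNorm_mono_measure _ Measure.restrict_le_self).trans hf
        refine add_le_add ?_ (add_le_add (key _ n1.1) (key _ n1.2))
        rw [eLpNorm_const' _ (by norm_num) (by norm_num), hfin, Real.enorm_of_nonneg (by positivity)]
        rcases hT.eq_or_lt with h0 | h0
        · simp [← h0]
        · rw [ENNReal.ofReal_rpow_of_pos h0, ← ENNReal.ofReal_mul (by positivity)]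
          apply ENNReal.ofReal_le_ofReal
          simp only [ENNReal.toReal_ofNat, ← Real.sqrt_eq_rpow]
          exact le_of_eq (by ring)
    _ = _ := by
        rw [← ENNReal.ofReal_add (by positivity) (by positivity),
          ← ENNReal.ofReal_add (by positivity) (by positivity)]
        congr 1
        ring

end Kernels

/-! ### Compactly supported weights: solution by the Banach algebra method -/

section Truncated

variable {T : ℝ} (hT : 0 ≤ T) {q : ℝ → ℂ} (hq : IntervalIntegrable q volume 0 T)

theorem isPrim_sSol (lam : ℂ) :
    IsPrim T (fun x => sSol hT hq x lam) (fun x => dsSol hT hq x lam) ∧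
    IsPrim T (fun x => dsSol hT hq x lam) (fun x => (q x - lam) * sSol hT hq x lam) :=
  by simpa only [sSol, dsSol] using (isSLSolution_iff hT).1 (isSLSolution_solFun hT hq 0 1 lam)

theorem sSol_zero (lam : ℂ) : sSol hT hq 0 lam = 0 := by
  rw [sSol]; exact ext_solFun_zero hT hq 0 1 lam

theorem dsSol_zero (lam : ℂ) : dsSol hT hq 0 lam = 1 := by
  rw [dsSol]; exact ext_dsolFun_zero hT hq 0 1 lam

/-- The closed disc of radius `R` around the origin. -/
abbrev Disc (R : ℝ) := Metric.closedBall (0 : ℂ) R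

instance (R : ℝ) : CompactSpace (Disc R) := isCompact_iff_compactSpace.1 (isCompact_closedBall 0 R)

/-- The solution with data `0`, `1` as a function with values in the algebra of continuous functions
of the spectral parameter. -/
noncomputable def discS (R x : ℝ) : C(Disc R, ℂ) :=
  ⟨fun l => sSol hT hq x l, Continuous.sSol hT hq continuous_const continuous_subtype_val⟩

/-- The derivative of `discS`. -/
noncomputable def discDS (R x : ℝ) : C(Disc R, ℂ) :=
  ⟨fun l => dsSol hT hq x l, Continuous.dsSol hT hq continuous_const continuous_subtype_val⟩

theorem continuous_discS (R : ℝ) : Continuous (discS hT hq R) := by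
  refine ContinuousMap.continuous_of_continuous_uncurry _ ?_
  exact Continuous.sSol hT hq continuous_fst (continuous_subtype_val.comp continuous_snd)

theorem continuous_discDS (R : ℝ) : Continuous (discDS hT hq R) := by
  refine ContinuousMap.continuous_of_continuous_uncurry _ ?_
  exact Continuous.dsSol hT hq continuous_fst (continuous_subtype_val.comp continuous_snd)

/-- Evaluation at a point of the disc as a real-linear map. -/
noncomputable def discEval {R : ℝ} (l : Disc R) : C(Disc R, ℂ) →L[ℝ] ℂ :=
  (ContinuousMap.evalCLM ℂ l).restrictScalars ℝ

theorem discEval_apply {R : ℝ} (l : Disc R) (φ : C(Disc R, ℂ)) : discEval l φ = φ l := rfl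

/-- Point evaluations separate the elements of the algebra and commute with the integral, so the
scalar equations for each `lam` give the equation in the algebra. -/
theorem isPrim_of_eval {R : ℝ} {f f' : ℝ → C(Disc R, ℂ)} (hi : IntervalIntegrable f' volume 0 T)
    (h : ∀ l : Disc R, IsPrim T (fun x => f x l) (fun x => f' x l)) : IsPrim T f f' := by
  refine ⟨hi, fun x hx => ?_⟩
  ext l
  have := (discEval l).intervalIntegral_comp_comm (subinterval hi hx)
  simp only [discEval_apply] at this
  rw [ContinuousMap.add_apply, ← this]
  exact (h l).eqn x hx

/-- The function `l ↦ l` on the disc. -/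
noncomputable def discId (R : ℝ) : C(Disc R, ℂ) := ⟨fun l => l, continuous_subtype_val⟩

theorem isPrim_discS (R : ℝ) : IsPrim T (discS hT hq R) (discDS hT hq R) :=
  isPrim_of_eval ((continuous_discDS hT hq R).intervalIntegrable _ _)
    fun l => (isPrim_sSol hT hq l).1

theorem isPrim_discDS (R : ℝ) : IsPrim T (discDS hT hq R)
    (fun t => q t • discS hT hq R t - discId R * discS hT hq R t) := by
  have hc := continuous_discS hT hq R
  refine isPrim_of_eval ((hq.smul_continuousOn hc.continuousOn).sub
    ((continuous_const.mul hc).intervalIntegrable _ _)) fun l => ?_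
  have := (isPrim_sSol hT hq l).2
  simp only [sub_mul] at this
  exact this

variable (τ : ℝ) {N R : ℝ} (hR : N ^ 2 + τ ^ 2 ≤ R)

/-- The point `θ²` of the parabola, with the parameter clamped to `[-N, N]`. -/
noncomputable def discPoint (σ : ℝ) : Disc R :=
  ⟨linePoint τ (max (-|N|) (min |N| σ)) ^ 2, by
    rw [Metric.mem_closedBall, dist_zero_right, norm_pow, norm_linePoint_sq]
    refine le_trans (add_le_add ?_ le_rfl) hR
    rw [sq_le_sq, abs_le]
    have := abs_nonneg N
    exact ⟨le_max_left _ _, max_le (by linarith) (min_le_left _ _)⟩⟩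

theorem continuous_discPoint : Continuous (discPoint τ hR) :=
  Continuous.subtype_mk (((continuous_linePoint τ).comp (by fun_prop)).pow 2) _

theorem discPoint_coe {σ : ℝ} (hσ : |σ| ≤ N) : (discPoint τ hR σ : ℂ) = linePoint τ σ ^ 2 := by
  rw [discPoint]
  have := abs_le.1 (hσ.trans (le_abs_self N))
  simp only [min_eq_right this.2, max_eq_right this.1]

/-- The functional `φ ↦ ∫ w(σ) θ φ(θ²) dσ`. -/
noncomputable def discNu {w : ℝ → ℂ} (hw : Integrable fun σ => w σ * linePoint τ σ) :
    C(Disc R, ℂ) →L[ℂ] ℂ :=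
  have hi : ∀ φ : C(Disc R, ℂ), Integrable fun σ => w σ * linePoint τ σ * φ (discPoint τ hR σ) :=
    fun φ => hw.mul_bdd (c := ‖φ‖)
      (φ.continuous.comp (continuous_discPoint τ hR)).aestronglyMeasurable
      (ae_of_all _ fun σ => φ.norm_coe_le_norm _)
  LinearMap.mkContinuous
    { toFun := fun φ => ∫ σ, w σ * linePoint τ σ * φ (discPoint τ hR σ)
      map_add' := fun φ ψ => by
        simp only [ContinuousMap.add_apply, mul_add]
        exact integral_add (hi φ) (hi ψ)
      map_smul' := fun c φ => by
        simp only [ContinuousMap.smul_apply, smul_eq_mul, RingHom.id_apply, mul_left_comm _ c]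
        exact integral_const_mul _ _ }
    (∫ σ, ‖w σ * linePoint τ σ‖) fun φ => by
      rw [← integral_mul_const]
      refine norm_integral_le_of_norm_le (hw.norm.mul_const _) (ae_of_all _ fun σ => ?_)
      rw [norm_mul _ (φ _)]
      gcongr
      exact φ.norm_coe_le_norm _

theorem discNu_apply {w : ℝ → ℂ} (hw : Integrable fun σ => w σ * linePoint τ σ)
    (φ : C(Disc R, ℂ)) :
    discNu τ hR hw φ = ∫ σ, w σ * linePoint τ σ * φ (discPoint τ hR σ) := rfl

theorem discNu_F {w : ℝ → ℂ} (hw : Integrable fun σ => w σ * linePoint τ σ)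
    (hN : ∀ σ, N < |σ| → w σ = 0) (x t : ℝ) :
    discNu τ hR hw (discS hT hq R x * discS hT hq R t) = kerF hT hq τ w x t := by
  rw [discNu_apply, kerF]
  congr 1; ext σ
  rcases lt_or_ge N |σ| with h | h
  · simp [hN σ h]
  · rw [mul_assoc, lineS, lineS, ← discPoint_coe τ hR h]; rfl

theorem discNu_G {w : ℝ → ℂ} (hw : Integrable fun σ => w σ * linePoint τ σ)
    (hN : ∀ σ, N < |σ| → w σ = 0) (x t : ℝ) :
    discNu τ hR hw (discDS hT hq R x * discS hT hq R t) = kerG hT hq τ w x t := by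
  rw [discNu_apply, kerG]
  congr 1; ext σ
  rcases lt_or_ge N |σ| with h | h
  · simp [hN σ h]
  · rw [mul_assoc, lineS, lineDS, ← discPoint_coe τ hR h]; rfl

/-- The disc contains all points `θ²` over the support of `w`, so `ν` reproduces `kerF` and `kerG`.
Evaluating the algebra-valued solution at `lam` yields the scalar equation for every `lam` in the
disc, not only on the parabola. -/
theorem exists_glSol_of_support {w : ℝ → ℂ} (hT0 : 0 < T)
    (hw : Integrable fun σ => w σ * linePoint τ σ)
    (hN : ∀ σ, N < |σ| → w σ = 0) (hR : N ^ 2 + τ ^ 2 ≤ R)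
    (hF : Continuous fun p : ℝ × ℝ => kerF hT hq τ w p.1 p.2)
    (hG : Continuous fun p : ℝ × ℝ => kerG hT hq τ w p.1 p.2)
    (hs : ∀ x ∈ Icc 0 T, ∀ t ∈ Icc 0 T, T * ‖kerF hT hq τ w x t‖ ≤ 1 / 2) :
    ∃ K L dκ, GLSol T (kerF hT hq τ w) (kerG hT hq τ w) K L dκ ∧
      IsPrim T (fun x => K x x) dκ ∧ ContinuousOn dκ (Icc 0 T) ∧
      ∀ lam : ℂ, ‖lam‖ ≤ R → ∃ y y1 : ℝ → ℂ,
        (∀ x ∈ Icc 0 T, y x = sSol hT hq x lam + ∫ t in (0 : ℝ)..x, K x t * sSol hT hq t lam) ∧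
        IsPrim T y y1 ∧ IsPrim T y1 (fun x => (q x + 2 * dκ x - lam) * y x) ∧ y1 0 = 1 := by
  have eF := discNu_F hT hq τ hR hw hN
  have eG := discNu_G hT hq τ hR hw hN
  let 𝒟 : GLData C(Disc R, ℂ) :=
    { T := T, T_pos := hT0, q := q, z := discId R, ν := discNu τ hR hw,
      s := discS hT hq R, s1 := discDS hT hq R, cont_s := continuous_discS hT hq R,
      cont_s1 := continuous_discDS hT hq R, prim_s := isPrim_discS hT hq R,
      prim_s1 := isPrim_discDS hT hq R
      s_zero := by ext l; exact sSol_zero hT hq l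
      s1_zero := by ext l; exact dsSol_zero hT hq l
      small := fun x hx t ht => by rw [eF]; exact hs x hx t ht }
  have cs : Continuous 𝒟.s := 𝒟.cont_s
  refine ⟨𝒟.K, 𝒟.L, 𝒟.dκ, ?_, 𝒟.prim_K_diag, 𝒟.continuousOn_dκ, fun lam hl => ?_⟩
  · refine ⟨hF, fun x hx => hG.comp (by fun_prop : Continuous fun t : ℝ => (x, t)), fun x hx => ?_,
      fun x hx => ?_, fun x hx t ht => ?_, fun x hx t ht => ?_, fun x hx => ?_⟩
    · exact (𝒟.ν.continuous.comp (continuous_const.mul cs)).neg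
    · exact (𝒟.ν.continuous.comp (continuous_const.mul cs)).neg
    · have := 𝒟.K_eq hx t
      simp only [← eF]; exact this
    · have := 𝒟.L_eq hx t
      simp only [← eF, ← eG]; exact this
    · have := 𝒟.dκ_eq hx
      simp only [← eF, ← eG]; exact this
  · have hl' : lam ∈ Metric.closedBall (0 : ℂ) R := by rwa [Metric.mem_closedBall, dist_zero_right]
    have p1 := 𝒟.prim_Y.clm (discEval ⟨lam, hl'⟩)
    have p2 := 𝒟.prim_Y1.clm (discEval ⟨lam, hl'⟩)
    refine ⟨fun x => 𝒟.Y x ⟨lam, hl'⟩, fun x => 𝒟.Y1 x ⟨lam, hl'⟩, fun x hx => ?_, p1, ?_, ?_⟩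
    · have e := congrArg (discEval ⟨lam, hl'⟩) (𝒟.Y_eq hx)
      have hc : Continuous fun t => 𝒟.K x t • 𝒟.s t :=
        ((𝒟.ν.continuous.comp (continuous_const.mul cs)).neg).smul cs
      rw [map_add, ← (discEval ⟨lam, hl'⟩).intervalIntegral_comp_comm
        (hc.intervalIntegrable _ _)] at e
      exact e
    · have e : ∀ x, discEval ⟨lam, hl'⟩ ((𝒟.q x + 2 * 𝒟.dκ x) • 𝒟.Y x - 𝒟.z * 𝒟.Y x) =
          (q x + 2 * 𝒟.dκ x - lam) * 𝒟.Y x ⟨lam, hl'⟩ := fun x => by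
        rw [sub_mul]; rfl
      simp only [e] at p2
      exact p2
    · change 𝒟.Y1 0 _ = 1
      rw [𝒟.Y1_zero]; rfl

end Truncated

/-! ### Passage to the limit in the Gelfand–Levitan problem -/

theorem exists_memLp_limit {α : Type*} [MeasurableSpace α] {μ : Measure α} {f : ℕ → α → ℂ}
    (hf : ∀ n, MemLp (f n) 2 μ) {b : ℕ → ℝ} (hb : Tendsto b atTop (𝓝 0)) (hb0 : ∀ n, 0 ≤ b n)
    (h : ∀ n k, eLpNorm (f n - f k) 2 μ ≤ ENNReal.ofReal (b n + b k)) :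
    ∃ g, MemLp g 2 μ ∧ ∀ n, eLpNorm (f n - g) 2 μ ≤ ENNReal.ofReal (b n) := by
  have hd : ∀ n k, dist ((hf n).toLp (f n)) ((hf k).toLp (f k)) ≤ b n + b k := by
    intro n k
    rw [dist_edist, Lp.edist_toLp_toLp]
    exact ENNReal.toReal_le_of_le_ofReal (add_nonneg (hb0 n) (hb0 k)) (h n k)
  have hc : CauchySeq fun n => (hf n).toLp (f n) := by
    refine Metric.cauchySeq_iff.2 fun ε hε => ?_
    obtain ⟨N, hN⟩ := eventually_atTop.1 (hb.eventually (gt_mem_nhds (half_pos hε)))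
    exact ⟨N, fun n hn k hk => (hd n k).trans_lt (by linarith [hN n hn, hN k hk])⟩
  obtain ⟨g, hg⟩ := cauchySeq_tendsto_of_complete hc
  refine ⟨g, Lp.memLp g, fun n => ?_⟩
  have h1 : dist ((hf n).toLp (f n)) g ≤ b n := by
    have t1 : Tendsto (fun k => dist ((hf n).toLp (f n)) ((hf k).toLp (f k))) atTop
      (𝓝 (dist ((hf n).toLp (f n)) g)) := tendsto_const_nhds.dist hg
    have t2 : Tendsto (fun k => b n + b k) atTop (𝓝 (b n + 0)) := hb.const_add _
    rw [add_zero] at t2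
    exact le_of_tendsto_of_tendsto' t1 t2 (hd n)
  have h2 : edist ((hf n).toLp (f n)) ((Lp.memLp g).toLp g) = eLpNorm (f n - (g : α → ℂ)) 2 μ :=
    Lp.edist_toLp_toLp _ _ _ _
  rw [Lp.toLp_coeFn, edist_dist] at h2
  rw [← h2]
  exact ENNReal.ofReal_le_ofReal h1

/-- Stability of `∫₀ˣ f φ` under perturbations of `f` in the mean and of `φ` uniformly. -/
theorem norm_integral_mul_sub_le {x a c A D : ℝ} (hx : 0 ≤ x) {f f' φ φ' : ℝ → ℂ}
    (hf : IntervalIntegrable f volume 0 x) (hf' : IntervalIntegrable f' volume 0 x)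
    (hφ : ContinuousOn φ (Icc 0 x)) (hφ' : ContinuousOn φ' (Icc 0 x))
    (ha : ∫ t in (0 : ℝ)..x, ‖f t - f' t‖ ≤ a) (hc : ∀ t ∈ Icc 0 x, ‖φ t - φ' t‖ ≤ c)
    (hA : ∫ t in (0 : ℝ)..x, ‖f' t‖ ≤ A) (hD : ∀ t ∈ Icc 0 x, ‖φ t‖ ≤ D) :
    ‖(∫ t in (0 : ℝ)..x, f t * φ t) - ∫ t in (0 : ℝ)..x, f' t * φ' t‖ ≤ D * a + c * A := by
  have h0 : (0 : ℝ) ∈ Icc 0 x := ⟨le_rfl, hx⟩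
  have hc0 : 0 ≤ c := (norm_nonneg _).trans (hc 0 h0)
  have hD0 : 0 ≤ D := (norm_nonneg _).trans (hD 0 h0)
  rw [← uIcc_of_le hx] at hφ hφ'
  have e : (∫ t in (0 : ℝ)..x, f t * φ t) - ∫ t in (0 : ℝ)..x, f' t * φ' t =
      (∫ t in (0 : ℝ)..x, (f t - f' t) * φ t) + ∫ t in (0 : ℝ)..x, f' t * (φ t - φ' t) := by
    have i1 : IntervalIntegrable (fun t => (f t - f' t) * φ t) volume 0 x :=
      (hf.sub hf').mul_continuousOn hφ
    have i2 : IntervalIntegrable (fun t => f' t * (φ t - φ' t)) volume 0 x :=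
      hf'.mul_continuousOn (hφ.sub hφ')
    rw [← intervalIntegral.integral_add i1 i2, ← intervalIntegral.integral_sub
      (hf.mul_continuousOn hφ) (hf'.mul_continuousOn hφ')]
    congr 1; ext t; ring
  rw [e]
  refine (norm_add_le _ _).trans (add_le_add ?_ ?_)
  · exact (norm_integral_mul_le hx (hf.sub hf') hD).trans (by gcongr)
  · exact (norm_integral_mul_le hx hf' hc).trans (by gcongr)

theorem integral_norm_le_of_eLpNorm_le {T x b : ℝ} (hx : x ∈ Icc 0 T) {f : ℝ → ℂ}
    (hf : MemLp f 2 (volume.restrict (Ioc 0 T))) (hb : 0 ≤ b)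
    (h : eLpNorm f 2 (volume.restrict (Ioc 0 T)) ≤ ENNReal.ofReal b) :
    ∫ t in (0 : ℝ)..x, ‖f t‖ ≤ √T * b := by
  have hT : 0 ≤ T := hx.1.trans hx.2
  have hi : IntegrableOn f (Ioc 0 T) := hf.integrable (by norm_num)
  have h1 := integral_norm_le_of_memLp hf
  rw [measureReal_restrict_apply_univ, Real.volume_real_Ioc_of_le hT, sub_zero] at h1
  have h2 : ∫ t in (0 : ℝ)..x, ‖f t‖ ≤ ∫ t in Ioc 0 T, ‖f t‖ := by
    rw [intervalIntegral.integral_of_le hx.1]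
    exact setIntegral_mono_set hi.norm (ae_of_all _ fun _ => norm_nonneg _)
      (Ioc_subset_Ioc_right hx.2).eventuallyLE
  refine h2.trans (h1.trans ?_)
  gcongr
  exact ENNReal.toReal_le_of_le_ofReal hb h

/-- Uniqueness for the Gelfand–Levitan equation with a small kernel. -/
theorem SolvesGL.unique {T η x : ℝ} {F : ℝ → ℝ → ℂ} (hx : x ∈ Icc 0 T) (hTη : T * η ≤ 1 / 2)
    (hF : ∀ x ∈ Icc 0 T, ∀ t ∈ Icc 0 T, ‖F x t‖ ≤ η)
    (cF : ∀ t, Continuous fun u => F u t) {κ κ' : ℝ → ℂ}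
    (hκ : IntervalIntegrable κ volume 0 x) (hκ' : IntervalIntegrable κ' volume 0 x)
    (h : SolvesGL F x κ) (h' : SolvesGL F x κ') : EqOn κ κ' (Icc 0 x) := by
  have hη : 0 ≤ η := (norm_nonneg _).trans (hF x hx x hx)
  have hb : ∀ t ∈ Icc 0 x, ‖κ t - κ' t‖ ≤ 0 + η * ∫ u in (0 : ℝ)..x, ‖κ u - κ' u‖ := by
    intro t ht
    have e : κ t - κ' t = -∫ u in (0 : ℝ)..x, (κ u - κ' u) * F u t := by
      have e1 : ∫ u in (0 : ℝ)..x, (κ u - κ' u) * F u t =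
          (∫ u in (0 : ℝ)..x, κ u * F u t) - ∫ u in (0 : ℝ)..x, κ' u * F u t := by
        rw [← intervalIntegral.integral_sub (hκ.mul_continuousOn (cF t).continuousOn)
          (hκ'.mul_continuousOn (cF t).continuousOn)]
        simp only [sub_mul]
      linear_combination h t ht - h' t ht + e1
    rw [e, norm_neg, zero_add]
    exact norm_integral_mul_le hx.1 (hκ.sub hκ')
      fun u hu => hF u ⟨hu.1, hu.2.trans hx.2⟩ t ⟨ht.1, ht.2.trans hx.2⟩
  have h1 := fredholm_bound hx hη hTη (h := fun t => κ t - κ' t) (g := fun _ => 0) (hκ.sub hκ')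
    (by simp) hb
  simp only [intervalIntegral.integral_zero, mul_zero] at h1
  intro t ht
  have h2 := hb t ht
  have h3 : η * ∫ u in (0 : ℝ)..x, ‖κ u - κ' u‖ ≤ 0 := mul_nonpos_of_nonneg_of_nonpos hη h1
  exact sub_eq_zero.1 (norm_le_zero_iff.1 (by linarith))

section Limit

variable {T η : ℝ} {q : ℝ → ℂ} {F : ℝ → ℝ → ℂ} {Fn Kn : ℕ → ℝ → ℝ → ℂ} {dn : ℕ → ℝ → ℂ}
  {b : ℕ → ℝ}

/-- Approximations of a Gelfand–Levitan problem with kernel `F` by problems with kernels `Fn n`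
which are solved by `Kn n`. -/
structure GLApprox (T η : ℝ) (F : ℝ → ℝ → ℂ) (Fn Kn : ℕ → ℝ → ℝ → ℂ) (dn : ℕ → ℝ → ℂ)
    (b : ℕ → ℝ) : Prop where
  T_nonneg : 0 ≤ T
  b_nonneg : ∀ n, 0 ≤ b n
  b_tendsto : Tendsto b atTop (𝓝 0)
  cont_F : ∀ t, Continuous fun u => F u t
  cont_Fn : ∀ n t, Continuous fun u => Fn n u t
  cont_Kn : ∀ n, ∀ x ∈ Icc 0 T, Continuous (Kn n x)
  F_le : ∀ x ∈ Icc 0 T, ∀ t ∈ Icc 0 T, ‖F x t‖ ≤ η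
  F_sub_le : ∀ n, ∀ x ∈ Icc 0 T, ∀ t ∈ Icc 0 T, ‖Fn n x t - F x t‖ ≤ b n
  K_le : ∀ n, ∀ x ∈ Icc 0 T, ∀ t ∈ Icc 0 T, ‖Kn n x t‖ ≤ 2 * η
  K_sub_le : ∀ n k, ∀ x ∈ Icc 0 T, ∀ t ∈ Icc 0 T, ‖Kn n x t - Kn k x t‖ ≤ b n + b k
  K_eq : ∀ n, ∀ x ∈ Icc 0 T, ∀ t ∈ Icc 0 T,
    Kn n x t = -Fn n x t - ∫ u in (0 : ℝ)..x, Kn n x u * Fn n u t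
  diag : ∀ n, IsPrim T (fun x => Kn n x x) (dn n)
  dn_memLp : ∀ n, MemLp (dn n) 2 (volume.restrict (Ioc 0 T))
  dn_sub_le : ∀ n k, eLpNorm (dn n - dn k) 2 (volume.restrict (Ioc 0 T)) ≤
    ENNReal.ofReal (b n + b k)

namespace GLApprox

variable (A : GLApprox T η F Fn Kn dn b)
include A

theorem exists_K : ∃ K : ℝ → ℝ → ℂ, ∀ n, ∀ x ∈ Icc 0 T, ∀ t ∈ Icc 0 T, ‖Kn n x t - K x t‖ ≤ b n := by
  have h : ∀ x t, ∃ k : ℂ, x ∈ Icc 0 T → t ∈ Icc 0 T → ∀ n, ‖Kn n x t - k‖ ≤ b n := by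
    intro x t
    by_cases hx : x ∈ Icc 0 T ∧ t ∈ Icc 0 T
    · have hc : CauchySeq fun n => Kn n x t := by
        refine Metric.cauchySeq_iff.2 fun ε hε => ?_
        obtain ⟨N, hN⟩ := eventually_atTop.1 (A.b_tendsto.eventually (gt_mem_nhds (half_pos hε)))
        refine ⟨N, fun n hn k hk => ?_⟩
        rw [dist_eq_norm]
        exact (A.K_sub_le n k x hx.1 t hx.2).trans_lt (by linarith [hN n hn, hN k hk])
      obtain ⟨g, hg⟩ := cauchySeq_tendsto_of_complete hc
      refine ⟨g, fun _ _ n => ?_⟩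
      have t1 : Tendsto (fun k => ‖Kn n x t - Kn k x t‖) atTop (𝓝 ‖Kn n x t - g‖) :=
        (tendsto_const_nhds.sub hg).norm
      have t2 : Tendsto (fun k => b n + b k) atTop (𝓝 (b n + 0)) := A.b_tendsto.const_add _
      rw [add_zero] at t2
      exact le_of_tendsto_of_tendsto' t1 t2 fun k => A.K_sub_le n k x hx.1 t hx.2
    · exact ⟨0, fun h1 h2 => absurd ⟨h1, h2⟩ hx⟩
  choose K hK using h
  exact ⟨K, fun n x hx t ht => hK x t hx ht n⟩

theorem tendsto_of_le {f : ℕ → ℂ} {g : ℂ} {c : ℝ} (h : ∀ n, ‖f n - g‖ ≤ c * b n) :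
    Tendsto f atTop (𝓝 g) := by
  rw [tendsto_iff_norm_sub_tendsto_zero]
  have := A.b_tendsto.const_mul c
  rw [mul_zero] at this
  exact squeeze_zero (fun _ => norm_nonneg _) h this

variable {K : ℝ → ℝ → ℂ} (hK : ∀ n, ∀ x ∈ Icc 0 T, ∀ t ∈ Icc 0 T, ‖Kn n x t - K x t‖ ≤ b n)
include hK

theorem continuousOn_K {x : ℝ} (hx : x ∈ Icc 0 T) : ContinuousOn (K x) (Icc 0 T) := by
  have hu : TendstoUniformlyOn (fun n => Kn n x) (K x) atTop (Icc 0 T) := by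
    rw [Metric.tendstoUniformlyOn_iff]
    intro ε hε
    filter_upwards [A.b_tendsto.eventually (gt_mem_nhds hε)] with n hn t ht
    rw [dist_comm, dist_eq_norm]
    exact (hK n x hx t ht).trans_lt hn
  exact hu.continuousOn (Frequently.of_forall fun n => (A.cont_Kn n x hx).continuousOn)

theorem intervalIntegrable_K {x : ℝ} (hx : x ∈ Icc 0 T) : IntervalIntegrable (K x) volume 0 x := by
  refine ((A.continuousOn_K hK hx).mono ?_).intervalIntegrable
  rw [uIcc_of_le hx.1]
  exact Icc_subset_Icc_right hx.2

/-- Both the kernels and the solutions converge uniformly, so the equation passes to the limit term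
by term. -/
theorem solvesGL {x : ℝ} (hx : x ∈ Icc 0 T) : SolvesGL F x (K x) := by
  intro t ht
  have ht' : t ∈ Icc 0 T := ⟨ht.1, ht.2.trans hx.2⟩
  have sub : Icc 0 x ⊆ Icc 0 T := Icc_subset_Icc_right hx.2
  have l1 : Tendsto (fun n => Kn n x t) atTop (𝓝 (K x t)) :=
    A.tendsto_of_le (c := 1) fun n => by rw [one_mul]; exact hK n x hx t ht'
  have l2 : Tendsto (fun n => Fn n x t) atTop (𝓝 (F x t)) :=
    A.tendsto_of_le (c := 1) fun n => by rw [one_mul]; exact A.F_sub_le n x hx t ht'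
  have l3 : Tendsto (fun n => ∫ u in (0 : ℝ)..x, Kn n x u * Fn n u t) atTop
      (𝓝 (∫ u in (0 : ℝ)..x, K x u * F u t)) := by
    obtain ⟨D, hD⟩ : ∃ D, ∀ n, ∀ u ∈ Icc 0 x, ‖Fn n u t‖ ≤ D := by
      obtain ⟨D, hD⟩ := A.b_tendsto.bddAbove_range
      refine ⟨D + η, fun n u hu => ?_⟩
      have := norm_add_le (Fn n u t - F u t) (F u t)
      rw [sub_add_cancel] at this
      linarith [A.F_sub_le n u (sub hu) t ht', A.F_le u (sub hu) t ht', hD ⟨n, rfl⟩]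
    refine A.tendsto_of_le (c := D * x + ∫ u in (0 : ℝ)..x, ‖K x u‖) fun n => ?_
    have hD0 : 0 ≤ D := (norm_nonneg _).trans (hD n 0 ⟨le_rfl, hx.1⟩)
    refine (norm_integral_mul_sub_le (a := b n * x) hx.1
      ((A.cont_Kn n x hx).intervalIntegrable _ _) (A.intervalIntegrable_K hK hx)
      (A.cont_Fn n t).continuousOn (A.cont_F t).continuousOn ?_
      (fun u hu => A.F_sub_le n u (sub hu) t ht') le_rfl (hD n)).trans (le_of_eq (by ring))
    have := intervalIntegral.integral_mono_on hx.1
      (((A.cont_Kn n x hx).intervalIntegrable 0 x).sub (A.intervalIntegrable_K hK hx)).norm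
      (intervalIntegrable_const (c := b n)) fun u hu => hK n x hx u (sub hu)
    simpa [mul_comm] using this
  have e := tendsto_nhds_unique l1 ((l2.neg.sub l3).congr fun n => (A.K_eq n x hx t ht').symm)
  rw [e]; ring

/-- On a bounded interval L₂ convergence of the diagonal derivatives implies convergence of their
primitives. -/
theorem hasL2Deriv {dK : ℝ → ℂ} (hm : MemLp dK 2 (volume.restrict (Ioc 0 T)))
    (hd : ∀ n, eLpNorm (dn n - dK) 2 (volume.restrict (Ioc 0 T)) ≤ ENNReal.ofReal (b n)) :
    HasL2Deriv T (fun x => K x x) dK := by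
  refine ⟨hm, fun x hx => ?_⟩
  have h0 : (0 : ℝ) ∈ Icc 0 T := ⟨le_rfl, A.T_nonneg⟩
  have hi : IntervalIntegrable dK volume 0 T := by
    rw [intervalIntegrable_iff_integrableOn_Ioc_of_le A.T_nonneg]
    exact hm.integrable (by norm_num)
  have l1 : ∀ x ∈ Icc 0 T, Tendsto (fun n => Kn n x x) atTop (𝓝 (K x x)) := fun x hx =>
    A.tendsto_of_le (c := 1) fun n => by rw [one_mul]; exact hK n x hx x hx
  have l2 : Tendsto (fun n => ∫ t in (0 : ℝ)..x, dn n t) atTop (𝓝 (∫ t in (0 : ℝ)..x, dK t)) := by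
    refine A.tendsto_of_le (c := √T) fun n => ?_
    rw [← intervalIntegral.integral_sub ((A.diag n).intervalIntegrable h0 hx) (subinterval hi hx)]
    refine (intervalIntegral.norm_integral_le_integral_norm hx.1).trans ?_
    exact integral_norm_le_of_eLpNorm_le hx ((A.dn_memLp n).sub hm) (A.b_nonneg n) (hd n)
  exact tendsto_nhds_unique (l1 x hx)
    (((l1 0 h0).add l2).congr fun n => ((A.diag n).eqn x hx).symm)

/-- The equation is passed to the limit in integrated form: the solutions converge uniformly and the
potentials in L¹, so the derivatives converge uniformly too. The hypothesis on the approximations is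
only eventual because a given `lam` enters the disc only for large `n`. -/
theorem isSLSolution (hq : IntervalIntegrable q volume 0 T)
    {dK : ℝ → ℂ} (hm : MemLp dK 2 (volume.restrict (Ioc 0 T)))
    (hd : ∀ n, eLpNorm (dn n - dK) 2 (volume.restrict (Ioc 0 T)) ≤ ENNReal.ofReal (b n))
    {lam : ℂ} {s : ℝ → ℂ} (hs : Continuous s) (s0 : s 0 = 0)
    (hode : ∀ᶠ n in atTop, ∃ y y1 : ℝ → ℂ,
      (∀ x ∈ Icc 0 T, y x = s x + ∫ t in (0 : ℝ)..x, Kn n x t * s t) ∧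
      IsPrim T y y1 ∧ IsPrim T y1 (fun x => (q x + 2 * dn n x - lam) * y x) ∧ y1 0 = 1) :
    ∃ dy, IsSLSolution (fun x => q x + 2 * dK x) T lam
      (fun x => s x + ∫ t in (0 : ℝ)..x, K x t * s t) dy ∧ dy 0 = 1 := by
  have hT := A.T_nonneg
  have h0 : (0 : ℝ) ∈ Icc 0 T := ⟨le_rfl, hT⟩
  obtain ⟨N, hN⟩ := eventually_atTop.1 hode
  choose! y y1 hy p1 p2 y10 using hN
  set Y : ℝ → ℂ := fun x => s x + ∫ t in (0 : ℝ)..x, K x t * s t with hY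
  have hi : ∀ {f : ℝ → ℂ}, MemLp f 2 (volume.restrict (Ioc 0 T)) →
      IntervalIntegrable f volume 0 T := fun hf => by
    rw [intervalIntegrable_iff_integrableOn_Ioc_of_le hT]
    exact hf.integrable (by norm_num)
  obtain ⟨D, hD⟩ := (isCompact_Icc (a := (0 : ℝ)) (b := T)).exists_bound_of_continuousOn
    hs.continuousOn
  have hD0 : 0 ≤ D := (norm_nonneg _).trans (hD 0 h0)
  have hη : 0 ≤ η := (norm_nonneg _).trans (A.F_le 0 h0 0 h0)
  have yY : ∀ n, N ≤ n → ∀ x ∈ Icc 0 T, ‖y n x - Y x‖ ≤ D * T * b n := by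
    intro n hn x hx
    have e : y n x - Y x = ∫ t in (0 : ℝ)..x, (Kn n x t - K x t) * s t := by
      rw [hy n hn x hx]
      simp only [hY, sub_mul]
      rw [intervalIntegral.integral_sub]
      · ring
      · exact ((A.cont_Kn n x hx).mul hs).intervalIntegrable _ _
      · exact (A.intervalIntegrable_K hK hx).mul_continuousOn hs.continuousOn
    rw [e]
    have := intervalIntegral.norm_integral_le_of_norm_le_const (a := 0) (b := x)
      (f := fun t => (Kn n x t - K x t) * s t) (C := b n * D) fun t ht => by
        rw [uIoc_of_le hx.1] at ht
        have ht' : t ∈ Icc 0 T := ⟨ht.1.le, ht.2.trans hx.2⟩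
        rw [norm_mul]
        exact mul_le_mul (hK n x hx t ht') (hD t ht') (norm_nonneg _) (A.b_nonneg n)
    refine this.trans ?_
    rw [sub_zero, abs_of_nonneg hx.1]
    have := mul_le_mul_of_nonneg_left hx.2 (mul_nonneg (A.b_nonneg n) hD0)
    linarith
  have ybd : ∀ n, N ≤ n → ∀ x ∈ Icc 0 T, ‖y n x‖ ≤ D + 2 * η * D * T := by
    intro n hn x hx
    rw [hy n hn x hx]
    refine (norm_add_le _ _).trans (add_le_add (hD x hx) ?_)
    have := intervalIntegral.norm_integral_le_of_norm_le_const (a := 0) (b := x)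
      (f := fun t => Kn n x t * s t) (C := 2 * η * D) fun t ht => by
        rw [uIoc_of_le hx.1] at ht
        have ht' : t ∈ Icc 0 T := ⟨ht.1.le, ht.2.trans hx.2⟩
        rw [norm_mul]
        exact mul_le_mul (A.K_le n x hx t ht') (hD t ht') (norm_nonneg _) (by positivity)
    refine this.trans ?_
    rw [sub_zero, abs_of_nonneg hx.1]
    exact mul_le_mul_of_nonneg_left hx.2 (by positivity)
  have cy : ∀ n, N ≤ n → ContinuousOn (y n) (Icc 0 T) := fun n hn => (p1 n hn).continuousOn hT
  have small : ∀ c : ℝ, Tendsto (fun n => c * b n) atTop (𝓝 0) := fun c => by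
    simpa using A.b_tendsto.const_mul c
  have cY : ContinuousOn Y (Icc 0 T) := by
    have hu : TendstoUniformlyOn y Y atTop (Icc 0 T) := by
      rw [Metric.tendstoUniformlyOn_iff]
      intro ε hε
      filter_upwards [(small (D * T)).eventually (gt_mem_nhds hε), eventually_ge_atTop N]
        with n hn hn' t ht
      rw [dist_comm, dist_eq_norm]
      exact (yY n hn' t ht).trans_lt hn
    exact hu.continuousOn ((eventually_ge_atTop N).mono cy).frequently
  set f : ℝ → ℂ := fun x => q x + 2 * dK x - lam with hf
  have fi : IntervalIntegrable f volume 0 T := (hq.add ((hi hm).const_mul 2)).sub (by simp)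
  have fni : ∀ n, IntervalIntegrable (fun x => q x + 2 * dn n x - lam) volume 0 T := fun n =>
    (hq.add ((hi (A.dn_memLp n)).const_mul 2)).sub (by simp)
  set Y1 : ℝ → ℂ := fun x => 1 + ∫ t in (0 : ℝ)..x, f t * Y t with hY1
  have P2 : IsPrim T Y1 (fun x => f x * Y x) := by
    refine ⟨fi.mul_continuousOn (by rwa [uIcc_of_le hT]), fun x _ => ?_⟩
    simp [hY1]
  have y1Y1 : ∃ c : ℝ, ∀ n, N ≤ n → ∀ x ∈ Icc 0 T, ‖y1 n x - Y1 x‖ ≤ c * b n := by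
    refine ⟨(D + 2 * η * D * T) * (2 * √T) + D * T * ∫ t in (0 : ℝ)..T, ‖f t‖, fun n hn x hx => ?_⟩
    have sub : Icc 0 x ⊆ Icc 0 T := Icc_subset_Icc_right hx.2
    rw [(p2 n hn).eqn x hx, y10 n hn, hY1, add_sub_add_left_eq_sub]
    refine (norm_integral_mul_sub_le (a := 2 * √T * b n) (A := ∫ t in (0 : ℝ)..T, ‖f t‖) hx.1
      (subinterval (fni n) hx) (subinterval fi hx) ((cy n hn).mono sub) (cY.mono sub) ?_
      (fun t ht => yY n hn t (sub ht)) ?_ (fun t ht => ybd n hn t (sub ht))).trans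
        (le_of_eq (by ring))
    · have e : ∀ t, ‖q t + 2 * dn n t - lam - f t‖ = 2 * ‖(dn n - dK) t‖ := fun t => by
        have : q t + 2 * dn n t - lam - f t = 2 * (dn n - dK) t := by
          simp only [hf, Pi.sub_apply]; ring
        rw [this, norm_mul, Complex.norm_two]
      simp only [e]
      rw [intervalIntegral.integral_const_mul, mul_assoc]
      gcongr
      exact integral_norm_le_of_eLpNorm_le hx ((A.dn_memLp n).sub hm) (A.b_nonneg n) (hd n)
    · exact intervalIntegral.integral_mono_interval le_rfl hx.1 hx.2
        (ae_of_all _ fun _ => norm_nonneg _) fi.norm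
  obtain ⟨c, hc⟩ := y1Y1
  have cY1 : ContinuousOn Y1 (Icc 0 T) := P2.continuousOn hT
  have tend : ∀ {g : ℕ → ℂ} {l : ℂ} {c : ℝ}, (∀ n, N ≤ n → ‖g n - l‖ ≤ c * b n) →
      Tendsto g atTop (𝓝 l) := fun {g l c} h => by
    rw [tendsto_iff_norm_sub_tendsto_zero]
    exact squeeze_zero' (Eventually.of_forall fun _ => norm_nonneg _)
      ((eventually_ge_atTop N).mono h) (small c)
  have Y0 : Y 0 = 0 := by simp [hY, s0]
  have P1 : IsPrim T Y Y1 := by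
    refine ⟨ContinuousOn.intervalIntegrable (by rwa [uIcc_of_le hT]), fun x hx => ?_⟩
    have l1 : Tendsto (fun n => y n x) atTop (𝓝 (Y x)) := tend fun n hn => yY n hn x hx
    have l2 : Tendsto (fun n => ∫ t in (0 : ℝ)..x, y1 n t) atTop
        (𝓝 (∫ t in (0 : ℝ)..x, Y1 t)) := by
      refine tend (c := c * T) fun n hn => ?_
      have i1 : IntervalIntegrable Y1 volume 0 T :=
        ContinuousOn.intervalIntegrable (by rwa [uIcc_of_le hT])
      rw [← intervalIntegral.integral_sub ((p1 n hn).intervalIntegrable h0 hx) (subinterval i1 hx)]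
      have := intervalIntegral.norm_integral_le_of_norm_le_const (a := 0) (b := x)
        (f := fun t => y1 n t - Y1 t) (C := c * b n) fun t ht => by
          rw [uIoc_of_le hx.1] at ht
          exact hc n hn t ⟨ht.1.le, ht.2.trans hx.2⟩
      refine this.trans ?_
      rw [sub_zero, abs_of_nonneg hx.1]
      have h2 : 0 ≤ c * b n := (norm_nonneg _).trans (hc n hn 0 h0)
      have := mul_le_mul_of_nonneg_left hx.2 h2
      linarith
    have e : ∀ᶠ n in atTop, ∫ t in (0 : ℝ)..x, y1 n t = y n x := by
      filter_upwards [eventually_ge_atTop N] with n hn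
      have z : y n 0 = 0 := by rw [hy n hn 0 h0, s0]; simp
      rw [(p1 n hn).eqn x hx, z, zero_add]
    rw [Y0, zero_add]
    exact tendsto_nhds_unique l1 (l2.congr' e)
  exact ⟨Y1, (isSLSolution_iff hT).2 ⟨P1, P2⟩, by simp [hY1]⟩

end GLApprox

end Limit

/-! ### The transformation kernel of a small L₂ weight -/

theorem l2norm_eq_sqrt {w : ℝ → ℂ} (hw : MemLp w 2) : l2norm w = √(∫ σ, ‖w σ‖ ^ 2) := by
  rw [l2norm, hw.eLpNorm_eq_integral_rpow_norm (by norm_num) (by norm_num),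
    ENNReal.toReal_ofReal (by positivity), Real.sqrt_eq_rpow]
  simp

theorem l2norm_mono {w w' : ℝ → ℂ} (hw' : MemLp w' 2) (h : ∀ σ, ‖w σ‖ ≤ ‖w' σ‖) :
    l2norm w ≤ l2norm w' :=
  ENNReal.toReal_mono hw'.2.ne (eLpNorm_mono h)

theorem l2norm_sub_le {u v w : ℝ → ℂ} (hu : MemLp u 2) (hv : MemLp v 2) (hw : MemLp w 2) :
    l2norm (u - v) ≤ l2norm (u - w) + l2norm (v - w) := by
  have h1 : eLpNorm (u - v) 2 volume ≤ eLpNorm (u - w) 2 volume + eLpNorm (v - w) 2 volume := by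
    have : u - v = (u - w) - (v - w) := by abel
    rw [this]
    exact eLpNorm_sub_le (hu.sub hw).1 (hv.sub hw).1 (by norm_num)
  have h2 := ENNReal.toReal_mono (ENNReal.add_ne_top.2 ⟨(hu.sub hw).2.ne, (hv.sub hw).2.ne⟩) h1
  rwa [ENNReal.toReal_add (hu.sub hw).2.ne (hv.sub hw).2.ne] at h2

theorem tendsto_l2norm_indicator_sub {w : ℝ → ℂ} (hw : MemLp w 2) :
    Tendsto (fun n : ℕ => l2norm ((Icc (-n : ℝ) n).indicator w - w)) atTop (𝓝 0) := by
  have hm : ∀ n : ℕ, MemLp ((Icc (-n : ℝ) n).indicator w - w) 2 := fun n =>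
    (hw.indicator measurableSet_Icc).sub hw
  simp only [fun n => l2norm_eq_sqrt (hm n)]
  rw [← Real.sqrt_zero]
  refine (Real.continuous_sqrt.tendsto 0).comp ?_
  have hi := hw.integrable_norm_pow (by norm_num)
  have : (0 : ℝ) = ∫ _ : ℝ, (0 : ℝ) := by simp
  rw [this]
  refine tendsto_integral_of_dominated_convergence (fun σ => ‖w σ‖ ^ 2) (fun n => ?_) hi
    (fun n => ae_of_all _ fun σ => ?_) (ae_of_all _ fun σ => ?_)
  · exact (hm n).1.norm.pow 2
  · rw [Real.norm_of_nonneg (by positivity)]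
    gcongr
    by_cases h : σ ∈ Icc (-n : ℝ) n <;> simp [h]
  · refine tendsto_const_nhds.congr' ?_
    obtain ⟨N, hN⟩ := exists_nat_ge |σ|
    filter_upwards [eventually_ge_atTop N] with n hn
    have h : σ ∈ Icc (-n : ℝ) n := abs_le.1 (hN.trans (by exact_mod_cast hn))
    simp [h]

/-- The form in which the diagonal derivative is controlled: up to a uniformly small error it is
`-2` times a function known only in L₂. -/
theorem eLpNorm_two_le_of_add_two_mul {T a b : ℝ} (hT : 0 < T) {f g : ℝ → ℂ}
    (hf : AEStronglyMeasurable f (volume.restrict (Ioc 0 T)))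
    (hg : AEStronglyMeasurable g (volume.restrict (Ioc 0 T)))
    (hb0 : 0 ≤ b) (ha : ∀ x ∈ Ioc 0 T, ‖f x + 2 * g x‖ ≤ a)
    (hb : eLpNorm g 2 (volume.restrict (Ioc 0 T)) ≤ ENNReal.ofReal b) :
    eLpNorm f 2 (volume.restrict (Ioc 0 T)) ≤ ENNReal.ofReal (√T * a + 2 * b) := by
  have e : f = (fun x => f x + 2 * g x) - fun x => 2 * g x := by ext x; simp
  have hg2 : AEStronglyMeasurable (fun x => 2 * g x) (volume.restrict (Ioc 0 T)) := hg.const_mul 2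
  have h := eLpNorm_sub_le (hf.add hg2) hg2 (p := 2) (by norm_num)
  have e1 := eLpNorm_le_of_ae_bound (p := 2) (μ := volume.restrict (Ioc 0 T))
    ((ae_restrict_mem measurableSet_Ioc).mono ha)
  have e4 : T ^ (2 : ℝ≥0∞).toReal⁻¹ = √T := by
    rw [Real.sqrt_eq_rpow]; simp
  rw [Measure.restrict_apply_univ, Real.volume_Ioc, sub_zero, ENNReal.ofReal_rpow_of_pos hT,
    ← ENNReal.ofReal_mul (by positivity), e4] at e1
  have e2 : ∀ᵐ x ∂(volume.restrict (Ioc 0 T)), ‖2 * g x‖ ≤ 2 * ‖g x‖ :=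
    ae_of_all _ fun x => by rw [norm_mul, Complex.norm_two]
  have e3 := (eLpNorm_le_mul_eLpNorm_of_ae_le_mul e2 2).trans (mul_le_mul_right hb _)
  have ha0 : 0 ≤ a := (norm_nonneg _).trans (ha T ⟨hT, le_rfl⟩)
  rw [← ENNReal.ofReal_mul zero_le_two] at e3
  rw [e]
  refine h.trans ((add_le_add e1 e3).trans ?_)
  rw [← ENNReal.ofReal_add (by positivity) (by positivity)]

section Transformation

variable {T : ℝ} (hT : 0 ≤ T) {q : ℝ → ℂ} (hq : IntervalIntegrable q volume 0 T) {τ : ℝ}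

/-- The estimates see the weights only through their L₂ norms, although integrability is needed to
state them. This is what permits removing the truncation. -/
theorem exists_stability (hT0 : 0 < T) (hτ : 0 < τ) : ∃ A : ℝ, 0 < A ∧
    (∀ w, MemLp w 2 → ∀ x t, ‖kerF hT hq τ w x t‖ ≤ A * l2norm w * (1 / (2 * T))) ∧
    (∀ w w', Integrable w → MemLp w 2 → Integrable w' → MemLp w' 2 →
      A * l2norm w ≤ 1 → A * l2norm w' ≤ 1 → ∀ K L dκ K' L' dκ',
      GLSol T (kerF hT hq τ w) (kerG hT hq τ w) K L dκ →
      GLSol T (kerF hT hq τ w') (kerG hT hq τ w') K' L' dκ' →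
      (∀ x ∈ Icc 0 T, ∀ t ∈ Icc 0 T, ‖K x t - K' x t‖ ≤ A * l2norm (w - w')) ∧
      (ContinuousOn dκ (Icc 0 T) → ContinuousOn dκ' (Icc 0 T) →
        eLpNorm (dκ - dκ') 2 (volume.restrict (Ioc 0 T)) ≤
          ENNReal.ofReal (A * l2norm (w - w')))) := by
  obtain ⟨C, hC⟩ := exists_lineBounds hT hq hτ
  obtain ⟨M1, hM1, hG⟩ := integral_norm_kerG_le hT hq hτ hC
  obtain ⟨M2, hM2, hGd⟩ := eLpNorm_kerG_diag_le hT hq hτ hC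
  have hF := fun (w : ℝ → ℂ) (hw : MemLp w 2) => norm_kerF_le hT hq hτ hC hw
  set B := C ^ 2 * l2norm (fun σ => (linePoint τ σ)⁻¹)
  have hB : 0 ≤ B := mul_nonneg (sq_nonneg C) (l2norm_nonneg _)
  set D := B + M1
  have hD : 0 ≤ D := by positivity
  -- The summand `2TD` makes the kernels at most `1/(2T)` once `A * l2norm w ≤ 1`. The summand `4D`
  -- serves the difference of the `K`. The last two serve that of the diagonal derivatives, where
  -- `28η = 14/T`.
  set A := 1 + 2 * T * D + 4 * D + 14 / T * D * √T + 2 * M2 with hA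
  have hA0 : 0 ≤ 14 / T * D * √T := by positivity
  have hA1 : 0 ≤ 2 * T * D := by positivity
  have hAD : D ≤ A * (1 / (2 * T)) := by
    rw [mul_one_div, le_div_iff₀ (by positivity)]
    nlinarith
  have hBA : B ≤ A * (1 / (2 * T)) := le_trans (by simp only [D]; linarith) hAD
  have hMA : M1 ≤ A * (1 / (2 * T)) := le_trans (by simp only [D]; linarith) hAD
  refine ⟨A, by positivity, fun w hw x t => ?_, ?_⟩
  · have := mul_le_mul_of_nonneg_right hBA (l2norm_nonneg w)
    linarith [hF w hw x t]
  intro w w' h1 h2 h1' h2' hw hw' K L dκ K' L' dκ' s s'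
  set l := l2norm (w - w')
  have hl : 0 ≤ l := l2norm_nonneg _
  set η := 1 / (2 * T) with hη
  have hη0 : 0 ≤ η := by positivity
  have hTη : T * η ≤ 1 / 2 := by rw [hη]; field_simp; rfl
  have bF : ∀ w, MemLp w 2 → A * l2norm w ≤ 1 → ∀ x ∈ Icc 0 T, ∀ t ∈ Icc 0 T,
      ‖kerF hT hq τ w x t‖ ≤ η := fun w hw h x _ t _ => by
    have := mul_le_mul_of_nonneg_right hBA (l2norm_nonneg w)
    have := mul_le_mul_of_nonneg_right h hη0
    linarith [hF w hw x t]
  have bG : ∀ w, Integrable w → MemLp w 2 → A * l2norm w ≤ 1 → ∀ x ∈ Icc 0 T,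
      ∫ t in (0 : ℝ)..x, ‖kerG hT hq τ w x t‖ ≤ η := fun w hi hw h x hx => by
    have := mul_le_mul_of_nonneg_right hMA (l2norm_nonneg w)
    have := mul_le_mul_of_nonneg_right h hη0
    linarith [hG w hi hw x hx]
  have dF : ∀ x ∈ Icc 0 T, ∀ t ∈ Icc 0 T,
      ‖kerF hT hq τ w x t - kerF hT hq τ w' x t‖ ≤ D * l := fun x _ t _ => by
    rw [← kerF_sub hT hq hτ hC h2 h2']
    refine (hF _ (h2.sub h2') x t).trans ?_
    gcongr
    simp only [D]; linarith
  have dG : ∀ x ∈ Icc 0 T,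
      ∫ t in (0 : ℝ)..x, ‖kerG hT hq τ w x t - kerG hT hq τ w' x t‖ ≤ D * l := fun x hx => by
    simp only [← kerG_sub hT hq hC h1 h1']
    refine (hG _ (h1.sub h1') (h2.sub h2') x hx).trans ?_
    gcongr
    simp only [D]; linarith
  have F1 := bF w h2 hw
  have F2 := bF w' h2' hw'
  have G1 := bG w h1 h2 hw
  have G2 := bG w' h1' h2' hw'
  refine ⟨fun x hx t ht => ?_, fun c c' => ?_⟩
  · refine (GLSol.norm_K_sub_le s s' hTη F1 F2 dF hx ht).trans ?_
    rw [← mul_assoc]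
    gcongr
    linarith
  · have key : ∀ x ∈ Ioc 0 T, ‖(dκ x - dκ' x) + 2 * kerG hT hq τ (w - w') x x‖ ≤
        28 * η * (D * l) := by
      intro x hx
      have := GLSol.norm_dκ_sub_le s s' hTη F1 F2 dF G1 G2 dG (Ioc_subset_Icc_self hx)
      rwa [← kerG_sub hT hq hC h1 h1'] at this
    have e0 := hGd _ (h1.sub h1') (h2.sub h2')
    have cG := continuous_kerG_diag hT hq hC (h1.sub h1')
    have m1 : AEStronglyMeasurable (dκ - dκ') (volume.restrict (Ioc 0 T)) :=
      ((c.sub c').mono Ioc_subset_Icc_self).aestronglyMeasurable measurableSet_Ioc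
    refine (eLpNorm_two_le_of_add_two_mul hT0 m1 cG.aestronglyMeasurable
      (mul_nonneg hM2 hl) key e0).trans
      (ENNReal.ofReal_le_ofReal ?_)
    have e5 : √T * (28 * η * (D * l)) + 2 * (M2 * l) = (14 / T * D * √T + 2 * M2) * l := by
      rw [hη]; field_simp; ring
    rw [e5]
    refine mul_le_mul_of_nonneg_right ?_ hl
    rw [hA]
    linarith

theorem exists_transformation (hT0 : 0 < T) (hτ : 0 < τ) : ∃ A : ℝ, 0 < A ∧
    ∀ w, MemLp w 2 → A * l2norm w ≤ 1 → ∃ (K : ℝ → ℝ → ℂ) (dK : ℝ → ℂ),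
      (∀ x ∈ Icc 0 T, ContinuousOn (K x) (Icc 0 x) ∧ SolvesGL (kerF hT hq τ w) x (K x) ∧
        ∀ κ : ℝ → ℂ, IntervalIntegrable κ volume 0 x → SolvesGL (kerF hT hq τ w) x κ →
          EqOn κ (K x) (Icc 0 x)) ∧
      HasL2Deriv T (fun x => K x x) dK ∧
      (∀ lam : ℂ, ∃ dy : ℝ → ℂ, IsSLSolution (fun x => q x + 2 * dK x) T lam
        (fun x => sSol hT hq x lam + ∫ t in (0 : ℝ)..x, K x t * sSol hT hq t lam) dy ∧ dy 0 = 1) ∧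
      eLpNorm dK 2 (volume.restrict (Ioc 0 T)) ≤ ENNReal.ofReal (A * l2norm w) := by
  obtain ⟨C, hC⟩ := exists_lineBounds hT hq hτ
  obtain ⟨A, hA, hF, hS⟩ := exists_stability hT hq hT0 hτ
  refine ⟨A, hA, fun w hw hAw => ?_⟩
  set wn : ℕ → ℝ → ℂ := fun n => (Icc (-n : ℝ) n).indicator w with hwn
  have m2 : ∀ n, MemLp (wn n) 2 := fun n => hw.indicator measurableSet_Icc
  have io : ∀ n : ℕ, IntegrableOn w (Icc (-n : ℝ) n) := fun n =>
    (hw.restrict _).integrable (by norm_num)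
  have m1 : ∀ n, Integrable (wn n) := fun n => (integrable_indicator_iff measurableSet_Icc).2 (io n)
  have m1' : ∀ n, Integrable fun σ => wn n σ * linePoint τ σ := fun n => by
    have : (fun σ => wn n σ * linePoint τ σ) =
        (Icc (-n : ℝ) n).indicator fun σ => w σ * linePoint τ σ := by
      ext σ; simp only [hwn, indicator]; split_ifs <;> simp
    rw [this, integrable_indicator_iff measurableSet_Icc]
    exact (io n).mul_continuousOn (continuous_linePoint τ).continuousOn isCompact_Icc
  have hle : ∀ n, l2norm (wn n) ≤ l2norm w := fun n => l2norm_mono hw fun σ => by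
    by_cases h : σ ∈ Icc (-n : ℝ) n <;> simp [hwn, h]
  have hAn : ∀ n, A * l2norm (wn n) ≤ 1 := fun n =>
    (mul_le_mul_of_nonneg_left (hle n) hA.le).trans hAw
  have hη0 : 0 ≤ 1 / (2 * T) := by positivity
  have hTη : T * (1 / (2 * T)) ≤ 1 / 2 := by field_simp; rfl
  have bF : ∀ w, MemLp w 2 → A * l2norm w ≤ 1 → ∀ x ∈ Icc 0 T, ∀ t ∈ Icc 0 T,
      ‖kerF hT hq τ w x t‖ ≤ 1 / (2 * T) := fun w hw h x _ t _ =>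
    (hF w hw x t).trans (by have := mul_le_mul_of_nonneg_right h hη0; linarith)
  -- The radius contains the truncated arc of the parabola; it also tends to infinity, so every
  -- `lam` is eventually covered.
  have hsol := fun n : ℕ => exists_glSol_of_support (w := wn n) (R := n ^ 2 + τ ^ 2 + n) (N := n) hT hq τ hT0
    (m1' n) (fun σ hσ => by
      simp only [hwn]
      exact indicator_of_notMem (fun h : σ ∈ Icc (-n : ℝ) n => absurd (abs_le.2 h) (not_le.2 hσ)) w)
    (by have : (0 : ℝ) ≤ n := n.cast_nonneg
        linarith)
    (continuous_kerF hT hq hτ hC (m2 n)) (continuous_kerG hT hq hC (m1 n))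
    (fun x hx t ht => (mul_le_mul_of_nonneg_left (bF _ (m2 n) (hAn n) x hx t ht) hT).trans hTη)
  choose Kn Ln dn gl diag cd ode using hsol
  have hS' := fun n k => hS _ _ (m1 n) (m2 n) (m1 k) (m2 k) (hAn n) (hAn k) _ _ _ _ _ _ (gl n) (gl k)
  -- One rate for all approximations: `A` governs `K` and the diagonal derivative, `A/(2T)` governs
  -- the kernel `F`.
  set E := A * (1 + 1 / (2 * T)) with hE
  have hAE : A ≤ E := by rw [hE]; nlinarith
  set b : ℕ → ℝ := fun n => E * l2norm (wn n - w) with hb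
  have htri : ∀ n k, A * l2norm (wn n - wn k) ≤ b n + b k := fun n k => by
    have h1 := l2norm_sub_le (m2 n) (m2 k) hw
    have h2 : l2norm (wn n - wn k) ≤ l2norm (wn n - w) + l2norm (wn k - w) := h1
    have h3 := l2norm_nonneg (wn n - wn k)
    have h4 := mul_le_mul hAE h2 h3 (hA.le.trans hAE)
    simp only [hb]; linarith
  have dm : ∀ n, MemLp (dn n) 2 (volume.restrict (Ioc 0 T)) := fun n => by
    obtain ⟨D, hD⟩ := (isCompact_Icc (a := (0 : ℝ)) (b := T)).exists_bound_of_continuousOn (cd n)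
    refine MemLp.of_bound (((cd n).mono Ioc_subset_Icc_self).aestronglyMeasurable
      measurableSet_Ioc) D ?_
    filter_upwards [ae_restrict_mem measurableSet_Ioc] with x hx
    exact hD x (Ioc_subset_Icc_self hx)
  have cF : ∀ w, MemLp w 2 → ∀ t, Continuous fun u => kerF hT hq τ w u t := fun w hw t =>
    (continuous_kerF hT hq hτ hC hw).comp (by fun_prop : Continuous fun u : ℝ => (u, t))
  have hb0 : ∀ n, 0 ≤ b n := fun n => mul_nonneg (hA.le.trans hAE) (l2norm_nonneg _)
  have approx : GLApprox T (1 / (2 * T)) (kerF hT hq τ w) (fun n => kerF hT hq τ (wn n)) Kn dn b :=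
    { T_nonneg := hT
      b_nonneg := hb0
      b_tendsto := by simpa using (tendsto_l2norm_indicator_sub hw).const_mul E
      cont_F := cF w hw
      cont_Fn := fun n => cF _ (m2 n)
      cont_Kn := fun n => (gl n).cont_K
      F_le := bF w hw hAw
      F_sub_le := fun n x hx t ht => by
        rw [← kerF_sub hT hq hτ hC (m2 n) hw]
        refine (hF _ ((m2 n).sub hw) x t).trans ?_
        have := mul_nonneg hA.le (l2norm_nonneg (wn n - w))
        simp only [hb, hE]
        linarith
      K_le := fun n x hx t ht => (gl n).norm_K_le hTη (bF _ (m2 n) (hAn n)) hx ht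
      K_sub_le := fun n k x hx t ht => ((hS' n k).1 x hx t ht).trans (htri n k)
      K_eq := fun n => (gl n).K_eq
      diag := diag
      dn_memLp := dm
      dn_sub_le := fun n k => ((hS' n k).2 (cd n) (cd k)).trans
        (ENNReal.ofReal_le_ofReal (htri n k)) }
  obtain ⟨K, hK⟩ := approx.exists_K
  obtain ⟨dK, hm, hd⟩ := exists_memLp_limit dm approx.b_tendsto hb0 approx.dn_sub_le
  refine ⟨K, dK, fun x hx => ⟨(approx.continuousOn_K hK hx).mono (Icc_subset_Icc_right hx.2),
    approx.solvesGL hK hx, fun κ hκ hsκ => ?_⟩, approx.hasL2Deriv hK hm hd, fun lam => ?_, ?_⟩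
  · exact SolvesGL.unique hx hTη (bF w hw hAw) (cF w hw) hκ (approx.intervalIntegrable_K hK hx) hsκ
      (approx.solvesGL hK hx)
  · refine approx.isSLSolution hK hq hm hd (Continuous.sSol hT hq continuous_id continuous_const)
      (sSol_zero hT hq lam) ?_
    obtain ⟨N, hN⟩ := exists_nat_ge ‖lam‖
    filter_upwards [eventually_ge_atTop N] with n hn
    refine ode n lam (hN.trans ?_)
    have : (N : ℝ) ≤ n := by exact_mod_cast hn
    have := sq_nonneg (n : ℝ)
    have := sq_nonneg τ
    linarith
  -- The bound for `dK` is the stability estimate against the zero weight, for the truncations and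
  -- then in the limit.
  · have zF : kerF hT hq τ (0 : ℝ → ℂ) = fun _ _ => 0 := by ext x t; simp [kerF]
    have zG : kerG hT hq τ (0 : ℝ → ℂ) = fun _ _ => 0 := by ext x t; simp [kerG]
    have z' : GLSol T (kerF hT hq τ 0) (kerG hT hq τ 0) (fun _ _ => 0) (fun _ _ => 0)
        fun _ => 0 := by
      rw [zF, zG]; exact GLSol.zero T
    have l0 : A * l2norm 0 ≤ 1 := by simp [l2norm]
    have bd : ∀ n, eLpNorm dK 2 (volume.restrict (Ioc 0 T)) ≤
        ENNReal.ofReal (b n + A * l2norm w) := fun n => by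
      have h1 := (hS _ _ (m1 n) (m2 n) (integrable_zero _ _ _) MemLp.zero (hAn n) l0 _ _ _ _ _ _
        (gl n) z').2 (cd n) continuousOn_const
      rw [sub_zero] at h1
      have h2 : dn n - (fun _ => 0) = dn n := sub_zero _
      rw [h2] at h1
      have h3 : dK = dn n - (dn n - dK) := by abel
      have h4 := eLpNorm_sub_le (dm n).1 ((dm n).sub hm).1 (p := 2) (by norm_num)
      rw [← h3] at h4
      refine h4.trans ((add_le_add h1 (hd n)).trans ?_)
      rw [add_comm, ← ENNReal.ofReal_add (hb0 n) (mul_nonneg hA.le (l2norm_nonneg _))]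
      have := mul_le_mul_of_nonneg_left (hle n) hA.le
      exact ENNReal.ofReal_le_ofReal (by linarith)
    have t := (approx.b_tendsto.add_const (A * l2norm w))
    rw [zero_add] at t
    exact ge_of_tendsto' (ENNReal.tendsto_ofReal t) bd

end Transformation

/-! ### Zeros of the characteristic function are eigenvalues -/

theorem IsSLSolution.lincomb {q : ℝ → ℂ} {T : ℝ} (hT : 0 ≤ T) {lam : ℂ} {y dy z dz : ℝ → ℂ}
    (hy : IsSLSolution q T lam y dy) (hz : IsSLSolution q T lam z dz) (α β : ℂ) :
    IsSLSolution q T lam (fun x => α * y x + β * z x) (fun x => α * dy x + β * dz x) := by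
  obtain ⟨h1, h2⟩ := (isSLSolution_iff hT).1 hy
  obtain ⟨h3, h4⟩ := (isSLSolution_iff hT).1 hz
  have c := fun (a : ℂ) {f f' : ℝ → ℂ} (h : IsPrim T f f') =>
    (h.clm (ContinuousLinearMap.mul ℝ ℂ a) : IsPrim T (fun x => a * f x) fun x => a * f' x)
  refine (isSLSolution_iff hT).2 ⟨(c α h1).add (c β h3), ((c α h2).add (c β h4)).congr
    (fun _ _ => rfl) (fun x _ => by simp only [ContinuousLinearMap.mul_apply']; ring) hT⟩

namespace Problem

variable (P : Problem m)

theorem intervalIntegrable_qc (j : Fin (m + 1)) : IntervalIntegrable (P.qc j) volume 0 (P.T j) := by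
  rw [intervalIntegrable_iff_integrableOn_Ioc_of_le (P.T_pos j).le]
  exact ((P.q_memLp j).integrable (by norm_num)).ofReal

theorem S_spec (j : Fin (m + 1)) (lam : ℂ) :
    IsSLSolution (P.qc j) (P.T j) lam (fun x => P.S j x lam) (fun x => P.dS j x lam) ∧
      P.S j 0 lam = 0 ∧ P.dS j 0 lam = 1 :=
  cauchySolution_spec (P.T_pos j).le (P.intervalIntegrable_qc j) lam 0 1

theorem C_spec (j : Fin (m + 1)) (lam : ℂ) :
    IsSLSolution (P.qc j) (P.T j) lam (fun x => P.C j x lam) (fun x => P.dC j x lam) ∧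
      P.C j 0 lam = 1 ∧ P.dC j 0 lam = 0 :=
  cauchySolution_spec (P.T_pos j).le (P.intervalIntegrable_qc j) lam 1 0

theorem wronskian (j : Fin (m + 1)) (lam : ℂ) :
    P.C j (P.T j) lam * P.dS j (P.T j) lam - P.dC j (P.T j) lam * P.S j (P.T j) lam = 1 := by
  obtain ⟨h1, h2, h3⟩ := P.S_spec j lam
  obtain ⟨h4, h5, h6⟩ := P.C_spec j lam
  have := h4.wronskian h1 (x := P.T j) ⟨(P.T_pos j).le, le_rfl⟩
  simpa [h2, h3, h5, h6] using this

theorem exists_S_ne_zero (j : Fin (m + 1)) (lam : ℂ) : ∃ x ∈ Icc 0 (P.T j), P.S j x lam ≠ 0 := by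
  by_contra! h
  obtain ⟨h1, h2, h3⟩ := P.S_spec j lam
  have h0 : (0 : ℝ) ∈ Icc 0 (P.T j) := ⟨le_rfl, (P.T_pos j).le⟩
  have d := h1.hasDeriv 0 h0
  have d' : HasDerivWithinAt (fun x => P.S j x lam) 0 (Icc 0 (P.T j)) 0 :=
    (hasDerivWithinAt_const (0 : ℝ) (Icc 0 (P.T j)) (0 : ℂ)).congr h h2
  have := (uniqueDiffOn_Icc (P.T_pos j) 0 h0).eq_deriv _ d d'
  simp only [h3] at this
  exact one_ne_zero this

/-- Reduction to linear algebra: the solution is `α C₀ + β S₀` on the loop and `γ_j S_j` on the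
boundary edges, where the Dirichlet conditions are automatic. -/
theorem isEigenvalue_of_coeffs {lam α β : ℂ} {γ : Fin m → ℂ}
    (h1 : α = P.a * (α * P.C 0 (P.T 0) lam + β * P.h lam))
    (h2 : ∀ j, α = γ j * P.sEnd j lam)
    (h3 : β = (P.a : ℂ)⁻¹ * (α * P.dC 0 (P.T 0) lam + β * P.dS 0 (P.T 0) lam) +
      ∑ j, γ j * P.dsEnd j lam)
    (h4 : α ≠ 0 ∨ β ≠ 0 ∨ ∃ j, γ j ≠ 0) : P.IsEigenvalue lam := by
  have hc := P.C_spec 0 lam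
  have hs := P.S_spec 0 lam
  have e0 : α * P.C 0 0 lam + β * P.S 0 0 lam = α := by rw [hc.2.1, hs.2.1]; ring
  refine ⟨Fin.cons (fun x => α * P.C 0 x lam + β * P.S 0 x lam) fun j x => γ j * P.S j.succ x lam,
    Fin.cons (fun x => α * P.dC 0 x lam + β * P.dS 0 x lam) fun j x => γ j * P.dS j.succ x lam,
    fun j => ?_, fun j => ?_, ?_, fun j => ?_, ?_, ?_⟩
  · refine Fin.cases ?_ (fun j => ?_) j
    · exact hc.1.lincomb (P.T_pos 0).le hs.1 α β
    · have := (P.S_spec j.succ lam).1.lincomb (P.T_pos _).le (P.S_spec j.succ lam).1 (γ j) 0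
      simpa using this
  · simp [(P.S_spec j.succ lam).2.1]
  · simp only [Fin.cons_zero]
    rw [e0]; exact h1
  · simp only [Fin.cons_zero, Fin.cons_succ]
    rw [e0]; exact h2 j
  · simp only [Fin.cons_zero, Fin.cons_succ]
    rw [hc.2.2, hs.2.2, mul_zero, mul_one, zero_add]
    exact h3
  · by_cases hα : α = 0
    · rcases h4 with h | h | ⟨j, h⟩
      · exact absurd hα h
      · obtain ⟨x, hx, hne⟩ := P.exists_S_ne_zero 0 lam
        exact ⟨0, x, hx, by simp [hα, h, hne]⟩
      · obtain ⟨x, hx, hne⟩ := P.exists_S_ne_zero j.succ lam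
        exact ⟨j.succ, x, hx, by simp [h, hne]⟩
    · exact ⟨0, 0, ⟨le_rfl, (P.T_pos 0).le⟩, by simpa only [Fin.cons_zero, e0] using hα⟩

theorem dsEnd_ne_zero {j : Fin m} {lam : ℂ} (h : P.sEnd j lam = 0) : P.dsEnd j lam ≠ 0 := by
  intro h'
  have := P.wronskian j.succ lam
  rw [sEnd] at h
  rw [dsEnd] at h'
  rw [h, h'] at this
  simp at this

/-- Zeros of the characteristic function are eigenvalues. -/
theorem isEigenvalue_of_Delta_eq_zero {lam : ℂ} (h : P.Delta lam = 0) : P.IsEigenvalue lam := by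
  classical
  have ha : (P.a : ℂ) ≠ 0 := Complex.ofReal_ne_zero.2 P.a_ne_zero
  by_cases hz : ∃ k, P.sEnd k lam = 0
  · obtain ⟨k, hk⟩ := hz
    have hk' := P.dsEnd_ne_zero hk
    have e1 : P.DeltaPi lam = 0 := Finset.prod_eq_zero (Finset.mem_univ k) hk
    have e2 : P.DeltaK lam = P.dsEnd k lam * ∏ j ∈ Finset.univ.erase k, P.sEnd j lam := by
      refine Finset.sum_eq_single k (fun r _ hr => ?_) (by simp)
      rw [Finset.prod_eq_zero (Finset.mem_erase.2 ⟨hr.symm, Finset.mem_univ k⟩) hk, mul_zero]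
    rw [Delta, e1, e2, mul_zero, zero_add] at h
    have h' : P.h lam = 0 ∨ ∏ j ∈ Finset.univ.erase k, P.sEnd j lam = 0 := by
      simpa [ha, hk'] using h
    rcases h' with h0 | h0
    -- The loop carries `S₀`, which vanishes at both ends, and edge `k` carries the multiple of
    -- `S_k` that balances the derivatives at the vertex.
    · refine P.isEigenvalue_of_coeffs (α := 0) (β := 1)
        (γ := Pi.single k ((1 - (P.a : ℂ)⁻¹ * P.dS 0 (P.T 0) lam) / P.dsEnd k lam)) ?_ (fun j => ?_)
        ?_ (Or.inr (Or.inl one_ne_zero))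
      · rw [h0]; ring
      · by_cases hj : j = k
        · rw [hj, hk, mul_zero]
        · rw [Pi.single_eq_of_ne hj, zero_mul]
      · rw [Finset.sum_eq_single k (fun r _ hr => by rw [Pi.single_eq_of_ne hr, zero_mul]) (by simp),
          Pi.single_eq_same]
        field_simp
        ring
    · obtain ⟨l, hl, hl0⟩ := Finset.prod_eq_zero_iff.1 h0
      have hlk := (Finset.mem_erase.1 hl).1
      have hl' := P.dsEnd_ne_zero hl0
      -- Two boundary edges have vanishing end values: an eigenfunction lives on these two edges,
      -- with opposite end derivatives.
      refine P.isEigenvalue_of_coeffs (α := 0) (β := 0)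
        (γ := Pi.single k (P.dsEnd k lam)⁻¹ - Pi.single l (P.dsEnd l lam)⁻¹) (by simp) (fun j => ?_)
        ?_ (Or.inr (Or.inr ⟨k, by simp [hlk.symm, hk']⟩))
      · by_cases hj : j = k
        · rw [hj, hk, mul_zero]
        · by_cases hj' : j = l
          · rw [hj', hl0, mul_zero]
          · simp [hj, hj']
      · simp only [Pi.sub_apply, sub_mul, Finset.sum_sub_distrib]
        rw [Finset.sum_eq_single k (fun r _ hr => by rw [Pi.single_eq_of_ne hr, zero_mul]) (by simp),
          Finset.sum_eq_single l (fun r _ hr => by rw [Pi.single_eq_of_ne hr, zero_mul]) (by simp),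
          Pi.single_eq_same, Pi.single_eq_same, inv_mul_cancel₀ hk', inv_mul_cancel₀ hl']
        simp
  · push Not at hz
    have hprod : P.DeltaPi lam ≠ 0 := Finset.prod_ne_zero_iff.2 fun j _ => hz j
    have eK : P.DeltaK lam = P.DeltaPi lam * ∑ r, P.dsEnd r lam / P.sEnd r lam := by
      rw [DeltaK, Finset.mul_sum]
      refine Finset.sum_congr rfl fun r _ => ?_
      rw [DeltaPi, ← Finset.mul_prod_erase _ _ (Finset.mem_univ r)]
      field_simp [hz r]
    set Sr := ∑ r, P.dsEnd r lam / P.sEnd r lam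
    have hX : P.d lam - 2 + P.a * P.h lam * Sr = 0 := by
      refine (mul_eq_zero.1 ?_).resolve_left hprod
      rw [← h, Delta, eK]; ring
    have W : P.C 0 (P.T 0) lam * P.dS 0 (P.T 0) lam - P.dC 0 (P.T 0) lam * P.h lam = 1 :=
      P.wronskian 0 lam
    -- With `γ_j = α / s_j` the matching conditions form a 2×2 system in `α`, `β`. By the Wronskian
    -- identity on the loop its determinant is `-(d - 2 + a h Σ s_r'/s_r)`, which vanishes by `hX`.
    obtain ⟨v, hv, hMv⟩ := (Matrix.exists_mulVec_eq_zero_iff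
      (M := !![P.a * P.C 0 (P.T 0) lam - 1, P.a * P.h lam;
        (P.a : ℂ)⁻¹ * P.dC 0 (P.T 0) lam + Sr, (P.a : ℂ)⁻¹ * P.dS 0 (P.T 0) lam - 1])).2 (by
      rw [Matrix.det_fin_two_of]
      rw [d] at hX
      have h1 : (P.a : ℂ) * (P.a : ℂ)⁻¹ = 1 := mul_inv_cancel₀ ha
      linear_combination W - hX +
        (P.C 0 (P.T 0) lam * P.dS 0 (P.T 0) lam - P.dC 0 (P.T 0) lam * P.h lam) * h1)
    have r0 := congrFun hMv 0
    have r1 := congrFun hMv 1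
    simp only [Matrix.mulVec, dotProduct, Fin.sum_univ_two, Matrix.of_apply, Matrix.cons_val',
      Matrix.cons_val_zero, Matrix.cons_val_one, Matrix.cons_val_fin_one, Pi.zero_apply] at r0 r1
    refine P.isEigenvalue_of_coeffs (α := v 0) (β := v 1) (γ := fun j => v 0 / P.sEnd j lam) ?_
      (fun j => by field_simp [hz j]) ?_ ?_
    · linear_combination -r0
    · have : ∑ j, v 0 / P.sEnd j lam * P.dsEnd j lam = v 0 * Sr := by
        rw [Finset.mul_sum]
        exact Finset.sum_congr rfl fun j _ => by ring
      rw [this]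
      linear_combination -r1
    · by_contra! hcon
      refine hv (funext fun i => ?_)
      fin_cases i
      · exact hcon.1
      · exact hcon.2.1

end Problem

/-! ### Asymptotic calculus in the upper half-plane -/

/-- Eventual boundedness. -/
def Bdd (l : Filter ℂ) (f : ℂ → ℂ) : Prop := ∃ C, ∀ᶠ ρ in l, ‖f ρ‖ ≤ C

namespace Bdd

variable {l : Filter ℂ} {f g f₀ g₀ : ℂ → ℂ}

theorem const (c : ℂ) : Bdd l fun _ => c := ⟨‖c‖, Eventually.of_forall fun _ => le_rfl⟩

theorem add (hf : Bdd l f) (hg : Bdd l g) : Bdd l fun ρ => f ρ + g ρ := by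
  obtain ⟨C, hC⟩ := hf
  obtain ⟨D, hD⟩ := hg
  refine ⟨C + D, ?_⟩
  filter_upwards [hC, hD] with ρ h1 h2
  exact (norm_add_le _ _).trans (add_le_add h1 h2)

theorem mul (hf : Bdd l f) (hg : Bdd l g) : Bdd l fun ρ => f ρ * g ρ := by
  obtain ⟨C, hC⟩ := hf
  obtain ⟨D, hD⟩ := hg
  refine ⟨C * D, ?_⟩
  filter_upwards [hC, hD] with ρ h1 h2
  rw [norm_mul]
  exact mul_le_mul h1 h2 (norm_nonneg _) ((norm_nonneg _).trans h1)

theorem sum {ι : Type*} (s : Finset ι) {f : ι → ℂ → ℂ} (h : ∀ i ∈ s, Bdd l (f i)) :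
    Bdd l fun ρ => ∑ i ∈ s, f i ρ := by
  classical
  induction s using Finset.induction_on with
  | empty => simpa using const (l := l) 0
  | insert a s ha ih =>
    simp only [Finset.sum_insert ha]
    exact (h a (Finset.mem_insert_self a s)).add
      (ih fun i hi => h i (Finset.mem_insert_of_mem hi))

theorem prod {ι : Type*} (s : Finset ι) {f : ι → ℂ → ℂ} (h : ∀ i ∈ s, Bdd l (f i)) :
    Bdd l fun ρ => ∏ i ∈ s, f i ρ := by
  classical
  induction s using Finset.induction_on with
  | empty => simpa using const (l := l) 1
  | insert a s ha ih =>
    simp only [Finset.prod_insert ha]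
    exact (h a (Finset.mem_insert_self a s)).mul
      (ih fun i hi => h i (Finset.mem_insert_of_mem hi))

theorem congr (hf : Bdd l f) (h : ∀ᶠ ρ in l, f ρ = g ρ) : Bdd l g := by
  obtain ⟨C, hC⟩ := hf
  refine ⟨C, ?_⟩
  filter_upwards [hC, h] with ρ h1 h2
  rwa [← h2]

theorem of_tendsto_sub (h : Tendsto (fun ρ => f ρ - g ρ) l (𝓝 0)) (hg : Bdd l g) : Bdd l f := by
  have h1 : Bdd l fun ρ => f ρ - g ρ := by
    refine ⟨1, ?_⟩
    have := (tendsto_zero_iff_norm_tendsto_zero.1 h).eventually (gt_mem_nhds one_pos)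
    filter_upwards [this] with ρ hρ using hρ.le
  exact (h1.add hg).congr (Eventually.of_forall fun ρ => by ring)

theorem mul_tendsto_zero (hf : Bdd l f) (hg : Tendsto g l (𝓝 0)) :
    Tendsto (fun ρ => f ρ * g ρ) l (𝓝 0) := by
  obtain ⟨C, hC⟩ := hf
  have := (tendsto_zero_iff_norm_tendsto_zero.1 hg).const_mul C
  rw [mul_zero] at this
  refine squeeze_zero_norm' ?_ this
  filter_upwards [hC] with ρ h1
  rw [norm_mul]
  gcongr

theorem eventually_ne_of_tendsto_sub {c : ℝ} (hc : 0 < c)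
    (h : Tendsto (fun ρ => f ρ - g ρ) l (𝓝 0)) (hg : ∀ᶠ ρ in l, c ≤ ‖g ρ‖) :
    (∀ᶠ ρ in l, f ρ ≠ 0) ∧ Bdd l fun ρ => (f ρ)⁻¹ := by
  have h1 := (tendsto_zero_iff_norm_tendsto_zero.1 h).eventually (gt_mem_nhds (half_pos hc))
  have h2 : ∀ᶠ ρ in l, c / 2 ≤ ‖f ρ‖ := by
    filter_upwards [h1, hg] with ρ a b
    have := norm_le_norm_add_norm_sub (f ρ) (g ρ)
    linarith
  refine ⟨?_, (c / 2)⁻¹, ?_⟩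
  · filter_upwards [h2] with ρ a
    exact norm_pos_iff.1 ((half_pos hc).trans_le a)
  · filter_upwards [h2] with ρ a
    rw [norm_inv]
    exact inv_anti₀ (half_pos hc) a

/-- The difference of quotients equals `(f - f₀)/g - f₀ (g - g₀)/(g g₀)`, and both reciprocals stay
bounded. -/
theorem tendsto_div_sub {c : ℝ} (hc : 0 < c)
    (hf : Tendsto (fun ρ => f ρ - f₀ ρ) l (𝓝 0)) (hf₀ : Bdd l f₀)
    (hg : Tendsto (fun ρ => g ρ - g₀ ρ) l (𝓝 0)) (hg₀ : ∀ᶠ ρ in l, c ≤ ‖g₀ ρ‖) :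
    Tendsto (fun ρ => f ρ / g ρ - f₀ ρ / g₀ ρ) l (𝓝 0) := by
  obtain ⟨h1, h2⟩ := eventually_ne_of_tendsto_sub hc hg hg₀
  have h3 : Bdd l fun ρ => (g₀ ρ)⁻¹ := ⟨c⁻¹, by
    filter_upwards [hg₀] with ρ a
    rw [norm_inv]
    exact inv_anti₀ hc a⟩
  have t := (h2.mul_tendsto_zero hf).sub (((hf₀.mul h2).mul h3).mul_tendsto_zero hg)
  rw [sub_zero] at t
  refine t.congr' ?_
  filter_upwards [h1, hg₀] with ρ a b
  have : g₀ ρ ≠ 0 := norm_pos_iff.1 (hc.trans_le b)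
  field_simp
  ring

end Bdd

/-- Points of the half-plane `Im ρ ≥ τ` tending to infinity. -/
noncomputable def upHalf (τ : ℝ) : Filter ℂ := Bornology.cobounded ℂ ⊓ 𝓟 {ρ | τ ≤ ρ.im}

theorem eventually_upHalf_iff {τ : ℝ} {p : ℂ → Prop} :
    (∀ᶠ ρ in upHalf τ, p ρ) ↔ ∃ R : ℝ, ∀ ρ : ℂ, R ≤ ‖ρ‖ → τ ≤ ρ.im → p ρ := by
  rw [upHalf, eventually_inf_principal, hasBasis_cobounded_norm.eventually_iff]
  simp

theorem eventually_upHalf_le_im (τ : ℝ) : ∀ᶠ ρ in upHalf τ, τ ≤ ρ.im :=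
  eventually_upHalf_iff.2 ⟨0, fun _ _ h => h⟩

theorem eventually_upHalf_le_norm (τ R : ℝ) : ∀ᶠ ρ in upHalf τ, R ≤ ‖ρ‖ :=
  eventually_upHalf_iff.2 ⟨R, fun _ h _ => h⟩

theorem tendsto_of_norm_le_div {τ : ℝ} {f : ℂ → ℂ} {C R : ℝ}
    (h : ∀ ρ : ℂ, R ≤ ‖ρ‖ → τ ≤ ρ.im → ‖f ρ‖ ≤ C * ‖ρ‖⁻¹) : Tendsto f (upHalf τ) (𝓝 0) := by
  have t : Tendsto (fun ρ : ℂ => C * ‖ρ‖⁻¹) (upHalf τ) (𝓝 (C * 0)) :=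
    ((tendsto_inv_atTop_zero.comp tendsto_norm_cobounded_atTop).mono_left inf_le_left).const_mul C
  rw [mul_zero] at t
  exact squeeze_zero_norm' (eventually_upHalf_iff.2 ⟨R, h⟩) t

/-- The asymptotic bound covers the half-plane outside a disc; the part inside the disc is compact.
-/
theorem Bdd.exists_bound {τ : ℝ} {f : ℂ → ℂ} (hf : Bdd (upHalf τ) f)
    (hc : ContinuousOn f {ρ | τ ≤ ρ.im}) : ∃ C, 0 < C ∧ ∀ ρ : ℂ, τ ≤ ρ.im → ‖f ρ‖ ≤ C := by
  obtain ⟨C, hC⟩ := hf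
  obtain ⟨R, hR⟩ := eventually_upHalf_iff.1 hC
  have hK : IsCompact (Metric.closedBall (0 : ℂ) R ∩ {ρ | τ ≤ ρ.im}) :=
    (isCompact_closedBall 0 R).inter_right (isClosed_le continuous_const Complex.continuous_im)
  obtain ⟨D, hD⟩ := hK.exists_bound_of_continuousOn (hc.mono inter_subset_right)
  refine ⟨max (max C D) 1, by positivity, fun ρ hρ => ?_⟩
  rcases le_total R ‖ρ‖ with h | h
  · exact (hR ρ h hρ).trans (le_max_of_le_left (le_max_left _ _))
  · exact (hD ρ ⟨by simpa using h, hρ⟩).trans (le_max_of_le_left (le_max_right _ _))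

/-- The real part is `(1 - |z|²)/|1 - z|²`, and `|1 - z| ≤ 2`. This positivity is the source of the
lower bound for `Δ`. -/
theorem re_one_add_div_one_sub_ge {z : ℂ} (hz : ‖z‖ < 1) :
    (1 - ‖z‖ ^ 2) / 4 ≤ ((1 + z) / (1 - z)).re := by
  have h1 : (1 - z) ≠ 0 := fun h => by
    rw [← sub_eq_zero.1 h, norm_one] at hz; exact lt_irrefl _ hz
  have hz2 : ‖z‖ ^ 2 = z.re ^ 2 + z.im ^ 2 := by
    rw [← Complex.normSq_eq_norm_sq, Complex.normSq_apply]; ring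
  have hn : Complex.normSq (1 - z) = (1 - z.re) ^ 2 + z.im ^ 2 := by
    rw [Complex.normSq_apply]; simp; ring
  have hpos : 0 < Complex.normSq (1 - z) := Complex.normSq_pos.2 h1
  have e : ((1 + z) / (1 - z)).re = (1 - ‖z‖ ^ 2) / Complex.normSq (1 - z) := by
    rw [Complex.div_re, hz2, ← add_div]
    simp
    ring
  have h2 : ‖z‖ ^ 2 < 1 := by nlinarith [norm_nonneg z]
  rw [e]
  apply div_le_div_of_nonneg_left (by linarith) hpos
  rw [hn]
  rw [hz2] at h2
  nlinarith [sq_nonneg (1 + z.re), sq_nonneg z.im]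

/-! ### Leading terms and the lower bound for the characteristic function -/

namespace Problem

variable (P : Problem m)

/-- `exp(i ρ T_j)`. -/
noncomputable def expT (j : Fin (m + 1)) (ρ : ℂ) : ℂ := Complex.exp (Complex.I * ρ * P.T j)

/-- `S_j(T_j, ρ²)` normalized to be bounded in the upper half-plane. -/
noncomputable def normS (j : Fin (m + 1)) (ρ : ℂ) : ℂ := ρ * P.S j (P.T j) (ρ ^ 2) * P.expT j ρ

/-- `S_j'(T_j, ρ²)` normalized to be bounded in the upper half-plane. -/
noncomputable def normDS (j : Fin (m + 1)) (ρ : ℂ) : ℂ := P.dS j (P.T j) (ρ ^ 2) * P.expT j ρ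

/-- `C_j(T_j, ρ²)` normalized to be bounded in the upper half-plane. -/
noncomputable def normC (j : Fin (m + 1)) (ρ : ℂ) : ℂ := P.C j (P.T j) (ρ ^ 2) * P.expT j ρ

/-- `C_j'(T_j, ρ²)` normalized to be bounded in the upper half-plane. -/
noncomputable def normDC (j : Fin (m + 1)) (ρ : ℂ) : ℂ :=
  P.dC j (P.T j) (ρ ^ 2) / ρ * P.expT j ρ

/-- The leading part of `normS`. -/
noncomputable def leadSin (j : Fin (m + 1)) (ρ : ℂ) : ℂ := Complex.I * (1 - P.expT j ρ ^ 2) / 2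

/-- The leading part of `normC`. -/
noncomputable def leadCos (j : Fin (m + 1)) (ρ : ℂ) : ℂ := (1 + P.expT j ρ ^ 2) / 2

theorem norm_expT (j : Fin (m + 1)) (ρ : ℂ) : ‖P.expT j ρ‖ = Real.exp (-(ρ.im * P.T j)) := by
  rw [expT, Complex.norm_exp]
  simp

theorem exp_neg_mul_expT (j : Fin (m + 1)) (ρ : ℂ) :
    Complex.exp (-(ρ * P.T j) * Complex.I) * P.expT j ρ = 1 := by
  rw [expT, ← Complex.exp_add, ← Complex.exp_zero]
  congr 1; ring

theorem sin_mul_expT (j : Fin (m + 1)) (ρ : ℂ) :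
    Complex.sin (ρ * P.T j) * P.expT j ρ = P.leadSin j ρ := by
  have h := P.exp_neg_mul_expT j ρ
  have e : Complex.exp (ρ * P.T j * Complex.I) = P.expT j ρ := by
    rw [expT]; congr 1; ring
  rw [Complex.sin, leadSin, e]
  linear_combination Complex.I / 2 * h

theorem cos_mul_expT (j : Fin (m + 1)) (ρ : ℂ) :
    Complex.cos (ρ * P.T j) * P.expT j ρ = P.leadCos j ρ := by
  have h := P.exp_neg_mul_expT j ρ
  have e : Complex.exp (ρ * P.T j * Complex.I) = P.expT j ρ := by
    rw [expT]; congr 1; ring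
  rw [Complex.cos, leadCos, e]
  linear_combination 1 / 2 * h

theorem norm_le_of_exp_mul (j : Fin (m + 1)) {ρ z : ℂ} (hρ : 0 ≤ ρ.im) {M : ℝ}
    (h : ‖z‖ ≤ M * Real.exp (|ρ.im| * P.T j)) : ‖z * P.expT j ρ‖ ≤ M := by
  rw [norm_mul, norm_expT]
  rw [abs_of_nonneg hρ] at h
  calc _ ≤ M * Real.exp (ρ.im * P.T j) * Real.exp (-(ρ.im * P.T j)) := by gcongr
    _ = M := by rw [mul_assoc, ← Real.exp_add, add_neg_cancel, Real.exp_zero, mul_one]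

theorem tendsto_norm_sub (j : Fin (m + 1)) {τ : ℝ} (hτ : 0 ≤ τ) :
    Tendsto (fun ρ => P.normS j ρ - P.leadSin j ρ) (upHalf τ) (𝓝 0) ∧
    Tendsto (fun ρ => P.normDS j ρ - P.leadCos j ρ) (upHalf τ) (𝓝 0) ∧
    Tendsto (fun ρ => P.normC j ρ - P.leadCos j ρ) (upHalf τ) (𝓝 0) ∧
    Tendsto (fun ρ => P.normDC j ρ - -P.leadSin j ρ) (upHalf τ) (𝓝 0) := by
  set Q := ∫ t in (0 : ℝ)..P.T j, ‖P.qc j t‖ with hQd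
  have hQ0 : 0 ≤ Q := intervalIntegral.integral_nonneg (P.T_pos j).le fun _ _ => norm_nonneg _
  have hx : P.T j ∈ Icc 0 (P.T j) := ⟨(P.T_pos j).le, le_rfl⟩
  have hq := P.intervalIntegrable_qc j
  have key : ∀ ρ : ℂ, 2 * Q + 1 ≤ ‖ρ‖ → τ ≤ ρ.im →
      ‖P.normS j ρ - P.leadSin j ρ‖ ≤ 2 * Q * ‖ρ‖⁻¹ ∧
      ‖P.normDS j ρ - P.leadCos j ρ‖ ≤ 2 * Q * ‖ρ‖⁻¹ ∧
      ‖P.normC j ρ - P.leadCos j ρ‖ ≤ 2 * Q * ‖ρ‖⁻¹ ∧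
      ‖P.normDC j ρ - -P.leadSin j ρ‖ ≤ 2 * Q * ‖ρ‖⁻¹ := by
    intro ρ hR him
    have hne : ρ ≠ 0 := norm_pos_iff.1 (by linarith)
    have hpos : 0 < ‖ρ‖ := norm_pos_iff.2 hne
    have him' := hτ.trans him
    have hQ : 2 * Q ≤ ‖ρ‖ := by linarith
    obtain ⟨s1, s2, s3⟩ := P.S_spec j (ρ ^ 2)
    obtain ⟨c1, c2, c3⟩ := P.C_spec j (ρ ^ 2)
    have a1 := s1.norm_sub_free_le hq hne hQ hx
    have a2 := s1.norm_deriv_sub_free_le hq hne hQ hx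
    have a3 := c1.norm_sub_free_le hq hne hQ hx
    have a4 := c1.norm_deriv_sub_free_le hq hne hQ hx
    rw [s2, s3] at a1 a2
    rw [c2, c3] at a3 a4
    simp only [norm_zero, norm_one, zero_add, zero_mul, one_mul, neg_zero, zero_div, add_zero]
      at a1 a2 a3 a4
    rw [← hQd] at a1 a2 a3 a4
    have b1 := P.norm_le_of_exp_mul j him' a1
    have b2 := P.norm_le_of_exp_mul j him' a2
    have b3 := P.norm_le_of_exp_mul j him' a3
    have b4 := P.norm_le_of_exp_mul j him' a4
    refine ⟨?_, ?_, ?_, ?_⟩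
    · rw [← P.sin_mul_expT, normS, show ρ * P.S j (P.T j) (ρ ^ 2) * P.expT j ρ -
        Complex.sin (ρ * P.T j) * P.expT j ρ = ρ * ((P.S j (P.T j) (ρ ^ 2) -
        Complex.sin (ρ * P.T j) / ρ) * P.expT j ρ) by field_simp, norm_mul]
      exact (mul_le_mul_of_nonneg_left b1 hpos.le).trans (le_of_eq (by field_simp))
    · rw [← P.cos_mul_expT, normDS, ← sub_mul]
      exact b2.trans (le_of_eq (by field_simp))
    · rw [← P.cos_mul_expT, normC, ← sub_mul]
      exact b3.trans (le_of_eq (by field_simp))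
    · rw [← P.sin_mul_expT, normDC, show P.dC j (P.T j) (ρ ^ 2) / ρ * P.expT j ρ -
        -(Complex.sin (ρ * P.T j) * P.expT j ρ) = ρ⁻¹ * ((P.dC j (P.T j) (ρ ^ 2) -
        -(ρ * Complex.sin (ρ * P.T j))) * P.expT j ρ) by field_simp, norm_mul, norm_inv]
      exact (mul_le_mul_of_nonneg_left b4 (inv_nonneg.2 hpos.le)).trans
        (le_of_eq (by field_simp))
  exact ⟨tendsto_of_norm_le_div fun ρ h h' => (key ρ h h').1,
    tendsto_of_norm_le_div fun ρ h h' => (key ρ h h').2.1,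
    tendsto_of_norm_le_div fun ρ h h' => (key ρ h h').2.2.1,
    tendsto_of_norm_le_div fun ρ h h' => (key ρ h h').2.2.2⟩

theorem norm_expT_le (j : Fin (m + 1)) {τ : ℝ} {ρ : ℂ} (h : τ ≤ ρ.im) :
    ‖P.expT j ρ‖ ≤ Real.exp (-(τ * P.T j)) := by
  rw [norm_expT]
  have := (P.T_pos j).le
  gcongr

theorem exp_lt_one (j : Fin (m + 1)) {τ : ℝ} (hτ : 0 < τ) : Real.exp (-(τ * P.T j)) < 1 := by
  rw [Real.exp_lt_one_iff]
  have := mul_pos hτ (P.T_pos j)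
  linarith

theorem bdd_expT (j : Fin (m + 1)) {τ : ℝ} (hτ : 0 < τ) : Bdd (upHalf τ) (P.expT j) :=
  ⟨1, by
    filter_upwards [eventually_upHalf_le_im τ] with ρ h
    exact (P.norm_expT_le j h).trans (P.exp_lt_one j hτ).le⟩

theorem bdd_leadSin (j : Fin (m + 1)) {τ : ℝ} (hτ : 0 < τ) : Bdd (upHalf τ) (P.leadSin j) :=
  ((((Bdd.const 1).add ((Bdd.const (-1)).mul ((P.bdd_expT j hτ).mul (P.bdd_expT j hτ)))).mul
    (Bdd.const (Complex.I / 2)))).congr (Eventually.of_forall fun ρ => by rw [leadSin]; ring)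

theorem bdd_leadCos (j : Fin (m + 1)) {τ : ℝ} (hτ : 0 < τ) : Bdd (upHalf τ) (P.leadCos j) :=
  (((Bdd.const 1).add ((P.bdd_expT j hτ).mul (P.bdd_expT j hτ))).mul
    (Bdd.const (1 / 2))).congr (Eventually.of_forall fun ρ => by rw [leadCos]; ring)

theorem exists_le_norm_leadSin (j : Fin (m + 1)) {τ : ℝ} (hτ : 0 < τ) :
    ∃ c, 0 < c ∧ ∀ᶠ ρ in upHalf τ, c ≤ ‖P.leadSin j ρ‖ := by
  have h1 := P.exp_lt_one j hτ
  have h0 := Real.exp_pos (-(τ * P.T j))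
  refine ⟨(1 - Real.exp (-(τ * P.T j)) ^ 2) / 2, by nlinarith, ?_⟩
  filter_upwards [eventually_upHalf_le_im τ] with ρ h
  have h2 := P.norm_expT_le j h
  have h3 : ‖P.expT j ρ ^ 2‖ ≤ Real.exp (-(τ * P.T j)) ^ 2 := by rw [norm_pow]; gcongr
  have h4 := norm_sub_norm_le (1 : ℂ) (P.expT j ρ ^ 2)
  rw [norm_one] at h4
  rw [leadSin, norm_div, norm_mul, Complex.norm_I, one_mul, Complex.norm_two]
  linarith

/-- The leading part of `Δ` divided by the product of all sines. -/
noncomputable def leadQuot (ρ : ℂ) : ℂ :=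
  (P.a * P.leadCos 0 ρ + (P.a : ℂ)⁻¹ * P.leadCos 0 ρ - 2 * P.expT 0 ρ) / P.leadSin 0 ρ +
    P.a * ∑ r : Fin m, P.leadCos r.succ ρ / P.leadSin r.succ ρ

theorem exists_le_norm_leadQuot {τ : ℝ} (hτ : 0 < τ) :
    ∃ c, 0 < c ∧ ∀ᶠ ρ in upHalf τ, c ≤ ‖P.leadQuot ρ‖ := by
  have ha := P.a_ne_zero
  have hac : (P.a : ℂ) ≠ 0 := Complex.ofReal_ne_zero.2 ha
  have hE := P.exp_lt_one 0 hτ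
  have hE0 := Real.exp_pos (-(τ * P.T 0))
  set E := Real.exp (-(τ * P.T 0))
  -- Only the two loop terms of the identity below are used; their coefficients `(a ∓ 1)²/2` add up
  -- to `a² + 1`.
  refine ⟨(P.a ^ 2 + 1) * ((1 - E ^ 2) / 4) / |P.a|, ?_, ?_⟩
  · have : 0 < 1 - E ^ 2 := by nlinarith
    positivity
  filter_upwards [eventually_upHalf_le_im τ] with ρ h
  have lt1 : ∀ j, ‖P.expT j ρ‖ < 1 := fun j => (P.norm_expT_le j h).trans_lt (P.exp_lt_one j hτ)
  have ne1 : ∀ z : ℂ, ‖z‖ < 1 → 1 - z ≠ 0 := fun z hz h => by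
    rw [← sub_eq_zero.1 h, norm_one] at hz; exact lt_irrefl _ hz
  set e := P.expT 0 ρ with he
  have n1 : 1 - e ≠ 0 := ne1 _ (lt1 0)
  have n2 : 1 + e ≠ 0 := by
    have := ne1 (-e) (by rw [norm_neg]; exact lt1 0)
    rwa [sub_neg_eq_add] at this
  -- Partial fractions in `e = exp(iρT₀)`: every summand is a nonnegative multiple of some `(1 +
  -- z)/(1 - z)` with `|z| < 1`, so no cancellation between the loop and the edges can occur,
  -- whatever the lengths and the sign of `a`.
  have id1 : Complex.I * P.a * P.leadQuot ρ =
      ((P.a - 1) ^ 2 / 2 : ℝ) * ((1 + e) / (1 - e)) + ((P.a + 1) ^ 2 / 2 : ℝ) *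
        ((1 + -e) / (1 - -e)) +
      ∑ r : Fin m, (P.a ^ 2 : ℝ) * ((1 + P.expT r.succ ρ ^ 2) / (1 - P.expT r.succ ρ ^ 2)) := by
    rw [leadQuot, mul_add]
    congr 1
    · rw [leadCos, leadSin, ← he, show 1 - e ^ 2 = (1 - e) * (1 + e) by ring]
      push_cast
      have hI := Complex.I_ne_zero
      rw [sub_neg_eq_add]
      field_simp
      ring_nf
    · rw [Finset.mul_sum, Finset.mul_sum]
      refine Finset.sum_congr rfl fun r _ => ?_
      rw [leadCos, leadSin]
      have n3 : 1 - P.expT r.succ ρ ^ 2 ≠ 0 := ne1 _ (by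
        rw [norm_pow]; exact pow_lt_one₀ (norm_nonneg _) (lt1 _) two_ne_zero)
      have hI := Complex.I_ne_zero
      push_cast
      field_simp
  have r0 : (1 - E ^ 2) / 4 ≤ (1 - ‖e‖ ^ 2) / 4 := by
    have := P.norm_expT_le 0 h
    gcongr
  have r1 := re_one_add_div_one_sub_ge (lt1 0)
  have r2 := re_one_add_div_one_sub_ge (z := -e) (by rw [norm_neg]; exact lt1 0)
  rw [norm_neg] at r2
  have r3 : ∀ r : Fin m, 0 ≤ (((P.a ^ 2 : ℝ) : ℂ) *
      ((1 + P.expT r.succ ρ ^ 2) / (1 - P.expT r.succ ρ ^ 2))).re := fun r => by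
    rw [Complex.re_ofReal_mul]
    have l : ‖P.expT r.succ ρ ^ 2‖ < 1 := by
      rw [norm_pow]; exact pow_lt_one₀ (norm_nonneg _) (lt1 _) two_ne_zero
    have l2 : ‖P.expT r.succ ρ ^ 2‖ ^ 2 ≤ 1 := pow_le_one₀ (norm_nonneg _) l.le
    have := re_one_add_div_one_sub_ge l
    exact mul_nonneg (sq_nonneg _) (le_trans (by linarith) this)
  have id2 := congrArg Complex.re id1
  rw [Complex.add_re, Complex.add_re, Complex.re_ofReal_mul, Complex.re_ofReal_mul,
    Complex.re_sum] at id2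
  have r4 := Finset.sum_nonneg fun (r : Fin m) (_ : r ∈ Finset.univ) => r3 r
  have r5 : (P.a ^ 2 + 1) * ((1 - E ^ 2) / 4) ≤ (Complex.I * P.a * P.leadQuot ρ).re := by
    rw [id2]
    have m1 := mul_le_mul_of_nonneg_left (r0.trans r1) (by positivity : 0 ≤ (P.a - 1) ^ 2 / 2)
    have m2 := mul_le_mul_of_nonneg_left (r0.trans r2) (by positivity : 0 ≤ (P.a + 1) ^ 2 / 2)
    linarith
  have r6 := r5.trans (Complex.re_le_norm _)
  rw [norm_mul, norm_mul, Complex.norm_I, one_mul, Complex.norm_real, Real.norm_eq_abs] at r6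
  rw [div_le_iff₀ (abs_pos.2 ha)]
  linarith

end Problem

/-! ### Normalized characteristic functions and their bounds -/

namespace Problem

variable (P : Problem m)

theorem differentiable_S (j : Fin (m + 1)) {x : ℝ} (hx : x ∈ Icc 0 (P.T j)) :
    Differentiable ℂ (P.S j x) := by
  have h := differentiable_ext_apply (P.T_pos j).le
    (differentiable_solFun (P.T_pos j).le (P.intervalIntegrable_qc j) 0 1) x
  convert h using 1
  exact funext fun lam => cauchySolution_fst _ _ lam 0 1 hx

theorem differentiable_dS (j : Fin (m + 1)) {x : ℝ} (hx : x ∈ Icc 0 (P.T j)) :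
    Differentiable ℂ (P.dS j x) := by
  have h := differentiable_ext_apply (P.T_pos j).le
    (differentiable_dsolFun (P.T_pos j).le (P.intervalIntegrable_qc j) 0 1) x
  convert h using 1
  exact funext fun lam => cauchySolution_snd _ _ lam 0 1 hx

theorem differentiable_C (j : Fin (m + 1)) {x : ℝ} (hx : x ∈ Icc 0 (P.T j)) :
    Differentiable ℂ (P.C j x) := by
  have h := differentiable_ext_apply (P.T_pos j).le
    (differentiable_solFun (P.T_pos j).le (P.intervalIntegrable_qc j) 1 0) x
  convert h using 1
  exact funext fun lam => cauchySolution_fst _ _ lam 1 0 hx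

theorem differentiable_dC (j : Fin (m + 1)) {x : ℝ} (hx : x ∈ Icc 0 (P.T j)) :
    Differentiable ℂ (P.dC j x) := by
  have h := differentiable_ext_apply (P.T_pos j).le
    (differentiable_dsolFun (P.T_pos j).le (P.intervalIntegrable_qc j) 1 0) x
  convert h using 1
  exact funext fun lam => cauchySolution_snd _ _ lam 1 0 hx

theorem T_mem (j : Fin (m + 1)) : P.T j ∈ Icc 0 (P.T j) := ⟨(P.T_pos j).le, le_rfl⟩

theorem differentiable_d : Differentiable ℂ P.d :=
  ((P.differentiable_C 0 (P.T_mem 0)).const_mul _).add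
    ((P.differentiable_dS 0 (P.T_mem 0)).const_mul _)

theorem differentiable_h : Differentiable ℂ P.h := P.differentiable_S 0 (P.T_mem 0)

theorem differentiable_sEnd (j : Fin m) : Differentiable ℂ (P.sEnd j) :=
  P.differentiable_S _ (P.T_mem _)

theorem differentiable_dsEnd (j : Fin m) : Differentiable ℂ (P.dsEnd j) :=
  P.differentiable_dS _ (P.T_mem _)

theorem differentiable_cEnd (j : Fin m) : Differentiable ℂ (P.cEnd j) :=
  P.differentiable_C _ (P.T_mem _)

theorem differentiable_dcEnd (j : Fin m) : Differentiable ℂ (P.dcEnd j) :=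
  P.differentiable_dC _ (P.T_mem _)

theorem differentiable_prod_sEnd (s : Finset (Fin m)) :
    Differentiable ℂ fun lam => ∏ j ∈ s, P.sEnd j lam :=
  Differentiable.fun_finsetProd fun j _ => P.differentiable_sEnd j

theorem differentiable_Delta : Differentiable ℂ P.Delta :=
  ((P.differentiable_d.sub_const 2).mul (P.differentiable_prod_sEnd _)).add
    ((P.differentiable_h.const_mul _).mul (Differentiable.fun_sum fun r _ =>
      (P.differentiable_dsEnd r).mul (P.differentiable_prod_sEnd _)))

theorem differentiable_DeltaEdge (k : Fin m) : Differentiable ℂ (P.DeltaEdge k) :=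
  ((P.differentiable_d.sub_const 2).mul
    ((P.differentiable_cEnd k).mul (P.differentiable_prod_sEnd _))).add
    ((P.differentiable_h.const_mul _).mul
      (((P.differentiable_dcEnd k).mul (P.differentiable_prod_sEnd _)).add
        ((P.differentiable_cEnd k).mul (Differentiable.fun_sum fun r _ =>
          (P.differentiable_dsEnd r).mul (P.differentiable_prod_sEnd _)))))

/-- `exp(i ρ 𝐓)`. -/
noncomputable def totalExp (ρ : ℂ) : ℂ := Complex.exp (Complex.I * ρ * P.totalLength)

theorem totalExp_ne_zero (ρ : ℂ) : P.totalExp ρ ≠ 0 := Complex.exp_ne_zero _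

theorem totalExp_eq (ρ : ℂ) : P.totalExp ρ = P.expT 0 ρ * ∏ j : Fin m, P.expT j.succ ρ := by
  simp only [totalExp, totalLength, expT]
  rw [← Complex.exp_sum, ← Complex.exp_add, Fin.sum_univ_succ]
  push_cast
  rw [mul_add, Finset.mul_sum]

/-- `d(ρ²) - 2` normalized to be bounded in the upper half-plane. -/
noncomputable def normD (ρ : ℂ) : ℂ :=
  P.a * P.normC 0 ρ + (P.a : ℂ)⁻¹ * P.normDS 0 ρ - 2 * P.expT 0 ρ

theorem normD_eq (ρ : ℂ) : P.normD ρ = (P.d (ρ ^ 2) - 2) * P.expT 0 ρ := by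
  rw [normD, d, normC, normDS]; ring

theorem prod_normS (s : Finset (Fin m)) (ρ : ℂ) : ∏ j ∈ s, P.normS j.succ ρ =
    (∏ _j ∈ s, ρ) * (∏ j ∈ s, P.sEnd j (ρ ^ 2)) * ∏ j ∈ s, P.expT j.succ ρ := by
  rw [← Finset.prod_mul_distrib, ← Finset.prod_mul_distrib]
  rfl

/-- `Δ(ρ²)` normalized to be bounded in the upper half-plane. -/
noncomputable def normDelta (ρ : ℂ) : ℂ := ρ ^ m * P.Delta (ρ ^ 2) * P.totalExp ρ

/-- `Δ_k(ρ²)` normalized to be bounded in the upper half-plane. -/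
noncomputable def normDeltaEdge (k : Fin m) (ρ : ℂ) : ℂ :=
  ρ ^ m * P.DeltaEdge k (ρ ^ 2) * P.totalExp ρ / ρ

theorem mul_prod_erase_const (r : Fin m) (ρ : ℂ) : ρ * ∏ _j ∈ Finset.univ.erase r, ρ = ρ ^ m := by
  rw [Finset.mul_prod_erase Finset.univ (fun _ => ρ) (Finset.mem_univ r)]
  simp

theorem normDelta_eq (ρ : ℂ) : P.normDelta ρ = P.normD ρ * ∏ j : Fin m, P.normS j.succ ρ +
    P.a * P.normS 0 ρ * ∑ r : Fin m, P.normDS r.succ ρ *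
      ∏ j ∈ Finset.univ.erase r, P.normS j.succ ρ := by
  rw [normDelta, Delta, mul_add, add_mul]
  congr 1
  · rw [prod_normS, normD_eq, totalExp_eq, DeltaPi]
    simp only [Finset.prod_const, Finset.card_univ, Fintype.card_fin]
    ring
  · rw [DeltaK, Finset.mul_sum, Finset.mul_sum, Finset.mul_sum, Finset.sum_mul]
    refine Finset.sum_congr rfl fun r _ => ?_
    rw [prod_normS, ← mul_prod_erase_const r ρ, totalExp_eq,
      ← Finset.mul_prod_erase Finset.univ (fun j : Fin m => P.expT j.succ ρ) (Finset.mem_univ r),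
      normS, normDS, dsEnd, h]
    ring

/-- The role of `S_k` is taken by `C_k`, which is larger by one power of `ρ`; the division by `ρ` in
`normDeltaEdge` compensates for it, and all factors on the right are bounded. -/
theorem normDeltaEdge_eq (k : Fin m) {ρ : ℂ} (hρ : ρ ≠ 0) : P.normDeltaEdge k ρ =
    P.normD ρ * P.normC k.succ ρ * ∏ j ∈ Finset.univ.erase k, P.normS j.succ ρ +
    P.a * P.normS 0 ρ * (P.normDC k.succ ρ * ∏ j ∈ Finset.univ.erase k, P.normS j.succ ρ +
      P.normC k.succ ρ * ∑ r ∈ Finset.univ.erase k, P.normDS r.succ ρ *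
        ∏ j ∈ (Finset.univ.erase k).erase r, P.normS j.succ ρ) := by
  have e1 : P.normC k.succ ρ * ∑ r ∈ Finset.univ.erase k, P.normDS r.succ ρ *
        (∏ j ∈ (Finset.univ.erase k).erase r, P.normS j.succ ρ) * ρ =
      P.cEnd k (ρ ^ 2) * (∏ _j ∈ Finset.univ.erase k, ρ) * (∏ j : Fin m, P.expT j.succ ρ) *
        ∑ r ∈ Finset.univ.erase k, P.dsEnd r (ρ ^ 2) *
          ∏ j ∈ (Finset.univ.erase k).erase r, P.sEnd j (ρ ^ 2) := by
    rw [Finset.mul_sum, Finset.mul_sum]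
    refine Finset.sum_congr rfl fun r hr => ?_
    rw [prod_normS, ← Finset.mul_prod_erase _ (fun _ => ρ) hr,
      ← Finset.mul_prod_erase Finset.univ (fun j : Fin m => P.expT j.succ ρ) (Finset.mem_univ k),
      ← Finset.mul_prod_erase _ (fun j : Fin m => P.expT j.succ ρ) hr, normC, normDS, cEnd, dsEnd]
    ring
  rw [← Finset.sum_mul] at e1
  rw [normDeltaEdge, div_eq_iff hρ, DeltaEdge, DeltaPiEdge, DeltaKEdge, prod_normS, normD_eq,
    ← mul_prod_erase_const k ρ, totalExp_eq]
  rw [← Finset.mul_prod_erase Finset.univ (fun j : Fin m => P.expT j.succ ρ)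
    (Finset.mem_univ k)] at e1 ⊢
  have e2 : P.normC k.succ ρ = P.cEnd k (ρ ^ 2) * P.expT k.succ ρ := rfl
  have e3 : P.normDC k.succ ρ * ρ = P.dcEnd k (ρ ^ 2) * P.expT k.succ ρ := by
    rw [normDC, dcEnd]; field_simp
  have e4 : P.normS 0 ρ = ρ * P.h (ρ ^ 2) * P.expT 0 ρ := rfl
  rw [e2] at e1 ⊢
  rw [e4]
  linear_combination -(P.a * (ρ * P.h (ρ ^ 2) * P.expT 0 ρ)) * (e1 +
    ((∏ _j ∈ Finset.univ.erase k, ρ) * (∏ j ∈ Finset.univ.erase k, P.sEnd j (ρ ^ 2)) *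
      ∏ j ∈ Finset.univ.erase k, P.expT j.succ ρ) * e3)

section Bounds

variable {τ : ℝ} (hτ : 0 < τ)
include hτ

theorem bdd_normS (j : Fin (m + 1)) : Bdd (upHalf τ) (P.normS j) :=
  Bdd.of_tendsto_sub (P.tendsto_norm_sub j hτ.le).1 (P.bdd_leadSin j hτ)

theorem bdd_normDS (j : Fin (m + 1)) : Bdd (upHalf τ) (P.normDS j) :=
  Bdd.of_tendsto_sub (P.tendsto_norm_sub j hτ.le).2.1 (P.bdd_leadCos j hτ)

theorem bdd_normC (j : Fin (m + 1)) : Bdd (upHalf τ) (P.normC j) :=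
  Bdd.of_tendsto_sub (P.tendsto_norm_sub j hτ.le).2.2.1 (P.bdd_leadCos j hτ)

theorem bdd_normDC (j : Fin (m + 1)) : Bdd (upHalf τ) (P.normDC j) :=
  Bdd.of_tendsto_sub (P.tendsto_norm_sub j hτ.le).2.2.2
    (((Bdd.const (-1)).mul (P.bdd_leadSin j hτ)).congr (Eventually.of_forall fun ρ => by ring))

theorem bdd_normD : Bdd (upHalf τ) P.normD :=
  ((((Bdd.const (P.a : ℂ)).mul (P.bdd_normC hτ 0)).add
    ((Bdd.const (P.a : ℂ)⁻¹).mul (P.bdd_normDS hτ 0))).add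
    ((Bdd.const (-2)).mul (P.bdd_expT 0 hτ))).congr
      (Eventually.of_forall fun ρ => by rw [normD]; ring)

theorem bdd_normDeltaEdge (k : Fin m) : Bdd (upHalf τ) (P.normDeltaEdge k) := by
  have hp := fun s : Finset (Fin m) =>
    Bdd.prod s (f := fun j => P.normS j.succ) fun j _ => P.bdd_normS hτ j.succ
  refine ((((P.bdd_normD hτ).mul (P.bdd_normC hτ k.succ)).mul (hp (Finset.univ.erase k))).add
    (((Bdd.const (P.a : ℂ)).mul (P.bdd_normS hτ 0)).mul
      (((P.bdd_normDC hτ k.succ).mul (hp (Finset.univ.erase k))).add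
        ((P.bdd_normC hτ k.succ).mul (Bdd.sum (Finset.univ.erase k)
          (f := fun r ρ => P.normDS r.succ ρ *
            ∏ j ∈ (Finset.univ.erase k).erase r, P.normS j.succ ρ)
          fun r _ => (P.bdd_normDS hτ r.succ).mul (hp _)))))).congr ?_
  filter_upwards [eventually_upHalf_le_norm τ 1] with ρ h
  exact (P.normDeltaEdge_eq k (norm_pos_iff.1 (one_pos.trans_le h))).symm

theorem normS_ne_zero (j : Fin (m + 1)) :
    (∀ᶠ ρ in upHalf τ, P.normS j ρ ≠ 0) ∧ Bdd (upHalf τ) fun ρ => (P.normS j ρ)⁻¹ := by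
  obtain ⟨c, hc, h⟩ := P.exists_le_norm_leadSin j hτ
  exact Bdd.eventually_ne_of_tendsto_sub hc (P.tendsto_norm_sub j hτ.le).1 h

theorem tendsto_quot_sub_leadQuot :
    Tendsto (fun ρ => P.normD ρ / P.normS 0 ρ + P.a * ∑ r : Fin m,
      P.normDS r.succ ρ / P.normS r.succ ρ - P.leadQuot ρ) (upHalf τ) (𝓝 0) := by
  have hD : Tendsto (fun ρ => P.normD ρ - (P.a * P.leadCos 0 ρ + (P.a : ℂ)⁻¹ * P.leadCos 0 ρ -
      2 * P.expT 0 ρ)) (upHalf τ) (𝓝 0) := by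
    have t := ((P.tendsto_norm_sub 0 hτ.le).2.2.1.const_mul (P.a : ℂ)).add
      ((P.tendsto_norm_sub 0 hτ.le).2.1.const_mul (P.a : ℂ)⁻¹)
    rw [mul_zero, mul_zero, add_zero] at t
    exact t.congr fun ρ => by rw [normD]; ring
  have hDb : Bdd (upHalf τ) fun ρ => P.a * P.leadCos 0 ρ + (P.a : ℂ)⁻¹ * P.leadCos 0 ρ -
      2 * P.expT 0 ρ :=
    ((((Bdd.const (P.a : ℂ)).mul (P.bdd_leadCos 0 hτ)).add
      ((Bdd.const (P.a : ℂ)⁻¹).mul (P.bdd_leadCos 0 hτ))).add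
      ((Bdd.const (-2)).mul (P.bdd_expT 0 hτ))).congr (Eventually.of_forall fun ρ => by ring)
  obtain ⟨c, hc, h⟩ := P.exists_le_norm_leadSin 0 hτ
  have t1 := Bdd.tendsto_div_sub hc hD hDb (P.tendsto_norm_sub 0 hτ.le).1 h
  have t2 : Tendsto (fun ρ => ∑ r : Fin m, (P.normDS r.succ ρ / P.normS r.succ ρ -
      P.leadCos r.succ ρ / P.leadSin r.succ ρ)) (upHalf τ) (𝓝 (∑ r : Fin m, 0)) :=
    tendsto_finsetSum _ fun r _ => by
      obtain ⟨c, hc, h⟩ := P.exists_le_norm_leadSin r.succ hτ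
      exact Bdd.tendsto_div_sub hc (P.tendsto_norm_sub r.succ hτ.le).2.1 (P.bdd_leadCos r.succ hτ)
        (P.tendsto_norm_sub r.succ hτ.le).1 h
  have t := t1.add (t2.const_mul (P.a : ℂ))
  simp only [Finset.sum_const_zero, mul_zero, add_zero] at t
  refine t.congr fun ρ => ?_
  rw [leadQuot, Finset.sum_sub_distrib]
  ring

/-- Far out `normDelta` is the product of all normalized sines times a quotient asymptotic to
`leadQuot`, and each factor is bounded away from zero. -/
theorem normDelta_ne_zero :
    (∀ᶠ ρ in upHalf τ, P.normDelta ρ ≠ 0) ∧ Bdd (upHalf τ) fun ρ => (P.normDelta ρ)⁻¹ := by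
  obtain ⟨c, hc, h⟩ := P.exists_le_norm_leadQuot hτ
  obtain ⟨h1, h2⟩ := Bdd.eventually_ne_of_tendsto_sub hc (P.tendsto_quot_sub_leadQuot hτ) h
  have h3 : ∀ᶠ ρ in upHalf τ, ∀ j, P.normS j ρ ≠ 0 :=
    eventually_all.2 fun j => (P.normS_ne_zero hτ j).1
  have e : ∀ᶠ ρ in upHalf τ, P.normS 0 ρ * (∏ j : Fin m, P.normS j.succ ρ) *
      (P.normD ρ / P.normS 0 ρ + P.a * ∑ r : Fin m, P.normDS r.succ ρ / P.normS r.succ ρ) =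
      P.normDelta ρ := by
    filter_upwards [h3] with ρ hρ
    rw [normDelta_eq, mul_add]
    congr 1
    · field_simp [hρ 0]
    · have : ∑ r : Fin m, P.normDS r.succ ρ * ∏ j ∈ Finset.univ.erase r, P.normS j.succ ρ =
          (∏ j : Fin m, P.normS j.succ ρ) * ∑ r : Fin m, P.normDS r.succ ρ / P.normS r.succ ρ := by
        rw [Finset.mul_sum]
        refine Finset.sum_congr rfl fun r _ => ?_
        rw [← Finset.mul_prod_erase _ _ (Finset.mem_univ r)]
        field_simp [hρ r.succ]
      rw [this]; ring
  constructor
  · filter_upwards [h1, h3, e] with ρ a b c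
    rw [← c]
    exact mul_ne_zero (mul_ne_zero (b 0) (Finset.prod_ne_zero_iff.2 fun j _ => b j.succ)) a
  · refine (((P.normS_ne_zero hτ 0).2.mul (Bdd.prod Finset.univ
      (f := fun (j : Fin m) ρ => (P.normS j.succ ρ)⁻¹)
      fun j _ => (P.normS_ne_zero hτ j.succ).2)).mul h2).congr ?_
    filter_upwards [e] with ρ c
    rw [← c, Finset.prod_inv_distrib, mul_inv, mul_inv]

end Bounds

theorem continuous_totalExp : Continuous P.totalExp := by
  unfold totalExp; fun_prop

theorem continuous_normDelta : Continuous P.normDelta := by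
  have h1 := P.differentiable_Delta.continuous.comp (continuous_pow 2 : Continuous fun ρ : ℂ => ρ ^ 2)
  exact ((continuous_pow m).mul h1).mul P.continuous_totalExp

theorem normDelta_ne_zero_of_Delta {ρ : ℂ} (hρ : ρ ≠ 0) (h : P.Delta (ρ ^ 2) ≠ 0) :
    P.normDelta ρ ≠ 0 := mul_ne_zero (mul_ne_zero (pow_ne_zero _ hρ) h) (P.totalExp_ne_zero ρ)

theorem ne_zero_of_im {τ : ℝ} (hτ : 0 < τ) {ρ : ℂ} (h : τ ≤ ρ.im) : ρ ≠ 0 := fun h0 => by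
  rw [h0, Complex.zero_im] at h; exact absurd h hτ.not_ge

/-- If `Δ(ρ²)` has no zeros with `Im ρ ≥ τ`, then it is bounded from below there, and `Δ_k(ρ²)` is
bounded from above, in the normalized form. -/
theorem exists_Delta_bound {τ : ℝ} (hτ : 0 < τ) (h : ∀ ρ : ℂ, τ ≤ ρ.im → P.Delta (ρ ^ 2) ≠ 0)
    (k : Fin m) : ∃ B, 0 < B ∧ ∀ ρ : ℂ, τ ≤ ρ.im →
      ‖(P.normDelta ρ)⁻¹‖ ≤ B ∧ ‖P.normDeltaEdge k ρ‖ ≤ B := by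
  have h0 : ∀ ρ : ℂ, τ ≤ ρ.im → ρ ≠ 0 := fun ρ hρ => ne_zero_of_im hτ hρ
  obtain ⟨B1, p1, hB1⟩ := (P.normDelta_ne_zero hτ).2.exists_bound
    (P.continuous_normDelta.continuousOn.inv₀ fun ρ hρ =>
      P.normDelta_ne_zero_of_Delta (h0 ρ hρ) (h ρ hρ))
  have c2 := (P.differentiable_DeltaEdge k).continuous.comp
    (continuous_pow 2 : Continuous fun ρ : ℂ => ρ ^ 2)
  obtain ⟨B2, p2, hB2⟩ := (P.bdd_normDeltaEdge hτ k).exists_bound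
    ((((continuous_pow m).mul c2).mul P.continuous_totalExp).continuousOn.div continuousOn_id h0)
  exact ⟨max B1 B2, lt_max_of_lt_left p1, fun ρ hρ =>
    ⟨(hB1 ρ hρ).trans (le_max_left _ _), (hB2 ρ hρ).trans (le_max_right _ _)⟩⟩

/-- Provides a zero-free half-plane that depends on the problem alone; the constant in the final
estimate is computed on its boundary. -/
theorem exists_Delta_ne_zero : ∃ τ, 0 < τ ∧ ∀ ρ : ℂ, τ ≤ ρ.im → P.Delta (ρ ^ 2) ≠ 0 := by
  obtain ⟨R, hR⟩ := eventually_upHalf_iff.1 (P.normDelta_ne_zero one_pos).1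
  refine ⟨max R 1, by positivity, fun ρ hρ h0 => hR ρ ?_ ((le_max_right _ _).trans hρ) ?_⟩
  · exact ((le_max_left _ _).trans hρ).trans ((le_abs_self _).trans (Complex.abs_im_le_norm ρ))
  · rw [normDelta, h0, mul_zero, zero_mul]

theorem Delta_ne_zero_of_inside {τ : ℝ}
    (h : ∀ lam : ℂ, P.IsEigenvalue lam → InsideParabola τ lam) (ρ : ℂ) (hρ : τ ≤ ρ.im) :
    P.Delta (ρ ^ 2) ≠ 0 := fun h0 => by
  obtain ⟨z, hz, hi⟩ := h _ (P.isEigenvalue_of_Delta_eq_zero h0)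
  -- Both square roots of the eigenvalue have the same `|Im|`, so being inside the parabola does not
  -- depend on the root.
  rcases sq_eq_sq_iff_eq_or_eq_neg.1 hz with rfl | rfl
  · exact absurd (hρ.trans (le_abs_self _)) hi.not_ge
  · rw [Complex.neg_im, abs_neg] at hi
    exact absurd (hρ.trans (le_abs_self _)) hi.not_ge

end Problem

/-! ### Shifting the line of integration -/

/-- Shift of the line of integration for a function decaying at infinity. -/
theorem integral_linePoint_eq_of_le {f : ℂ → ℂ} {a b C R : ℝ} (hab : a ≤ b)
    (hd : ∀ ρ : ℂ, a ≤ ρ.im → ρ.im ≤ b → DifferentiableAt ℂ f ρ)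
    (hC : ∀ ρ : ℂ, R ≤ ‖ρ‖ → a ≤ ρ.im → ρ.im ≤ b → ‖f ρ‖ ≤ C / ‖ρ‖)
    (ha : Integrable fun σ : ℝ => f (linePoint a σ))
    (hb : Integrable fun σ : ℝ => f (linePoint b σ)) :
    ∫ σ : ℝ, f (linePoint a σ) = ∫ σ : ℝ, f (linePoint b σ) := by
  have rect : ∀ r : ℝ, (∫ x in (-r)..r, f (linePoint a x)) - (∫ x in (-r)..r, f (linePoint b x)) +
      Complex.I * (∫ y in a..b, f (linePoint y r)) -
      Complex.I * (∫ y in a..b, f (linePoint y (-r))) = 0 := fun r => by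
    have h := Complex.integral_boundary_rect_eq_zero_of_differentiableOn f ⟨-r, a⟩ ⟨r, b⟩
      fun ρ hρ => by
        have him := (Complex.mem_reProdIm.1 hρ).2
        rw [uIcc_of_le hab] at him
        exact (hd ρ him.1 him.2).differentiableWithinAt
    exact h
  -- The vertical sides have fixed length, so decay like `1/|ρ|` is enough for them to disappear.
  have vert : ∀ s : ℝ, |s| = 1 →
      Tendsto (fun r : ℝ => ∫ y in a..b, f (linePoint y (s * r))) atTop (𝓝 0) := fun s hs => by
    have t : Tendsto (fun r : ℝ => |C| * r⁻¹ * |b - a|) atTop (𝓝 (|C| * 0 * |b - a|)) :=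
      (tendsto_inv_atTop_zero.const_mul _).mul_const _
    rw [mul_zero, zero_mul] at t
    refine squeeze_zero_norm' ?_ t
    filter_upwards [eventually_ge_atTop R, eventually_gt_atTop 0] with r hR hr
    refine intervalIntegral.norm_integral_le_of_norm_le_const fun y hy => ?_
    rw [uIoc_of_le hab] at hy
    have hle : r ≤ ‖linePoint y (s * r)‖ := by
      have := abs_le_norm_linePoint y (s * r)
      rwa [abs_mul, hs, one_mul, abs_of_pos hr] at this
    refine (hC _ (hR.trans hle) (by rw [linePoint_im]; exact hy.1.le)
      (by rw [linePoint_im]; exact hy.2)).trans ?_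
    calc C / ‖linePoint y (s * r)‖ ≤ |C| / ‖linePoint y (s * r)‖ := by gcongr; exact le_abs_self C
      _ ≤ |C| / r := by gcongr
      _ = _ := div_eq_mul_inv _ _
  have v1 := vert 1 abs_one
  have v2 := vert (-1) (by simp)
  simp only [one_mul, neg_mul] at v1 v2
  have la := intervalIntegral_tendsto_integral ha tendsto_neg_atTop_atBot tendsto_id
  have lb := intervalIntegral_tendsto_integral hb tendsto_neg_atTop_atBot tendsto_id
  have t := ((la.sub lb).add (v1.const_mul Complex.I)).sub (v2.const_mul Complex.I)
  simp only [id, rect, mul_zero, add_zero, sub_zero] at t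
  exact sub_eq_zero.1 (tendsto_nhds_unique t tendsto_const_nhds)

theorem integral_linePoint_eq {f : ℂ → ℂ} {a b c C R : ℝ} (ha : a ≤ b) (hc : a ≤ c)
    (hd : ∀ ρ : ℂ, a ≤ ρ.im → DifferentiableAt ℂ f ρ)
    (hC : ∀ ρ : ℂ, R ≤ ‖ρ‖ → a ≤ ρ.im → ρ.im ≤ max b c → ‖f ρ‖ ≤ C / ‖ρ‖)
    (hb : Integrable fun σ : ℝ => f (linePoint b σ))
    (hc' : Integrable fun σ : ℝ => f (linePoint c σ)) :
    ∫ σ : ℝ, f (linePoint b σ) = ∫ σ : ℝ, f (linePoint c σ) := by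
  rcases le_total b c with h | h
  · exact integral_linePoint_eq_of_le h (fun ρ h1 _ => hd ρ (ha.trans h1))
      (fun ρ h0 h1 h2 => hC ρ h0 (ha.trans h1) (h2.trans (le_max_right _ _))) hb hc'
  · exact (integral_linePoint_eq_of_le h (fun ρ h1 _ => hd ρ (hc.trans h1))
      (fun ρ h0 h1 h2 => hC ρ h0 (hc.trans h1) (h2.trans (le_max_left _ _))) hc' hb).symm

/-! ### The perturbed Weyl function -/

namespace Problem

variable (P : Problem m)

theorem totalLength_pos : 0 < P.totalLength :=
  Finset.sum_pos (fun j _ => P.T_pos j) Finset.univ_nonempty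

theorem norm_totalExp (ρ : ℂ) : ‖P.totalExp ρ‖ = Real.exp (-(P.totalLength * ρ.im)) := by
  rw [totalExp, Complex.norm_exp]
  simp [mul_comm]

theorem exists_norm_S_le (j : Fin (m + 1)) (b : ℝ) : ∃ C R : ℝ, 0 < C ∧ 0 < R ∧ ∀ ρ : ℂ,
    R ≤ ‖ρ‖ → |ρ.im| ≤ b → ∀ x ∈ Icc 0 (P.T j), ‖ρ * P.S j x (ρ ^ 2)‖ ≤ C := by
  have hQ0 : 0 ≤ ∫ t in (0 : ℝ)..P.T j, ‖P.qc j t‖ :=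
    intervalIntegral.integral_nonneg (P.T_pos j).le fun _ _ => norm_nonneg _
  refine ⟨2 * Real.exp (b * P.T j), 2 * (∫ t in (0 : ℝ)..P.T j, ‖P.qc j t‖) + 1, by positivity,
    by positivity, fun ρ hR him x hx => ?_⟩
  have hpos : 0 < ‖ρ‖ := by linarith
  obtain ⟨s1, s2, s3⟩ := P.S_spec j (ρ ^ 2)
  have h := s1.norm_le (P.intervalIntegrable_qc j) (norm_pos_iff.1 hpos) (by linarith) hx
  rw [s2, s3, norm_zero, zero_add, norm_one] at h
  rw [norm_mul]
  have hb : 0 ≤ b := (abs_nonneg _).trans him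
  have hx0 := hx.1
  calc _ ≤ ‖ρ‖ * (2 * (1 / ‖ρ‖) * Real.exp (|ρ.im| * x)) := by gcongr
    _ = 2 * Real.exp (|ρ.im| * x) := by field_simp
    _ ≤ _ := by gcongr; exact hx.2

/-- The pair `D`, `Dk` is an admissible perturbation of `Δ`, `Δ_k`. -/
structure IsPerturbation (k : Fin m) (D Dk : ℂ → ℂ) : Prop where
  diff : Differentiable ℂ D
  diff_edge : Differentiable ℂ Dk
  pw : PaleyWiener P.totalLength fun ρ => ρ ^ (m + 1) * (P.Delta (ρ ^ 2) - D (ρ ^ 2))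
  pw_edge : PaleyWiener P.totalLength fun ρ => ρ ^ m * (P.DeltaEdge k (ρ ^ 2) - Dk (ρ ^ 2))
  fin : deviation P k D Dk ≠ ∞

/-- `M̂ = M_k - M̃`. -/
noncomputable def weylDiff (k : Fin m) (D Dk : ℂ → ℂ) (lam : ℂ) : ℂ :=
  P.weyl k lam - -(Dk lam / D lam)

/-- The identity is `M̂ = Δ_k (Δ - Δ̃)/(Δ Δ̃) - (Δ_k - Δ̃_k)/Δ̃`. The powers `ρ^{m+1}` and `ρ^m` in
the deviation are exactly those that leave bounded coefficients. -/
theorem weylDiff_eq {k : Fin m} {D Dk : ℂ → ℂ} {ρ : ℂ} (hρ : ρ ≠ 0) (h1 : P.Delta (ρ ^ 2) ≠ 0)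
    (h2 : D (ρ ^ 2) ≠ 0) : P.weylDiff k D Dk (ρ ^ 2) =
      P.normDeltaEdge k ρ * (P.normDelta ρ)⁻¹ * (ρ ^ m * D (ρ ^ 2) * P.totalExp ρ)⁻¹ *
        (ρ ^ (m + 1) * (P.Delta (ρ ^ 2) - D (ρ ^ 2)) * P.totalExp ρ) -
      (ρ ^ m * D (ρ ^ 2) * P.totalExp ρ)⁻¹ *
        (ρ ^ m * (P.DeltaEdge k (ρ ^ 2) - Dk (ρ ^ 2)) * P.totalExp ρ) := by
  have h3 := P.totalExp_ne_zero ρ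
  rw [weylDiff, weyl, normDeltaEdge, normDelta]
  field_simp
  ring

namespace IsPerturbation

variable {P} {k : Fin m} {D Dk : ℂ → ℂ} (h : P.IsPerturbation k D Dk)
include h

theorem norm_Delta_sub_le {ρ : ℂ} (hρ : 0 ≤ ρ.im) :
    ‖ρ ^ (m + 1) * (P.Delta (ρ ^ 2) - D (ρ ^ 2)) * P.totalExp ρ‖ ≤
      √(2 * P.totalLength) * (deviation P k D Dk).toReal := by
  have hle : eLpNorm (fun ρ : ℝ => (ρ : ℂ) ^ (m + 1) *
      (P.Delta ((ρ : ℂ) ^ 2) - D ((ρ : ℂ) ^ 2))) 2 volume ≤ deviation P k D Dk := le_self_add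
  have hn := PaleyWiener.norm_le P.totalLength_pos.le h.pw (ne_top_of_le_ne_top h.fin hle) ρ
  rw [norm_mul, norm_totalExp]
  rw [abs_of_nonneg hρ] at hn
  have hm := ENNReal.toReal_mono h.fin hle
  calc _ ≤ √(2 * P.totalLength) * (deviation P k D Dk).toReal *
        Real.exp (P.totalLength * ρ.im) * Real.exp (-(P.totalLength * ρ.im)) := by
        gcongr
        exact hn.trans (by gcongr)
    _ = _ := by rw [mul_assoc, ← Real.exp_add, add_neg_cancel, Real.exp_zero, mul_one]

theorem norm_DeltaEdge_sub_le {ρ : ℂ} (hρ : 0 ≤ ρ.im) :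
    ‖ρ ^ m * (P.DeltaEdge k (ρ ^ 2) - Dk (ρ ^ 2)) * P.totalExp ρ‖ ≤
      √(2 * P.totalLength) * (deviation P k D Dk).toReal := by
  have hle : eLpNorm (fun ρ : ℝ => (ρ : ℂ) ^ m *
      (P.DeltaEdge k ((ρ : ℂ) ^ 2) - Dk ((ρ : ℂ) ^ 2))) 2 volume ≤ deviation P k D Dk :=
    le_add_self
  have hn := PaleyWiener.norm_le P.totalLength_pos.le h.pw_edge (ne_top_of_le_ne_top h.fin hle) ρ
  rw [norm_mul, norm_totalExp]
  rw [abs_of_nonneg hρ] at hn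
  have hm := ENNReal.toReal_mono h.fin hle
  calc _ ≤ √(2 * P.totalLength) * (deviation P k D Dk).toReal *
        Real.exp (P.totalLength * ρ.im) * Real.exp (-(P.totalLength * ρ.im)) := by
        gcongr
        exact hn.trans (by gcongr)
    _ = _ := by rw [mul_assoc, ← Real.exp_add, add_neg_cancel, Real.exp_zero, mul_one]

section HalfPlane

variable {τ B : ℝ} (hτ : 0 < τ) (hΔ : ∀ ρ : ℂ, τ ≤ ρ.im → P.Delta (ρ ^ 2) ≠ 0) (hB0 : 0 < B)
  (hB : ∀ ρ : ℂ, τ ≤ ρ.im → ‖(P.normDelta ρ)⁻¹‖ ≤ B ∧ ‖P.normDeltaEdge k ρ‖ ≤ B)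
  (hδ : 2 * B * (√(2 * P.totalLength) * (deviation P k D Dk).toReal) ≤ τ)
include hτ hΔ hB0 hB hδ

/-- The extra power of `ρ` in the weight of `Δ - Δ̃` gives a factor `1/‖ρ‖ ≤ 1/τ`, so the smallness
condition keeps the perturbation below half of the lower bound `1/B`. -/
theorem perturbed_ne_zero {ρ : ℂ} (hρ : τ ≤ ρ.im) :
    D (ρ ^ 2) ≠ 0 ∧ ‖(ρ ^ m * D (ρ ^ 2) * P.totalExp ρ)⁻¹‖ ≤ 2 * B := by
  have h0 := ne_zero_of_im hτ hρ
  have hpos : τ ≤ ‖ρ‖ := hρ.trans ((le_abs_self _).trans (Complex.abs_im_le_norm ρ))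
  have e : P.normDelta ρ - ρ ^ m * D (ρ ^ 2) * P.totalExp ρ =
      (ρ ^ (m + 1) * (P.Delta (ρ ^ 2) - D (ρ ^ 2)) * P.totalExp ρ) / ρ := by
    rw [normDelta]; field_simp; ring
  have h1 : ‖P.normDelta ρ - ρ ^ m * D (ρ ^ 2) * P.totalExp ρ‖ ≤ (2 * B)⁻¹ := by
    rw [e, norm_div]
    have := h.norm_Delta_sub_le (hτ.le.trans hρ)
    calc _ ≤ √(2 * P.totalLength) * (deviation P k D Dk).toReal / τ := by gcongr
      _ ≤ _ := by
        rw [div_le_iff₀ hτ, inv_mul_eq_div, le_div_iff₀ (by positivity)]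
        linarith
  have h2 : B⁻¹ ≤ ‖P.normDelta ρ‖ := by
    have := (hB ρ hρ).1
    rw [norm_inv] at this
    exact inv_le_of_inv_le₀ (norm_pos_iff.2 (P.normDelta_ne_zero_of_Delta h0 (hΔ ρ hρ))) this
  have h3 : (2 * B)⁻¹ ≤ ‖ρ ^ m * D (ρ ^ 2) * P.totalExp ρ‖ := by
    have := norm_sub_norm_le (P.normDelta ρ) (ρ ^ m * D (ρ ^ 2) * P.totalExp ρ)
    have e : B⁻¹ = (2 * B)⁻¹ + (2 * B)⁻¹ := by field_simp; norm_num
    linarith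
  have h4 : 0 < (2 * B)⁻¹ := by positivity
  constructor
  · intro h5
    rw [h5, mul_zero, zero_mul, norm_zero] at h3
    linarith
  · rw [norm_inv]
    exact inv_le_of_inv_le₀ (by positivity) h3

theorem norm_weylDiff_le {ρ : ℂ} (hρ : τ ≤ ρ.im) : ‖P.weylDiff k D Dk (ρ ^ 2)‖ ≤
    (2 * B ^ 3 + 2 * B) * (‖ρ ^ (m + 1) * (P.Delta (ρ ^ 2) - D (ρ ^ 2)) * P.totalExp ρ‖ +
      ‖ρ ^ m * (P.DeltaEdge k (ρ ^ 2) - Dk (ρ ^ 2)) * P.totalExp ρ‖) := by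
  obtain ⟨h1, h2⟩ := h.perturbed_ne_zero hτ hΔ hB0 hB hδ hρ
  obtain ⟨h3, h4⟩ := hB ρ hρ
  rw [P.weylDiff_eq (ne_zero_of_im hτ hρ) (hΔ ρ hρ) h1]
  refine (norm_sub_le _ _).trans ?_
  rw [norm_mul, norm_mul, norm_mul, norm_mul (_⁻¹) (ρ ^ m * (_ - _) * _)]
  set u := ‖ρ ^ (m + 1) * (P.Delta (ρ ^ 2) - D (ρ ^ 2)) * P.totalExp ρ‖
  set v := ‖ρ ^ m * (P.DeltaEdge k (ρ ^ 2) - Dk (ρ ^ 2)) * P.totalExp ρ‖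
  have hu : 0 ≤ u := norm_nonneg _
  have hv : 0 ≤ v := norm_nonneg _
  have h5 : 0 ≤ 2 * B * u + 2 * B ^ 3 * v := by positivity
  calc _ ≤ B * B * (2 * B) * u + 2 * B * v := by gcongr
    _ ≤ _ := by linarith

/-- Boundedness is all the shift of the line requires, the decay coming from the two solutions; the
L₂ bound below gives the estimate. -/
theorem norm_weylDiff_le_const {ρ : ℂ} (hρ : τ ≤ ρ.im) : ‖P.weylDiff k D Dk (ρ ^ 2)‖ ≤
    (2 * B ^ 3 + 2 * B) * (2 * (√(2 * P.totalLength) * (deviation P k D Dk).toReal)) := by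
  refine (h.norm_weylDiff_le hτ hΔ hB0 hB hδ hρ).trans ?_
  have h1 := h.norm_Delta_sub_le (hτ.le.trans hρ)
  have h2 := h.norm_DeltaEdge_sub_le (hτ.le.trans hρ)
  gcongr
  linarith

theorem differentiableAt_weylDiff {ρ : ℂ} (hρ : τ ≤ ρ.im) :
    DifferentiableAt ℂ (fun ρ => P.weylDiff k D Dk (ρ ^ 2)) ρ := by
  have h1 := (h.perturbed_ne_zero hτ hΔ hB0 hB hδ hρ).1
  have hp : DifferentiableAt ℂ (fun ρ : ℂ => ρ ^ 2) ρ := differentiableAt_id.pow 2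
  have c : ∀ {g : ℂ → ℂ}, Differentiable ℂ g → DifferentiableAt ℂ (fun ρ : ℂ => g (ρ ^ 2)) ρ :=
    fun hg => (hg.differentiableAt (x := ρ ^ 2)).comp ρ hp
  exact ((c (P.differentiable_DeltaEdge k)).div (c P.differentiable_Delta) (hΔ ρ hρ)).neg.sub
    ((c h.diff_edge).div (c h.diff) h1).neg

theorem continuous_weylDiff_line {s : ℝ} (hs : τ ≤ s) :
    Continuous fun σ : ℝ => P.weylDiff k D Dk (linePoint s σ ^ 2) :=
  continuous_iff_continuousAt.2 fun σ => by
    have h1 := (h.differentiableAt_weylDiff hτ hΔ hB0 hB hδ (ρ := linePoint s σ)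
      (by rwa [linePoint_im])).continuousAt
    exact h1.comp (f := linePoint s) (continuous_linePoint s).continuousAt

/-- The `L₂`-norm of `M̂` on a line is controlled by the deviation. -/
theorem eLpNorm_weylDiff_le {s : ℝ} (hs : τ ≤ s) :
    eLpNorm (fun σ : ℝ => P.weylDiff k D Dk (linePoint s σ ^ 2)) 2 volume ≤
      ENNReal.ofReal ((2 * B ^ 3 + 2 * B) *
        (√(2 * Real.pi) * Real.exp (|s| * P.totalLength))) * deviation P k D Dk := by
  set g1 : ℝ → ℂ := fun σ => linePoint s σ ^ (m + 1) *
    (P.Delta (linePoint s σ ^ 2) - D (linePoint s σ ^ 2)) with hg1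
  set g2 : ℝ → ℂ := fun σ => linePoint s σ ^ m *
    (P.DeltaEdge k (linePoint s σ ^ 2) - Dk (linePoint s σ ^ 2)) with hg2
  have cl := continuous_linePoint s
  have c1 : Continuous g1 := (cl.pow _).mul
    ((P.differentiable_Delta.continuous.comp (cl.pow 2)).sub (h.diff.continuous.comp (cl.pow 2)))
  have c2 : Continuous g2 := (cl.pow _).mul (((P.differentiable_DeltaEdge k).continuous.comp
    (cl.pow 2)).sub (h.diff_edge.continuous.comp (cl.pow 2)))
  have b1 := PaleyWiener.eLpNorm_line_le P.totalLength_pos.le h.pw s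
  have b2 := PaleyWiener.eLpNorm_line_le P.totalLength_pos.le h.pw_edge s
  have he : ∀ σ, ‖P.totalExp (linePoint s σ)‖ ≤ 1 := fun σ => by
    rw [norm_totalExp, linePoint_im, Real.exp_le_one_iff]
    have := mul_pos P.totalLength_pos (hτ.trans_le hs)
    linarith
  have hb : ∀ σ : ℝ, ‖P.weylDiff k D Dk (linePoint s σ ^ 2)‖ ≤
      (2 * B ^ 3 + 2 * B) * ‖‖g1 σ‖ + ‖g2 σ‖‖ := fun σ => by
    refine (h.norm_weylDiff_le hτ hΔ hB0 hB hδ (by rwa [linePoint_im])).trans ?_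
    rw [Real.norm_of_nonneg (by positivity), norm_mul _ (P.totalExp _), norm_mul _ (P.totalExp _)]
    gcongr
    · exact mul_le_of_le_one_right (norm_nonneg _) (he σ)
    · exact mul_le_of_le_one_right (norm_nonneg _) (he σ)
  refine (eLpNorm_le_mul_eLpNorm_of_ae_le_mul (ae_of_all _ hb) 2).trans ?_
  rw [ENNReal.ofReal_mul (by positivity), mul_assoc]
  gcongr
  refine (eLpNorm_add_le c1.norm.aestronglyMeasurable c2.norm.aestronglyMeasurable
    (by norm_num)).trans ?_
  rw [eLpNorm_norm, eLpNorm_norm, deviation, mul_add]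
  exact add_le_add b1 b2

theorem memLp_weylDiff {s : ℝ} (hs : τ ≤ s) :
    MemLp (fun σ : ℝ => P.weylDiff k D Dk (linePoint s σ ^ 2)) 2 volume :=
  ⟨(h.continuous_weylDiff_line hτ hΔ hB0 hB hδ hs).aestronglyMeasurable,
    (h.eLpNorm_weylDiff_le hτ hΔ hB0 hB hδ hs).trans_lt
      (ENNReal.mul_lt_top ENNReal.ofReal_lt_top h.fin.lt_top)⟩

end HalfPlane

end IsPerturbation

end Problem

/-! ### The result for one edge -/

theorem SolvesGL.congr {F G : ℝ → ℝ → ℂ} {T x : ℝ} {κ : ℝ → ℂ} (hx : x ∈ Icc 0 T)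
    (hFG : ∀ s ∈ Icc 0 T, ∀ t ∈ Icc 0 T, F s t = G s t) (h : SolvesGL F x κ) : SolvesGL G x κ := by
  intro t ht
  have hi : ∫ s in (0 : ℝ)..x, κ s * G s t = ∫ s in (0 : ℝ)..x, κ s * F s t :=
    intervalIntegral.integral_congr fun s hs => by
      rw [uIcc_of_le hx.1] at hs
      rw [hFG s ⟨hs.1, hs.2.trans hx.2⟩ t ⟨ht.1, ht.2.trans hx.2⟩]
  rw [hi, ← hFG x hx t ⟨ht.1, ht.2.trans hx.2⟩]
  exact h t ht

theorem IsSLSolution.congr {q : ℝ → ℂ} {T : ℝ} {lam : ℂ} {y z dy : ℝ → ℂ} (hT : 0 ≤ T)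
    (h : IsSLSolution q T lam y dy) (hyz : ∀ x ∈ Icc 0 T, z x = y x) :
    IsSLSolution q T lam z dy where
  hasDeriv x hx := (h.hasDeriv x hx).congr hyz (hyz x hx)
  integrable := h.integrable.congr fun x hx => by
    rw [uIoc_of_le hT] at hx
    simp only [hyz x (Ioc_subset_Icc_self hx)]
  eqn x hx := by
    rw [h.eqn x hx]
    congr 1
    refine intervalIntegral.integral_congr fun t ht => ?_
    rw [uIcc_of_le hx.1] at ht
    simp only [hyz t ⟨ht.1, ht.2.trans hx.2⟩]

namespace Problem

variable (P : Problem m)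

theorem sSol_eq (j : Fin (m + 1)) {x : ℝ} (hx : x ∈ Icc 0 (P.T j)) (lam : ℂ) :
    sSol (P.T_pos j).le (P.intervalIntegrable_qc j) x lam = P.S j x lam := by
  rw [sSol]
  exact (cauchySolution_fst _ _ lam 0 1 hx).symm

theorem lineS_eq (j : Fin (m + 1)) {x : ℝ} (hx : x ∈ Icc 0 (P.T j)) (τ σ : ℝ) :
    lineS (P.T_pos j).le (P.intervalIntegrable_qc j) τ x σ = P.S j x (linePoint τ σ ^ 2) := by
  rw [lineS]
  exact P.sSol_eq j hx _

theorem parabolaIntegrand_eq (k : Fin m) (D Dk : ℂ → ℂ) {x t : ℝ} (hx : x ∈ Icc 0 (P.T k.succ))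
    (ht : t ∈ Icc 0 (P.T k.succ)) (τ σ : ℝ) :
    parabolaIntegrand τ (spectralKernel P k D Dk x t) σ =
      2 * (P.weylDiff k D Dk (linePoint τ σ ^ 2) * (linePoint τ σ *
        (lineS (P.T_pos k.succ).le (P.intervalIntegrable_qc k.succ) τ x σ *
          lineS (P.T_pos k.succ).le (P.intervalIntegrable_qc k.succ) τ t σ))) := by
  rw [P.lineS_eq _ hx, P.lineS_eq _ ht, parabolaIntegrand, spectralKernel, weylDiff]
  ring

namespace IsPerturbation

variable {P} {k : Fin m} {D Dk : ℂ → ℂ} (h : P.IsPerturbation k D Dk)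
include h

variable {τ B : ℝ} (hτ : 0 < τ) (hΔ : ∀ ρ : ℂ, τ ≤ ρ.im → P.Delta (ρ ^ 2) ≠ 0) (hB0 : 0 < B)
  (hB : ∀ ρ : ℂ, τ ≤ ρ.im → ‖(P.normDelta ρ)⁻¹‖ ≤ B ∧ ‖P.normDeltaEdge k ρ‖ ≤ B)
  (hδ : 2 * B * (√(2 * P.totalLength) * (deviation P k D Dk).toReal) ≤ τ)
include hτ hΔ hB0 hB hδ

theorem integrable_parabolaIntegrand {s : ℝ} (hs : τ ≤ s) {x t : ℝ} (hx : x ∈ Icc 0 (P.T k.succ))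
    (ht : t ∈ Icc 0 (P.T k.succ)) :
    Integrable (parabolaIntegrand s (spectralKernel P k D Dk x t)) := by
  have hs0 := hτ.trans_le hs
  obtain ⟨C, hC⟩ := exists_lineBounds (P.T_pos k.succ).le (P.intervalIntegrable_qc k.succ) hs0
  have hi := (integrable_kerF (P.T_pos k.succ).le (P.intervalIntegrable_qc k.succ) hs0 hC
    (h.memLp_weylDiff hτ hΔ hB0 hB hδ hs) x t).const_mul 2
  exact hi.congr (ae_of_all _ fun σ => (P.parabolaIntegrand_eq k D Dk hx ht s σ).symm)

theorem integral_parabolaIntegrand_eq {s s' : ℝ} (hs : τ ≤ s) (hs' : τ ≤ s') {x t : ℝ}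
    (hx : x ∈ Icc 0 (P.T k.succ)) (ht : t ∈ Icc 0 (P.T k.succ)) :
    ∫ σ, parabolaIntegrand s (spectralKernel P k D Dk x t) σ =
      ∫ σ, parabolaIntegrand s' (spectralKernel P k D Dk x t) σ := by
  obtain ⟨C, R, hC0, hR0, hC⟩ := P.exists_norm_S_le k.succ (max s s')
  set V := (2 * B ^ 3 + 2 * B) * (2 * (√(2 * P.totalLength) * (deviation P k D Dk).toReal)) with hV
  have hV0 : 0 ≤ V := by positivity
  set f : ℂ → ℂ := fun ρ => spectralKernel P k D Dk x t (ρ ^ 2) * (2 * ρ) with hf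
  have hp : ∀ ρ : ℂ, DifferentiableAt ℂ (fun ρ : ℂ => ρ ^ 2) ρ := fun ρ => differentiableAt_id.pow 2
  refine integral_linePoint_eq (f := f) (a := τ) (C := V * C * C * 2) (R := R) hs hs'
    (fun ρ hρ => ?_) (fun ρ hR h1 h2 => ?_)
    (h.integrable_parabolaIntegrand hτ hΔ hB0 hB hδ hs hx ht)
    (h.integrable_parabolaIntegrand hτ hΔ hB0 hB hδ hs' hx ht)
  · have d1 := h.differentiableAt_weylDiff hτ hΔ hB0 hB hδ hρ
    have d2 : DifferentiableAt ℂ (fun ρ : ℂ => P.S k.succ x (ρ ^ 2)) ρ :=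
      DifferentiableAt.comp (g := P.S k.succ x) ρ (P.differentiable_S k.succ hx _) (hp ρ)
    have d3 : DifferentiableAt ℂ (fun ρ : ℂ => P.S k.succ t (ρ ^ 2)) ρ :=
      DifferentiableAt.comp (g := P.S k.succ t) ρ (P.differentiable_S k.succ ht _) (hp ρ)
    exact ((d1.mul d2).mul d3).mul (differentiableAt_id.const_mul 2)
  · have hne := ne_zero_of_im hτ h1
    have him : |ρ.im| ≤ max s s' := by rwa [abs_of_nonneg (hτ.le.trans h1)]
    have b1 := h.norm_weylDiff_le_const hτ hΔ hB0 hB hδ h1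
    have b2 := hC ρ hR him x hx
    have b3 := hC ρ hR him t ht
    -- Pairing each solution with its own `ρ` leaves bounded factors and a single `1/ρ`.
    have e : f ρ = P.weylDiff k D Dk (ρ ^ 2) * (ρ * P.S k.succ x (ρ ^ 2)) *
        (ρ * P.S k.succ t (ρ ^ 2)) * 2 / ρ := by
      rw [hf]; simp only; rw [spectralKernel, weylDiff]; field_simp
    rw [e, norm_div, norm_mul, norm_mul, norm_mul, Complex.norm_two]
    gcongr

/-- The minus sign in front of `F` cancels that of the parametrization, and `dμ = 2θ dσ` turns
`1/(2πi)` into `1/(πi)`. The line `s'` may differ from `s`, which frees the estimates from the given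
parabola. -/
theorem kernelF_eq {s s' : ℝ} (hs : τ ≤ s) (hs' : τ ≤ s') (o : ℂ) {x t : ℝ}
    (hx : x ∈ Icc 0 (P.T k.succ)) (ht : t ∈ Icc 0 (P.T k.succ)) :
    kernelF P k D Dk s o x t =
      kerF (P.T_pos k.succ).le (P.intervalIntegrable_qc k.succ) s'
        (fun σ => o / (Real.pi * Complex.I) * P.weylDiff k D Dk (linePoint s' σ ^ 2)) x t := by
  rw [kernelF, parabolaIntegral, h.integral_parabolaIntegrand_eq hτ hΔ hB0 hB hδ hs hs' hx ht]
  simp only [P.parabolaIntegrand_eq k D Dk hx ht, kerF, mul_assoc (o / _)]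
  rw [integral_const_mul, integral_const_mul]
  have hpi : (Real.pi : ℂ) ≠ 0 := Complex.ofReal_ne_zero.2 Real.pi_ne_zero
  field_simp

end IsPerturbation

theorem exists_edge_constant (k : Fin m) : ∃ C : ℝ, 0 < C ∧ ∀ τ₀ : ℝ, 0 < τ₀ →
    (∀ lam : ℂ, P.IsEigenvalue lam → InsideParabola τ₀ lam) → ∃ ε : ℝ, 0 < ε ∧
    ∀ τ : ℝ, τ₀ ≤ τ → ∀ o : ℂ, ‖o‖ = 1 → ∀ D Dk : ℂ → ℂ, P.IsPerturbation k D Dk →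
    deviation P k D Dk ≤ ENNReal.ofReal ε →
      (∀ σ : ℝ, P.Delta (linePoint τ σ ^ 2) ≠ 0 ∧ D (linePoint τ σ ^ 2) ≠ 0) ∧
      (∀ x ∈ Icc 0 (P.T k.succ), ∀ t ∈ Icc 0 (P.T k.succ),
        Integrable (parabolaIntegrand τ (spectralKernel P k D Dk x t))) ∧
      ∃ (K : ℝ → ℝ → ℂ) (dK : ℝ → ℂ),
        (∀ x ∈ Icc 0 (P.T k.succ), ContinuousOn (K x) (Icc 0 x) ∧
          SolvesGL (kernelF P k D Dk τ o) x (K x) ∧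
          ∀ κ : ℝ → ℂ, IntervalIntegrable κ volume 0 x →
            SolvesGL (kernelF P k D Dk τ o) x κ → EqOn κ (K x) (Icc 0 x)) ∧
        HasL2Deriv (P.T k.succ) (fun x => K x x) dK ∧
        (∀ lam : ℂ, ∃ dy : ℝ → ℂ,
          IsSLSolution (fun x => P.qc k.succ x + 2 * dK x) (P.T k.succ) lam
            (fun x => P.S k.succ x lam + ∫ t in (0 : ℝ)..x, K x t * P.S k.succ t lam) dy ∧
          dy 0 = 1) ∧
        eLpNorm dK 2 (volume.restrict (Ioc 0 (P.T k.succ))) ≤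
          ENNReal.ofReal C * deviation P k D Dk := by
  -- The line `Im θ = s` and everything entering the constant `A * c` are fixed before `τ₀` appears.
  obtain ⟨s, hs, hΔs⟩ := P.exists_Delta_ne_zero
  obtain ⟨Bs, hBs0, hBs⟩ := P.exists_Delta_bound hs hΔs k
  obtain ⟨A, hA, main⟩ := exists_transformation (P.T_pos k.succ).le
    (P.intervalIntegrable_qc k.succ) (P.T_pos k.succ) hs
  set c := (2 * Bs ^ 3 + 2 * Bs) * (√(2 * Real.pi) * Real.exp (|s| * P.totalLength)) with hc
  have hpi : 0 < √(2 * Real.pi) := Real.sqrt_pos.2 Real.two_pi_pos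
  have hc0 : 0 < c := by positivity
  set b := √(2 * P.totalLength) with hb
  have hb0 : 0 < b := Real.sqrt_pos.2 (mul_pos two_pos P.totalLength_pos)
  refine ⟨A * c, by positivity, fun τ₀ hτ₀ hev => ?_⟩
  have hΔ0 := P.Delta_ne_zero_of_inside hev
  -- This half-plane contains both the given line and the line `s`. It is zero-free as the union of
  -- the half-plane above `τ₀`, by the hypothesis on eigenvalues, and the one above `s`.
  set τ₁ := min τ₀ s with hτ₁
  have hτ₁0 : 0 < τ₁ := lt_min hτ₀ hs
  have hΔ1 : ∀ ρ : ℂ, τ₁ ≤ ρ.im → P.Delta (ρ ^ 2) ≠ 0 := fun ρ hρ =>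
    (min_le_iff.1 hρ).elim (hΔ0 ρ) (hΔs ρ)
  obtain ⟨B, hB0, hB⟩ := P.exists_Delta_bound hτ₁0 hΔ1 k
  -- The first bound keeps `Δ̃` zero-free above `τ₁`, which allows the shift. The second does the
  -- same above `s` with constants independent of `τ₀`. The third makes the weight small enough for
  -- `exists_transformation`.
  refine ⟨min (τ₁ / (2 * B * b)) (min (s / (2 * Bs * b)) (1 / (A * c))), by positivity,
    fun τ hτ o ho D Dk h hδ => ?_⟩
  set δ := (deviation P k D Dk).toReal with hδd
  have hδ' : δ ≤ min (τ₁ / (2 * B * b)) (min (s / (2 * Bs * b)) (1 / (A * c))) :=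
    ENNReal.toReal_le_of_le_ofReal (by positivity) hδ
  have hδe : ENNReal.ofReal δ = deviation P k D Dk := ENNReal.ofReal_toReal h.fin
  have d1 : 2 * B * (b * δ) ≤ τ₁ := by
    have := hδ'.trans (min_le_left _ _)
    rw [le_div_iff₀ (by positivity)] at this
    linarith
  have d2 : 2 * Bs * (b * δ) ≤ s := by
    have := hδ'.trans ((min_le_right _ _).trans (min_le_left _ _))
    rw [le_div_iff₀ (by positivity)] at this
    linarith
  have d3 : A * (c * δ) ≤ 1 := by
    have := hδ'.trans ((min_le_right _ _).trans (min_le_right _ _))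
    rw [le_div_iff₀ (by positivity)] at this
    linarith
  have hτ1 : τ₁ ≤ τ := (min_le_left _ _).trans hτ
  have hτ1s : τ₁ ≤ s := min_le_right _ _
  have mw := (h.memLp_weylDiff hs hΔs hBs0 hBs d2 le_rfl).const_mul (o / (Real.pi * Complex.I))
  -- The orientation enters only through a factor of modulus one, so it does not affect the
  -- smallness.
  have ho' : ‖o / (Real.pi * Complex.I)‖ ≤ 1 := by
    rw [norm_div, norm_mul, Complex.norm_I, mul_one, ho, Complex.norm_real,
      Real.norm_of_nonneg Real.pi_pos.le, div_le_one Real.pi_pos]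
    linarith [Real.pi_gt_three]
  have nw : eLpNorm (fun σ => o / (Real.pi * Complex.I) * P.weylDiff k D Dk (linePoint s σ ^ 2)) 2
      volume ≤ ENNReal.ofReal (c * δ) := by
    rw [ENNReal.ofReal_mul hc0.le, hδe]
    refine le_trans (eLpNorm_mono fun σ => ?_) (h.eLpNorm_weylDiff_le hs hΔs hBs0 hBs d2 le_rfl)
    rw [norm_mul]
    exact mul_le_of_le_one_left (norm_nonneg _) ho'
  have lw := ENNReal.toReal_le_of_le_ofReal (mul_nonneg hc0.le ENNReal.toReal_nonneg) nw
  obtain ⟨K, dK, hK, hd, hsol, hn⟩ := main _ mw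
    ((mul_le_mul_of_nonneg_left lw hA.le).trans d3)
  have hF := fun x (hx : x ∈ Icc 0 (P.T k.succ)) t (ht : t ∈ Icc 0 (P.T k.succ)) =>
    h.kernelF_eq hτ₁0 hΔ1 hB0 hB d1 hτ1 hτ1s o hx ht
  refine ⟨fun σ => ⟨hΔ1 _ (by rwa [linePoint_im]),
    (h.perturbed_ne_zero hτ₁0 hΔ1 hB0 hB d1 (by rwa [linePoint_im])).1⟩,
    fun x hx t ht => h.integrable_parabolaIntegrand hτ₁0 hΔ1 hB0 hB d1 hτ1 hx ht,
    K, dK, fun x hx => ?_, hd, fun lam => ?_, ?_⟩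
  · obtain ⟨k1, k2, k3⟩ := hK x hx
    exact ⟨k1, k2.congr hx fun u hu t ht => (hF u hu t ht).symm,
      fun κ hκ hs => k3 κ hκ (hs.congr hx hF)⟩
  · obtain ⟨dy, hy, hy0⟩ := hsol lam
    refine ⟨dy, ?_, hy0⟩
    have e : ∀ x ∈ Icc 0 (P.T k.succ), sSol (P.T_pos k.succ).le (P.intervalIntegrable_qc k.succ) x
        lam + ∫ t in (0 : ℝ)..x, K x t * sSol (P.T_pos k.succ).le (P.intervalIntegrable_qc k.succ)
          t lam = P.S k.succ x lam + ∫ t in (0 : ℝ)..x, K x t * P.S k.succ t lam := fun x hx => by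
      rw [P.sSol_eq _ hx]
      congr 1
      refine intervalIntegral.integral_congr fun t ht => ?_
      rw [uIcc_of_le hx.1] at ht
      rw [P.sSol_eq _ ⟨ht.1, ht.2.trans hx.2⟩]
    exact hy.congr (P.T_pos _).le fun x hx => (e x hx).symm
  · refine hn.trans ?_
    rw [← hδe, ← ENNReal.ofReal_mul (by positivity), mul_assoc A]
    exact ENNReal.ofReal_le_ofReal (mul_le_mul_of_nonneg_left lw hA.le)

end Problem

end LoopGraph

/-! ### Uniformity over the edges -/

theorem theorem4p1 {m : ℕ} (P : LoopGraph.Problem m) :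
    ∃ C : ℝ, 0 < C ∧
    ∀ τ₀ : ℝ, 0 < τ₀ →
      (∀ lam : ℂ, P.IsEigenvalue lam → LoopGraph.InsideParabola τ₀ lam) →
    ∃ ε : ℝ, 0 < ε ∧
    ∀ τ : ℝ, τ₀ ≤ τ →
    ∀ o : ℂ, (o = 1 ∨ o = -1) →
    ∀ k : Fin m,
    ∀ D Dk : ℂ → ℂ, Differentiable ℂ D → Differentiable ℂ Dk →
      LoopGraph.PaleyWiener P.totalLength
        (fun ρ => ρ ^ (m + 1) * (P.Delta (ρ ^ 2) - D (ρ ^ 2))) →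
      LoopGraph.PaleyWiener P.totalLength
        (fun ρ => ρ ^ m * (P.DeltaEdge k (ρ ^ 2) - Dk (ρ ^ 2))) →
      LoopGraph.deviation P k D Dk ≤ ENNReal.ofReal ε →
      -- the integral defining `F` is meaningful and converges absolutely
      (∀ σ : ℝ, P.Delta (LoopGraph.linePoint τ σ ^ 2) ≠ 0 ∧ D (LoopGraph.linePoint τ σ ^ 2) ≠ 0) ∧
      (∀ x ∈ Set.Icc 0 (P.T k.succ), ∀ t ∈ Set.Icc 0 (P.T k.succ),
        MeasureTheory.Integrable
          (LoopGraph.parabolaIntegrand τ (LoopGraph.spectralKernel P k D Dk x t))) ∧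
      ∃ K : ℝ → ℝ → ℂ,
        -- `K(x, ·)` is the unique solution of the Gelfand–Levitan-type equation
        (∀ x ∈ Set.Icc 0 (P.T k.succ),
          ContinuousOn (K x) (Set.Icc 0 x) ∧
          LoopGraph.SolvesGL (LoopGraph.kernelF P k D Dk τ o) x (K x) ∧
          ∀ κ : ℝ → ℂ, IntervalIntegrable κ MeasureTheory.volume 0 x →
            LoopGraph.SolvesGL (LoopGraph.kernelF P k D Dk τ o) x κ →
            Set.EqOn κ (K x) (Set.Icc 0 x)) ∧
        -- `dK` is the derivative of `K(x, x)`, and the new potential is `q + 2 dK`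
        ∃ dK : ℝ → ℂ,
          LoopGraph.HasL2Deriv (P.T k.succ) (fun x => K x x) dK ∧
          (∀ lam : ℂ, ∃ dy : ℝ → ℂ,
            LoopGraph.IsSLSolution (fun x => P.qc k.succ x + 2 * dK x) (P.T k.succ) lam
              (fun x => P.S k.succ x lam + ∫ t in (0 : ℝ)..x, K x t * P.S k.succ t lam) dy ∧
            P.S k.succ 0 lam + ∫ t in (0 : ℝ)..0, K 0 t * P.S k.succ t lam = 0 ∧
            dy 0 = 1) ∧
          MeasureTheory.eLpNorm (fun x => P.qc k.succ x - (P.qc k.succ x + 2 * dK x)) 2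
              (MeasureTheory.volume.restrict (Set.Ioc 0 (P.T k.succ))) ≤
            ENNReal.ofReal C * LoopGraph.deviation P k D Dk := by
  choose c hc main using P.exists_edge_constant
  have lec : ∀ k, c k ≤ ∑ j, c j := fun k =>
    Finset.single_le_sum (fun j _ => (hc j).le) (Finset.mem_univ k)
  have hs : 0 ≤ ∑ j, c j := Finset.sum_nonneg fun j _ => (hc j).le
  -- The sum dominates the constant of each edge, the 1 keeps it positive when there are no edges,
  -- and the factor 2 comes from `q - q̃ = -2 dK`.
  refine ⟨2 * (1 + ∑ j, c j), by positivity, fun τ₀ hτ₀ hev => ?_⟩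
  choose e he main using fun k => main k τ₀ hτ₀ hev
  have hs' : 0 ≤ ∑ j, (e j)⁻¹ := Finset.sum_nonneg fun j _ => (inv_pos.2 (he j)).le
  -- A positive number below every `e k`, meaningful also for an empty family of edges.
  refine ⟨(1 + ∑ j, (e j)⁻¹)⁻¹, by positivity,
    fun τ hτ o ho k D Dk hD hDk h1 h2 hδ => ?_⟩
  have lee : (1 + ∑ j, (e j)⁻¹)⁻¹ ≤ e k := by
    refine inv_le_of_inv_le₀ (he k) ?_
    have := Finset.single_le_sum (f := fun j => (e j)⁻¹) (fun j _ => (inv_pos.2 (he j)).le)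
      (Finset.mem_univ k)
    linarith
  have hp : P.IsPerturbation k D Dk := ⟨hD, hDk, h1, h2, ne_top_of_le_ne_top ENNReal.ofReal_ne_top hδ⟩
  obtain ⟨r1, r2, K, dK, r3, r4, r5, r6⟩ := main k τ hτ o
    (by rcases ho with rfl | rfl <;> simp) D Dk hp (hδ.trans (ENNReal.ofReal_le_ofReal lee))
  refine ⟨r1, r2, K, r3, dK, r4, fun lam => ?_, ?_⟩
  · obtain ⟨dy, hy, hy0⟩ := r5 lam
    exact ⟨dy, hy, by rw [intervalIntegral.integral_same, add_zero, (P.S_spec k.succ lam).2.1], hy0⟩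
  · have hfun : (fun x => P.qc k.succ x - (P.qc k.succ x + 2 * dK x)) =
        fun x => (-2 : ℂ) * dK x := by
      ext x; ring
    rw [hfun]
    refine (MeasureTheory.eLpNorm_const_smul_le (c := (-2 : ℂ)) (f := dK)).trans ?_
    rw [ENNReal.ofReal_mul two_pos.le, mul_assoc]
    have h2 : ‖(-2 : ℂ)‖ₑ = ENNReal.ofReal 2 := by
      rw [← ofReal_norm, norm_neg, Complex.norm_two]
    rw [h2]
    gcongr
    refine r6.trans ?_
    gcongr
    linarith [lec k]
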